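/- A multitensor $(E,u,\sigma)$ on a category $V$ consists of functors $E_n:V^n\to V$ ($n\in\mathbb N$), a unit $u_X:X\to E_1X$ and substitutions $\sigma:E_i E_j X_{ij}\to E_{ij}X_{ij}$, natural and satisfying the unit and associativity axioms; $(V,E)$ is then a lax monoidal category. Its unary part is the monad $E_1$ on $V$, and $E$ is a functor operad when its unary part is the identity monad. $E$ is distributive when each $E_n$ preserves small coproducts in each variable, $\lambda$-accessible ($\lambda$ a regular cardinal) when each $E_n:V^n\to V$ preserves $\lambda$-filtered colimits, and accessible when it is $\lambda$-accessible for some $\lambda$. A lax monoidal functor $(H,\psi):(W,F)\to(V,E)$ is a functor $H:W\to V$ with coherences $\psi:E_i HX_i\to H F_i X_i$, natural and compatible with units and substitutions. Let $\textrm{Acc-DISTMULT}$ be the 2-category of pairs $(V,E)$ with $V$ a (locally small) cocomplete category and $E$ an accessible distributive multitensor on $V$, with lax monoidal functors as 1-cells and monoidal natural transformations as 2-cells; let $\textrm{Acc-FOp}$ be its full sub-2-category on the $(V,E)$ with $E$ a functor operad, and $I:\textrm{Acc-FOp}\to\textrm{Acc-DISTMULT}$ the inclusion. For a category $V$, let $\mathcal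 GV$ be the category of $V$-enriched graphs; an $E$-category is a $V$-graph $X$ with compositions $E_iX(x_{i-1},x_i)\to X(x_0,x_n)$ satisfying the unit and associativity axioms. The homs of an $E$-category are $E_1$-algebras, so that the category $E\text{-Cat}$ of $E$-categories has a forgetful functor to $\mathcal G(V^{E_1})$, where $V^{E_1}$ is the category of $E_1$-algebras and $U^{E_1}:V^{E_1}\to V$ is its forgetful functor. **Proposition.** There is a 2-functor $$C:\textrm{Acc-DISTMULT}\longrightarrow\textrm{Acc-FOp}$$ which is right 2-adjoint to the inclusion $I$ (so that $\textrm{Acc-FOp}$ is a coreflective sub-2-category), and whose value on each object $(V,E)$ is $C(V,E)=(V^{E_1},E')$, where $E'$ is a multitensor lifting $E$: $E'$ is a distributive functor operad on $V^{E_1}$, it is $\lambda$-accessible for every regular cardinal $\lambda$ for which $E$ is, and there is an isomorphism of categories $E'\text{-Cat}\cong E\text{-Cat}$ over $\mathcal G(V^{E_1})$ (hence over $\mathcal GV$). The component at $(V,E)$ of the counit of the 2-adjunction has $U^{E_1}$ as its underlying functor. -/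

import Mathlib

open CategoryTheory CategoryTheory.Limits CategoryTheory.Bicategory

set_option linter.checkUnivs false

universe w₁ w₂ v₁ v₂ u₁ u₂ v u

/-! ### Concatenation of finite sequences

`Fin.partialSum n i` is the total length of the blocks preceding the `i`-th cut, for a list of
blocks of lengths `n 0, ..., n (k - 1)`. -/

section Concatenation

variable {k m : ℕ} (n : Fin k → ℕ) (hm : ∑ i, n i = m)

theorem partialSum_last_eq : Fin.partialSum n (Fin.last k) = ∑ i, n i := by
  induction k with
  | zero => simp [Fin.last]
  | succ k ih =>
    rw [← Fin.succ_last, Fin.partialSum_succ, Fin.sum_univ_castSucc, ← ih]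
    exact congrArg (· + _) (Fin.partialSum_init (f := n) (Fin.last k)).symm

theorem partialSum_le_sum (i : Fin (k + 1)) : Fin.partialSum n i ≤ ∑ j, n j := by
  induction i using Fin.reverseInduction with
  | last => exact (partialSum_last_eq n).le
  | cast i ih => exact le_trans (by rw [Fin.partialSum_succ]; omega) ih

/-- The position, in the concatenated sequence, of the `j`-th entry of the `i`-th block. -/
def blockPos (i : Fin k) (j : Fin (n i)) : Fin m :=
  ⟨Fin.partialSum n i.castSucc + j, by
    have h := partialSum_le_sum n i.succ
    rw [Fin.partialSum_succ] at h
    omega⟩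

/-- The vertex of `{0, ..., m}` which is the `j`-th vertex of the `i`-th block. -/
def blockVertex (i : Fin k) (j : Fin (n i + 1)) : Fin (m + 1) :=
  ⟨Fin.partialSum n i.castSucc + j, by
    have h := partialSum_le_sum n i.succ
    rw [Fin.partialSum_succ] at h
    omega⟩

/-- The vertex of `{0, ..., m}` which is the `i`-th cut between blocks. -/
def cutVertex (i : Fin (k + 1)) : Fin (m + 1) :=
  ⟨Fin.partialSum n i, by
    have h := partialSum_le_sum n i
    omega⟩

theorem blockVertex_zero (i : Fin k) :
    blockVertex n hm i 0 = cutVertex n hm i.castSucc := rfl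

theorem blockVertex_last (i : Fin k) :
    blockVertex n hm i (Fin.last (n i)) = cutVertex n hm i.succ :=
  Fin.ext (Fin.partialSum_succ n i).symm

theorem cutVertex_zero : cutVertex n hm 0 = 0 :=
  Fin.ext (Fin.partialSum_zero n)

theorem cutVertex_last : cutVertex n hm (Fin.last k) = Fin.last m :=
  Fin.ext ((partialSum_last_eq n).trans hm)

end Concatenation

/-- `IsConcat Y X` says that the sequence `X` is the concatenation
`(Y₁₁, ..., Y₁ₙ₁, ..., Yₖ₁, ..., Yₖₙₖ)` of the sequences `Yᵢ`. -/
structure IsConcat {α : Type*} {k : ℕ} {n : Fin k → ℕ} (Y : ∀ i, Fin (n i) → α)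
    {m : ℕ} (X : Fin m → α) : Prop where
  length_eq : ∑ i, n i = m
  entry_eq : ∀ i j, Y i j = X (blockPos n length_eq i j)

namespace IsConcat

theorem canonical {α : Type*} {k m : ℕ} (n : Fin k → ℕ) (hm : ∑ i, n i = m) (X : Fin m → α) :
    IsConcat (fun i j => X (blockPos n hm i j)) X :=
  ⟨hm, fun _ _ => rfl⟩

theorem map {α β : Type*} {k : ℕ} {n : Fin k → ℕ} {Y : ∀ i, Fin (n i) → α}
    {m : ℕ} {X : Fin m → α} (h : IsConcat Y X) (f : α → β) :
    IsConcat (fun i j => f (Y i j)) (fun s => f (X s)) :=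
  ⟨h.length_eq, fun i j => congrArg f (h.entry_eq i j)⟩

/-- A sequence is the concatenation of its entries. -/
theorem singletons {α : Type*} {k : ℕ} (X : Fin k → α) :
    IsConcat (fun i (_ : Fin 1) => X i) X where
  length_eq := by simp
  entry_eq i j := by
    congr 1
    ext
    have : ∀ i : Fin (k + 1), Fin.partialSum (fun _ : Fin k => (1 : ℕ)) i = (i : ℕ) := fun i => by
      induction i using Fin.induction with
      | zero => simp
      | succ i ih => rw [Fin.partialSum_succ, ih]; simp
    simpa [blockPos] using (this i.castSucc).symm

/-- A sequence is the concatenation of the one-term list of sequences consisting of itself. -/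
theorem single {α : Type*} {m : ℕ} (X : Fin m → α) :
    IsConcat (fun (_ : Fin 1) j => X j) X where
  length_eq := by simp
  entry_eq i j := by
    obtain rfl : i = 0 := Subsingleton.elim _ _
    congr 1
    ext
    simp [blockPos]

end IsConcat

/-! ### Multitensors -/

/-- A multitensor (lax monoidal structure) `(E, u, σ)` on a category `V`: functors
`Eₙ : Vⁿ ⥤ V`, a unit `u : X ⟶ E₁ X`, and substitutions
`σ : Eᵢ Eⱼ Xᵢⱼ ⟶ Eᵢⱼ Xᵢⱼ`, natural and satisfying the unit and associativity axioms.
The substitution map is indexed by a list of sequences `Y` and a sequence `X` which is the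
concatenation of `Y` (so that `X` is determined by `Y`). -/
structure Multitensor (V : Type u) [Category.{v} V] where
  tensor (n : ℕ) : (Fin n → V) ⥤ V
  unit (X : V) : X ⟶ (tensor 1).obj (fun _ => X)
  subst {k : ℕ} {n : Fin k → ℕ} {Y : ∀ i, Fin (n i) → V} {m : ℕ} {X : Fin m → V}
    (h : IsConcat Y X) :
    (tensor k).obj (fun i => (tensor (n i)).obj (Y i)) ⟶ (tensor m).obj X
  unit_naturality {X Y : V} (f : X ⟶ Y) :
    f ≫ unit Y = unit X ≫ (tensor 1).map (fun _ => f)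
  subst_naturality {k m : ℕ} (n : Fin k → ℕ) (hm : ∑ i, n i = m) {X X' : Fin m → V}
    (f : ∀ s, X s ⟶ X' s) :
    (tensor k).map (fun i => (tensor (n i)).map (fun j => f (blockPos n hm i j))) ≫
        subst (IsConcat.canonical n hm X') =
      subst (IsConcat.canonical n hm X) ≫ (tensor m).map f
  /-- `E(X₁, ..., Xₖ) → E(E₁X₁, ..., E₁Xₖ) → E(X₁, ..., Xₖ)` is the identity. -/
  unit_inner {k : ℕ} (X : Fin k → V) :
    (tensor k).map (fun i => unit (X i)) ≫ subst (IsConcat.singletons X) = 𝟙 _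
  /-- `E(X₁, ..., Xₘ) → E₁E(X₁, ..., Xₘ) → E(X₁, ..., Xₘ)` is the identity. -/
  unit_outer {m : ℕ} (X : Fin m → V) :
    unit ((tensor m).obj X) ≫ subst (IsConcat.single X) = 𝟙 _
  /-- The two maps `Eᵢ Eⱼ Eₗ Xᵢⱼₗ → Eᵢⱼₗ Xᵢⱼₗ` agree: `X` is the concatenation of sequences
  `Wᵢ`, and each `Wᵢ` is the concatenation over `j` of the sequences `(Xᵢⱼₗ)ₗ`. -/
  subst_assoc {k m r : ℕ} (n : Fin k → ℕ) (hm : ∑ i, n i = m) (p : Fin m → ℕ)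
    (hr : ∑ s, p s = r) (X : Fin r → V) {q : Fin k → ℕ} {W : ∀ i, Fin (q i) → V}
    (hW : IsConcat W X)
    (hY : ∀ i, IsConcat
      (fun (j : Fin (n i)) (l : Fin (p (blockPos n hm i j))) =>
        X (blockPos p hr (blockPos n hm i j) l)) (W i)) :
    (tensor k).map (fun i => subst (hY i)) ≫ subst hW =
      subst (IsConcat.canonical n hm
        (fun s => (tensor (p s)).obj (fun l => X (blockPos p hr s l)))) ≫
        subst (IsConcat.canonical p hr X)

namespace Multitensor

variable {V : Type u} [Category.{v} V] (E : Multitensor V)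

/-- Substitution is natural in any compatible families of maps. -/
theorem subst_naturality_of_heq {k : ℕ} {n : Fin k → ℕ} {Y Y' : ∀ i, Fin (n i) → V} {m : ℕ}
    {X X' : Fin m → V} (h : IsConcat Y X) (h' : IsConcat Y' X')
    (g : ∀ i j, Y i j ⟶ Y' i j) (f : ∀ s, X s ⟶ X' s)
    (hgf : ∀ i j, HEq (g i j) (f (blockPos n h.length_eq i j))) :
    (E.tensor k).map (fun i => (E.tensor (n i)).map (g i)) ≫ E.subst h' =
      E.subst h ≫ (E.tensor m).map f := by
  obtain ⟨hm, hY⟩ := h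
  obtain ⟨_, hY'⟩ := h'
  obtain rfl : Y = fun i j => X (blockPos n hm i j) := funext fun i => funext fun j => hY i j
  obtain rfl : Y' = fun i j => X' (blockPos n hm i j) := funext fun i => funext fun j => hY' i j
  obtain rfl : g = fun i j => f (blockPos n hm i j) :=
    funext fun i => funext fun j => eq_of_heq (hgf i j)
  exact E.subst_naturality n hm f

/-- The unary part of a multitensor: the monad `E₁` on `V`. -/
def unary : Monad V where
  obj X := (E.tensor 1).obj (fun _ => X)
  map f := (E.tensor 1).map (fun _ => f)
  map_id X := (E.tensor 1).map_id (fun _ => X)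
  map_comp f g := (E.tensor 1).map_comp (fun _ => f) (fun _ => g)
  η := { app := E.unit, naturality := fun _ _ f => E.unit_naturality f }
  μ :=
    { app := fun X => E.subst (IsConcat.single (fun _ : Fin 1 => X))
      naturality := fun _ _ f =>
        E.subst_naturality_of_heq _ _ (fun _ _ => f) (fun _ => f) (fun _ _ => HEq.rfl) }
  assoc X := E.subst_assoc (fun _ : Fin 1 => 1) (by simp) (fun _ : Fin 1 => 1) (by simp)
    (fun _ => X) (IsConcat.single (fun _ : Fin 1 => X))
    (fun _ => IsConcat.single (fun _ : Fin 1 => X))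
  left_unit X := E.unit_outer (fun _ : Fin 1 => X)
  right_unit X := E.unit_inner (fun _ : Fin 1 => X)

/-- A functor operad is a multitensor whose unary part is the identity monad. -/
def IsFunctorOperad : Prop := E.unary = Monad.id V

/-- `E` is distributive when each `Eₙ` preserves (small) coproducts in each variable. Explicitly:
given cocones `ι a : Z a ⟶ W` in `Vⁿ` which are invertible in all variables other than the `i`-th
and which exhibit `W i` as the coproduct of the `Z a i`, the maps `Eₙ (ι a)` exhibit `Eₙ W` as the
coproduct of the `Eₙ (Z a)`. -/
def IsDistributive : Prop :=
  ∀ (n : ℕ) (i : Fin n) (J : Type v) (Z : J → Fin n → V) (W : Fin n → V)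
    (ι : ∀ a j, Z a j ⟶ W j),
    (∀ a j, j ≠ i → IsIso (ι a j)) →
    Nonempty (IsColimit (Cofan.mk (W i) (fun a => ι a i))) →
    Nonempty (IsColimit
      (Cofan.mk ((E.tensor n).obj W) (fun a => (E.tensor n).map (X := Z a) (Y := W) (ι a))))

/-- `E` is `κ`-accessible when every `Eₙ` preserves `κ`-filtered colimits. -/
def IsCardinalAccessible (κ : Cardinal.{v}) [Fact κ.IsRegular] : Prop :=
  ∀ n, (E.tensor n).IsCardinalAccessible κ

/-- `E` is accessible when it is `κ`-accessible for some regular cardinal `κ`. -/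
def IsAccessible : Prop :=
  ∃ (κ : Cardinal.{v}) (_ : Fact κ.IsRegular), E.IsCardinalAccessible κ

end Multitensor

/-! ### Enriched graphs -/

/-- A graph enriched in `V`. -/
structure VGraph (V : Type u) [Category.{v} V] where
  vertex : Type v
  hom : vertex → vertex → V

namespace VGraph

variable {V : Type u₁} [Category.{v} V] {W : Type u₂} [Category.{v} W]

/-- A morphism of `V`-graphs. -/
@[ext]
structure Hom (X Y : VGraph V) where
  onVertex : X.vertex → Y.vertex
  onHom : ∀ a b, X.hom a b ⟶ Y.hom (onVertex a) (onVertex b)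

/-- The category `𝒢V` of `V`-graphs. -/
instance : Category (VGraph V) where
  Hom := Hom
  id X := { onVertex := fun a => a, onHom := fun _ _ => 𝟙 _ }
  comp f g :=
    { onVertex := fun a => g.onVertex (f.onVertex a)
      onHom := fun a b => f.onHom a b ≫ g.onHom _ _ }
  id_comp f := by cases f; simp
  comp_id f := by cases f; simp
  assoc f g h := by simp

/-- The functor `𝒢F : 𝒢V ⥤ 𝒢W` induced by a functor `F : V ⥤ W`. -/
def mapFunctor (F : V ⥤ W) : VGraph V ⥤ VGraph W where
  obj X := { vertex := X.vertex, hom := fun a b => F.obj (X.hom a b) }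
  map f := { onVertex := f.onVertex, onHom := fun a b => F.map (f.onHom a b) }
  map_id X := by
    change Hom.mk _ _ = Hom.mk _ _
    congr 1
    funext a b
    exact F.map_id _
  map_comp f g := by
    change Hom.mk _ _ = Hom.mk _ _
    congr 1
    funext a b
    exact F.map_comp _ _

/-- `X.IsPath x a b Z` says that `a = x₀, ..., xₙ = b` is a sequence of vertices of `X`, and that
`Z` is the sequence of homs `X(x₀, x₁), ..., X(xₙ₋₁, xₙ)`. -/
structure IsPath (X : VGraph V) {n : ℕ} (x : Fin (n + 1) → X.vertex) (a b : X.vertex)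
    (Z : Fin n → V) : Prop where
  start : x 0 = a
  finish : x (Fin.last n) = b
  homs : ∀ i, Z i = X.hom (x i.castSucc) (x i.succ)

namespace IsPath

theorem canonical (X : VGraph V) {n : ℕ} (x : Fin (n + 1) → X.vertex) :
    X.IsPath x (x 0) (x (Fin.last n)) (fun i => X.hom (x i.castSucc) (x i.succ)) :=
  ⟨rfl, rfl, fun _ => rfl⟩

/-- The path of length one from `a` to `b`. -/
theorem edge (X : VGraph V) (a b : X.vertex) : X.IsPath ![a, b] a b (fun _ => X.hom a b) :=
  ⟨rfl, rfl, fun i => by obtain rfl : i = 0 := Subsingleton.elim _ _; rfl⟩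

variable (X : VGraph V) {k m : ℕ} (n : Fin k → ℕ) (hm : ∑ i, n i = m)
  (x : Fin (m + 1) → X.vertex)

/-- The `i`-th block of a path. -/
theorem block (i : Fin k) :
    X.IsPath (fun j => x (blockVertex n hm i j)) (x (cutVertex n hm i.castSucc))
      (x (cutVertex n hm i.succ))
      (fun j => X.hom (x (blockPos n hm i j).castSucc) (x (blockPos n hm i j).succ)) :=
  ⟨rfl, congrArg x (blockVertex_last n hm i), fun _ => rfl⟩

/-- The path obtained by composing each block of a path. -/
theorem cuts :
    X.IsPath (fun i => x (cutVertex n hm i)) (x 0) (x (Fin.last m))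
      (fun i => X.hom (x (cutVertex n hm i.castSucc)) (x (cutVertex n hm i.succ))) :=
  ⟨congrArg x (cutVertex_zero n hm), congrArg x (cutVertex_last n hm), fun _ => rfl⟩

end IsPath

end VGraph

/-! ### Categories enriched in a multitensor -/

/-- A category enriched in `E`: a `V`-graph with compositions
`κ : Eᵢ X(xᵢ₋₁, xᵢ) ⟶ X(x₀, xₙ)` satisfying the unit and associativity axioms. -/
structure EnrichedCat {V : Type u} [Category.{v} V] (E : Multitensor V) extends VGraph V where
  comp {n : ℕ} {x : Fin (n + 1) → vertex} {a b : vertex} {Z : Fin n → V}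
    (h : toVGraph.IsPath x a b Z) : (E.tensor n).obj Z ⟶ hom a b
  unit_comp (a b : vertex) :
    E.unit (hom a b) ≫ comp (VGraph.IsPath.edge toVGraph a b) = 𝟙 _
  subst_comp {k m : ℕ} (n : Fin k → ℕ) (hm : ∑ i, n i = m) (x : Fin (m + 1) → vertex) :
    (E.tensor k).map (fun i => comp (VGraph.IsPath.block toVGraph n hm x i)) ≫
        comp (VGraph.IsPath.cuts toVGraph n hm x) =
      E.subst (IsConcat.canonical n hm (fun s => hom (x s.castSucc) (x s.succ))) ≫
        comp (VGraph.IsPath.canonical toVGraph x)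

namespace EnrichedCat

variable {V : Type u} [Category.{v} V] {E : Multitensor V}

/-- An `E`-functor: a morphism of `V`-graphs compatible with the compositions. -/
@[ext]
structure Hom (X Y : EnrichedCat E) where
  toGraphHom : X.toVGraph ⟶ Y.toVGraph
  map_comp {n : ℕ} (x : Fin (n + 1) → X.vertex) :
    (E.tensor n).map (fun i => toGraphHom.onHom (x i.castSucc) (x i.succ)) ≫
        Y.comp (VGraph.IsPath.canonical Y.toVGraph (fun i => toGraphHom.onVertex (x i))) =
      X.comp (VGraph.IsPath.canonical X.toVGraph x) ≫ toGraphHom.onHom (x 0) (x (Fin.last n))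

/-- The category `E`-Cat of `E`-categories and `E`-functors. -/
instance : Category (EnrichedCat E) where
  Hom := Hom
  id X :=
    { toGraphHom := 𝟙 X.toVGraph
      map_comp := fun {n} x => by
        refine (congrArg (· ≫ _) ((E.tensor n).map_id _)).trans ?_
        exact (Category.id_comp _).trans (Category.comp_id _).symm }
  comp {X Y Z} f g :=
    { toGraphHom := f.toGraphHom ≫ g.toGraphHom
      map_comp := fun {n} x => by
        refine (congrArg (· ≫ _) ((E.tensor n).map_comp
          (fun i => f.toGraphHom.onHom (x i.castSucc) (x i.succ))
          (fun i => g.toGraphHom.onHom _ _))).trans ?_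
        refine (Category.assoc _ _ _).trans ?_
        refine (congrArg (_ ≫ ·) (g.map_comp (fun i => f.toGraphHom.onVertex (x i)))).trans ?_
        refine (Category.assoc _ _ _).symm.trans ?_
        refine (congrArg (· ≫ _) (f.map_comp x)).trans ?_
        exact Category.assoc _ _ _ }
  id_comp f := Hom.ext (Category.id_comp f.toGraphHom)
  comp_id f := Hom.ext (Category.comp_id f.toGraphHom)
  assoc f g h := Hom.ext (Category.assoc f.toGraphHom g.toGraphHom h.toGraphHom)

/-- The forgetful functor `Uᴱ : E-Cat ⥤ 𝒢V`. -/
def forget (E : Multitensor V) : EnrichedCat E ⥤ VGraph V where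
  obj X := X.toVGraph
  map f := f.toGraphHom

/-- The associativity axiom for arbitrary compatible families of homs. -/
theorem subst_comp_of_isPath (X : EnrichedCat E) {k m : ℕ} {n : Fin k → ℕ}
    {Y : ∀ i, Fin (n i) → V} {Z : Fin m → V} (hc : IsConcat Y Z)
    {x : Fin (m + 1) → X.vertex} {a b : X.vertex} (hx : X.IsPath x a b Z)
    {y : ∀ i, Fin (n i + 1) → X.vertex} {c d : Fin k → X.vertex}
    (hy : ∀ i, X.IsPath (y i) (c i) (d i) (Y i))
    {z : Fin (k + 1) → X.vertex} (hz : X.IsPath z a b (fun i => X.hom (c i) (d i)))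
    (hyx : ∀ i j, y i j = x (blockVertex n hc.length_eq i j))
    (hzx : ∀ i, z i = x (cutVertex n hc.length_eq i)) :
    (E.tensor k).map (fun i => X.comp (hy i)) ≫ X.comp hz = E.subst hc ≫ X.comp hx := by
  obtain ⟨hm, hYZ⟩ := hc
  obtain ⟨rfl, rfl, hZ⟩ := hx
  obtain rfl : Z = fun s => X.hom (x s.castSucc) (x s.succ) := funext hZ
  obtain rfl : Y = fun i j => X.hom (x (blockPos n hm i j).castSucc) (x (blockPos n hm i j).succ) :=
    funext fun i => funext fun j => hYZ i j
  obtain rfl : y = fun i j => x (blockVertex n hm i j) :=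
    funext fun i => funext fun j => hyx i j
  obtain rfl : z = fun i => x (cutVertex n hm i) := funext hzx
  obtain rfl : c = fun i => x (cutVertex n hm i.castSucc) :=
    funext fun i => (hy i).start.symm
  obtain rfl : d = fun i => x (cutVertex n hm i.succ) :=
    funext fun i => (hy i).finish.symm.trans (congrArg x (blockVertex_last n hm i))
  exact X.subst_comp n hm x

/-- Compatibility of an `E`-functor with composition, for arbitrary compatible families. -/
theorem Hom.map_comp_of_isPath {X Y : EnrichedCat E} (f : Hom X Y) {n : ℕ}
    {x : Fin (n + 1) → X.vertex} {a b : X.vertex} {Z : Fin n → V} (hx : X.IsPath x a b Z)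
    {y : Fin (n + 1) → Y.vertex} {Z' : Fin n → V}
    (hy : Y.IsPath y (f.toGraphHom.onVertex a) (f.toGraphHom.onVertex b) Z')
    (hyx : ∀ i, y i = f.toGraphHom.onVertex (x i)) (g : ∀ i, Z i ⟶ Z' i)
    (hg : ∀ i, HEq (g i) (f.toGraphHom.onHom (x i.castSucc) (x i.succ))) :
    (E.tensor n).map g ≫ Y.comp hy = X.comp hx ≫ f.toGraphHom.onHom a b := by
  obtain ⟨rfl, rfl, hZ⟩ := hx
  obtain rfl : Z = fun i => X.hom (x i.castSucc) (x i.succ) := funext hZ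
  obtain rfl : y = fun i => f.toGraphHom.onVertex (x i) := funext hyx
  obtain rfl : Z' = fun i => Y.hom (f.toGraphHom.onVertex (x i.castSucc))
    (f.toGraphHom.onVertex (x i.succ)) := funext hy.homs
  obtain rfl : g = fun i : Fin n => f.toGraphHom.onHom (x i.castSucc) (x i.succ) :=
    funext fun (i : Fin n) => eq_of_heq (hg i)
  exact f.map_comp x

/-- The homs of an `E`-category are algebras for the unary part of `E`. -/
def homAlgebra (X : EnrichedCat E) (a b : X.vertex) : E.unary.Algebra where
  A := X.hom a b
  a := X.comp (VGraph.IsPath.edge X.toVGraph a b)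
  unit := X.unit_comp a b
  assoc := by
    refine (X.subst_comp_of_isPath (IsConcat.single (fun _ : Fin 1 => X.hom a b))
      (VGraph.IsPath.edge X.toVGraph a b) (fun _ => VGraph.IsPath.edge X.toVGraph a b)
      (VGraph.IsPath.edge X.toVGraph a b) (fun i j => ?_) (fun i => ?_)).symm
    · obtain rfl : i = 0 := Subsingleton.elim _ _
      congr 1
      ext
      simp [blockVertex]
    · congr 1
      ext
      fin_cases i <;> simp [cutVertex, Fin.partialSum]

/-- The forgetful functor `E-Cat ⥤ 𝒢(V^{E₁})`, remembering the `E₁`-algebra structures of the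
homs. -/
def toAlgebraGraph (E : Multitensor V) : EnrichedCat E ⥤ VGraph E.unary.Algebra where
  obj X := { vertex := X.vertex, hom := X.homAlgebra }
  map {X Y} f :=
    { onVertex := f.toGraphHom.onVertex
      onHom := fun a b =>
        { f := f.toGraphHom.onHom a b
          h := by
            refine f.map_comp_of_isPath (VGraph.IsPath.edge X.toVGraph a b)
              (VGraph.IsPath.edge Y.toVGraph _ _) (fun i => ?_) _ (fun i => ?_)
            · fin_cases i <;> rfl
            · obtain rfl : i = 0 := Subsingleton.elim _ _
              rfl } }

theorem toAlgebraGraph_comp_mapFunctor (E : Multitensor V) :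
    toAlgebraGraph E ⋙ VGraph.mapFunctor E.unary.forget = forget E := rfl

end EnrichedCat

/-! ### The 2-category of lax monoidal categories -/

/-- A lax monoidal category: a category equipped with a multitensor. -/
structure LaxMonCat where
  carrier : Type u
  [category : Category.{v} carrier]
  mult : Multitensor carrier

attribute [instance] LaxMonCat.category

namespace LaxMonCat

/-- A lax monoidal functor `(H, ψ) : (V, E) ⟶ (W, F)`, with coherences
`ψ : Fᵢ H Xᵢ ⟶ H Eᵢ Xᵢ`. -/
@[ext]
structure Hom (A B : LaxMonCat.{v, u}) where
  functor : A.carrier ⥤ B.carrier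
  coh {n : ℕ} (X : Fin n → A.carrier) :
    (B.mult.tensor n).obj (fun i => functor.obj (X i)) ⟶ functor.obj ((A.mult.tensor n).obj X)
  coh_naturality {n : ℕ} {X Y : Fin n → A.carrier} (f : ∀ i, X i ⟶ Y i) :
    (B.mult.tensor n).map (fun i => functor.map (f i)) ≫ coh Y =
      coh X ≫ functor.map ((A.mult.tensor n).map f)
  unit_coh (X : A.carrier) :
    B.mult.unit (functor.obj X) ≫ coh (fun _ => X) = functor.map (A.mult.unit X)
  subst_coh {k : ℕ} {n : Fin k → ℕ} {Y : ∀ i, Fin (n i) → A.carrier} {m : ℕ}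
    {X : Fin m → A.carrier} (h : IsConcat Y X) :
    (B.mult.tensor k).map (fun i => coh (Y i)) ≫
        coh (fun i => (A.mult.tensor (n i)).obj (Y i)) ≫ functor.map (A.mult.subst h) =
      B.mult.subst (h.map functor.obj) ≫ coh X

/-- A monoidal natural transformation between lax monoidal functors. -/
@[ext]
structure Hom₂ {A B : LaxMonCat.{v, u}} (H K : Hom A B) where
  natTrans : H.functor ⟶ K.functor
  coh_natTrans {n : ℕ} (X : Fin n → A.carrier) :
    (B.mult.tensor n).map (fun i => natTrans.app (X i)) ≫ K.coh X =
      H.coh X ≫ natTrans.app ((A.mult.tensor n).obj X)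

instance (A B : LaxMonCat.{v, u}) : Category (Hom A B) where
  Hom := Hom₂
  id H :=
    { natTrans := 𝟙 H.functor
      coh_natTrans := fun {n} X => by
        refine (congrArg (· ≫ _) ((B.mult.tensor n).map_id _)).trans ?_
        exact (Category.id_comp _).trans (Category.comp_id _).symm }
  comp {H K L} φ θ :=
    { natTrans := φ.natTrans ≫ θ.natTrans
      coh_natTrans := fun {n} X => by
        refine (congrArg (· ≫ _) ((B.mult.tensor n).map_comp
          (fun i => φ.natTrans.app (X i)) (fun i => θ.natTrans.app (X i)))).trans ?_
        refine (Category.assoc _ _ _).trans ?_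
        refine (congrArg (_ ≫ ·) (θ.coh_natTrans X)).trans ?_
        refine (Category.assoc _ _ _).symm.trans ?_
        refine (congrArg (· ≫ _) (φ.coh_natTrans X)).trans ?_
        exact Category.assoc _ _ _ }
  id_comp φ := Hom₂.ext (Category.id_comp φ.natTrans)
  comp_id φ := Hom₂.ext (Category.comp_id φ.natTrans)
  assoc φ θ χ := Hom₂.ext (Category.assoc φ.natTrans θ.natTrans χ.natTrans)

@[ext]
theorem hom₂_ext {A B : LaxMonCat.{v, u}} {H K : Hom A B} {φ θ : H ⟶ K}
    (h : φ.natTrans = θ.natTrans) : φ = θ :=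
  Hom₂.ext h

@[simp]
theorem id_natTrans {A B : LaxMonCat.{v, u}} (H : Hom A B) :
    Hom₂.natTrans (𝟙 H) = 𝟙 H.functor := rfl

@[simp]
theorem comp_natTrans {A B : LaxMonCat.{v, u}} {H K L : Hom A B} (φ : H ⟶ K) (θ : K ⟶ L) :
    (φ ≫ θ).natTrans = φ.natTrans ≫ θ.natTrans := rfl

theorem subst_coh_aux {C : Type*} [Category* C] {a₁ a₂ a₃ a₄ a₅ a₆ b₁ b₂ b₃ : C}
    {t₁ : a₁ ⟶ a₂} {t₂ : a₂ ⟶ a₃} {c₁ : a₃ ⟶ a₄} {c₂ : a₄ ⟶ a₅} {s : a₅ ⟶ a₆}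
    {c : a₂ ⟶ b₁} {k : b₁ ⟶ a₄} {s' : b₁ ⟶ b₂} {l : b₂ ⟶ a₆} {σ : a₁ ⟶ b₃} {r : b₃ ⟶ b₂}
    (h₃ : t₂ ≫ c₁ = c ≫ k) (h₁ : k ≫ c₂ ≫ s = s' ≫ l) (h₂ : t₁ ≫ c ≫ s' = σ ≫ r) :
    (t₁ ≫ t₂) ≫ (c₁ ≫ c₂) ≫ s = σ ≫ r ≫ l := by
  have e₁ : t₂ ≫ c₁ ≫ c₂ ≫ s = c ≫ s' ≫ l := by
    rw [← h₁, ← Category.assoc, h₃, Category.assoc]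
  have e₂ : t₁ ≫ c ≫ s' ≫ l = σ ≫ r ≫ l := by
    rw [← Category.assoc σ r l, ← h₂, Category.assoc, Category.assoc]
  rw [Category.assoc, Category.assoc, e₁, e₂]

instance : CategoryStruct LaxMonCat.{v, u} where
  Hom := Hom
  id A :=
    { functor := 𝟭 A.carrier
      coh := fun _ => 𝟙 _
      coh_naturality := fun _ => (Category.comp_id _).trans (Category.id_comp _).symm
      unit_coh := fun _ => Category.comp_id _
      subst_coh := fun {k n Y m X} h => by
        refine (congrArg (· ≫ _) ((A.mult.tensor k).map_id _)).trans ?_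
        refine (Category.id_comp _).trans ?_
        exact (Category.id_comp _).trans (Category.comp_id _).symm }
  comp {A B C} H K :=
    { functor := H.functor ⋙ K.functor
      coh := fun X => K.coh (fun i => H.functor.obj (X i)) ≫ K.functor.map (H.coh X)
      coh_naturality := fun {n X Y} f => by
        have h₁ := K.coh_naturality (fun i => H.functor.map (f i))
        have h₂ := congrArg K.functor.map (H.coh_naturality f)
        simp only [Functor.map_comp] at h₂
        refine (Category.assoc _ _ _).symm.trans ((congrArg (· ≫ _) h₁).trans ?_)
        refine (Category.assoc _ _ _).trans ((congrArg (_ ≫ ·) h₂).trans ?_)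
        exact (Category.assoc _ _ _).symm
      unit_coh := fun X => by
        have h₁ := K.unit_coh (H.functor.obj X)
        have h₂ := congrArg K.functor.map (H.unit_coh X)
        simp only [Functor.map_comp] at h₂
        exact (Category.assoc _ _ _).symm.trans ((congrArg (· ≫ _) h₁).trans h₂)
      subst_coh := fun {k n Y m X} h => by
        have h₁ := congrArg K.functor.map (H.subst_coh h)
        simp only [Functor.map_comp] at h₁
        have h₂ := K.subst_coh (h.map H.functor.obj)
        have h₃ := K.coh_naturality (fun i => H.coh (Y i))
        have h₄ := (C.mult.tensor k).map_comp
          (fun i => K.coh (fun j => H.functor.obj (Y i j)))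
          (fun i => K.functor.map (H.coh (Y i)))
        exact (congrArg (· ≫ _) h₄).trans (subst_coh_aux h₃ h₁ h₂) }

/-- The identity 2-cell between lax monoidal functors with the same underlying data. -/
def idCell {A B : LaxMonCat.{v, u}} {H : A.carrier ⥤ B.carrier}
    {c c' : ∀ {n : ℕ} (X : Fin n → A.carrier),
      (B.mult.tensor n).obj (fun i => H.obj (X i)) ⟶ H.obj ((A.mult.tensor n).obj X)}
    {h₁ h₂ h₃ h₁' h₂' h₃'} (hc : ∀ {n : ℕ} (X : Fin n → A.carrier), c X = c' X) :
    (Hom.mk H c h₁ h₂ h₃ : Hom A B) ≅ Hom.mk H c' h₁' h₂' h₃' where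
  hom :=
    { natTrans := 𝟙 H
      coh_natTrans := fun {n} X => by
        refine (congrArg (· ≫ _) ((B.mult.tensor n).map_id _)).trans ?_
        exact (Category.id_comp _).trans ((hc X).symm.trans (Category.comp_id _).symm) }
  inv :=
    { natTrans := 𝟙 H
      coh_natTrans := fun {n} X => by
        refine (congrArg (· ≫ _) ((B.mult.tensor n).map_id _)).trans ?_
        exact (Category.id_comp _).trans ((hc X).trans (Category.comp_id _).symm) }
  hom_inv_id := Hom₂.ext (Category.id_comp (𝟙 H))
  inv_hom_id := Hom₂.ext (Category.id_comp (𝟙 H))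

/-- The 2-category of lax monoidal categories, lax monoidal functors and monoidal natural
transformations. -/
instance : Bicategory LaxMonCat.{v, u} where
  homCategory A B := inferInstanceAs (Category (Hom A B))
  whiskerLeft {A B C} H K L η :=
    { natTrans := Functor.whiskerLeft H.functor η.natTrans
      coh_natTrans := fun {n} X => by
        have h₁ := η.coh_natTrans (fun i => H.functor.obj (X i))
        have h₂ := η.natTrans.naturality (H.coh X)
        refine (Category.assoc _ _ _).symm.trans ((congrArg (· ≫ _) h₁).trans ?_)
        refine (Category.assoc _ _ _).trans ((congrArg (_ ≫ ·) h₂.symm).trans ?_)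
        exact (Category.assoc _ _ _).symm }
  whiskerRight {A B C} H K η L :=
    { natTrans := Functor.whiskerRight η.natTrans L.functor
      coh_natTrans := fun {n} X => by
        have h₁ := L.coh_naturality (fun i => η.natTrans.app (X i))
        have h₂ := congrArg L.functor.map (η.coh_natTrans X)
        simp only [Functor.map_comp] at h₂
        refine (Category.assoc _ _ _).symm.trans ((congrArg (· ≫ _) h₁).trans ?_)
        refine (Category.assoc _ _ _).trans ((congrArg (_ ≫ ·) h₂).trans ?_)
        exact (Category.assoc _ _ _).symm }
  associator H K L := idCell fun X => by
    refine (congrArg (_ ≫ ·) (L.functor.map_comp _ _)).trans ?_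
    exact (Category.assoc _ _ _).symm
  leftUnitor H := idCell fun X =>
    (congrArg (_ ≫ ·) (H.functor.map_id _)).trans (Category.comp_id _)
  rightUnitor H := idCell fun X => Category.id_comp _
  whiskerLeft_id := by
    intros
    exact Hom₂.ext (NatTrans.ext (funext fun X => rfl))
  whiskerLeft_comp := by
    intros
    exact Hom₂.ext (NatTrans.ext (funext fun X => rfl))
  id_whiskerLeft := by
    intros
    exact Hom₂.ext (NatTrans.ext (funext fun X =>
      ((Category.id_comp _).trans (Category.comp_id _)).symm))
  comp_whiskerLeft := by
    intros
    exact Hom₂.ext (NatTrans.ext (funext fun X =>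
      ((Category.id_comp _).trans (Category.comp_id _)).symm))
  id_whiskerRight _ g := Hom₂.ext (NatTrans.ext (funext fun X => g.functor.map_id _))
  comp_whiskerRight _ _ i := Hom₂.ext (NatTrans.ext (funext fun X => i.functor.map_comp _ _))
  whiskerRight_id := by
    intros
    exact Hom₂.ext (NatTrans.ext (funext fun X =>
      ((Category.id_comp _).trans (Category.comp_id _)).symm))
  whiskerRight_comp := by
    intros
    exact Hom₂.ext (NatTrans.ext (funext fun X =>
      ((Category.id_comp _).trans (Category.comp_id _)).symm))
  whisker_assoc := by
    intros
    exact Hom₂.ext (NatTrans.ext (funext fun X =>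
      ((Category.id_comp _).trans (Category.comp_id _)).symm))
  whisker_exchange η θ := Hom₂.ext (NatTrans.ext (funext fun X =>
    (θ.natTrans.naturality (η.natTrans.app X)).symm))
  pentagon _ _ _ i := Hom₂.ext (NatTrans.ext (funext fun X =>
    (congrArg (· ≫ _) (i.functor.map_id _)).trans
      (congrArg (_ ≫ ·) (Category.id_comp _))))
  triangle _ g := Hom₂.ext (NatTrans.ext (funext fun X =>
    (Category.id_comp _).trans (g.functor.map_id _).symm))

theorem hom_eq {A B : LaxMonCat.{v, u}} {H : A.carrier ⥤ B.carrier}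
    {c c' : ∀ {n : ℕ} (X : Fin n → A.carrier),
      (B.mult.tensor n).obj (fun i => H.obj (X i)) ⟶ H.obj ((A.mult.tensor n).obj X)}
    {h₁ h₂ h₃ h₁' h₂' h₃'} (hc : ∀ {n : ℕ} (X : Fin n → A.carrier), c X = c' X) :
    (Hom.mk H c h₁ h₂ h₃ : Hom A B) = Hom.mk H c' h₁' h₂' h₃' := by
  obtain rfl : @c = @c' := funext fun n => funext fun X => hc X
  rfl

theorem eqToHom_natTrans_app {A B : LaxMonCat.{v, u}} {H K : A ⟶ B} (h : H = K) (X : A.carrier) :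
    (Hom₂.natTrans (eqToHom h)).app X =
      eqToHom (congrArg (fun L : Hom A B => L.functor.obj X) h) := by
  subst h
  rfl

theorem id_comp_eq {A B : LaxMonCat.{v, u}} (H : A ⟶ B) : 𝟙 A ≫ H = H :=
  hom_eq fun _ => (congrArg (_ ≫ ·) (H.functor.map_id _)).trans (Category.comp_id _)

theorem comp_id_eq {A B : LaxMonCat.{v, u}} (H : A ⟶ B) : H ≫ 𝟙 B = H :=
  hom_eq fun _ => Category.id_comp _

theorem assoc_eq {A B C D : LaxMonCat.{v, u}} (H : A ⟶ B) (K : B ⟶ C) (L : C ⟶ D) :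
    (H ≫ K) ≫ L = H ≫ K ≫ L :=
  hom_eq fun _ => (congrArg (_ ≫ ·) (L.functor.map_comp _ _)).trans (Category.assoc _ _ _).symm

instance : Bicategory.Strict LaxMonCat.{v, u} where
  id_comp := id_comp_eq
  comp_id := comp_id_eq
  assoc := assoc_eq
  leftUnitor_eqToIso H := Iso.ext <| Hom₂.ext <| NatTrans.ext <| funext fun X =>
    (eqToHom_natTrans_app (id_comp_eq H) X).symm
  rightUnitor_eqToIso H := Iso.ext <| Hom₂.ext <| NatTrans.ext <| funext fun X =>
    (eqToHom_natTrans_app (comp_id_eq H) X).symm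
  associator_eqToIso H K L := Iso.ext <| Hom₂.ext <| NatTrans.ext <| funext fun X =>
    (eqToHom_natTrans_app (assoc_eq H K L) X).symm

end LaxMonCat

/-- An accessible distributive lax monoidal category: a cocomplete category with an accessible
distributive multitensor. -/
structure AccDistMultObj extends LaxMonCat.{v, u} where
  hasColimits : HasColimits carrier
  isDistributive : mult.IsDistributive
  isAccessible : mult.IsAccessible

/-- The 2-category `Acc-DISTMULT`: the full sub-2-category of the 2-category of lax monoidal
categories on the cocomplete categories with an accessible distributive multitensor. -/
abbrev AccDistMult := InducedBicategory LaxMonCat.{v, u} AccDistMultObj.toLaxMonCat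

/-- An object of `Acc-DISTMULT` whose multitensor is a functor operad. -/
structure AccFOpObj extends AccDistMultObj.{v, u} where
  isFunctorOperad : mult.IsFunctorOperad

/-- The underlying object of `Acc-DISTMULT`. -/
abbrev AccFOpObj.toAccDistMult (A : AccFOpObj.{v, u}) : AccDistMult.{v, u} :=
  A.toAccDistMultObj

/-- The 2-category `Acc-FOp`: the full sub-2-category of `Acc-DISTMULT` on the functor operads. -/
abbrev AccFOp := InducedBicategory AccDistMult.{v, u} AccFOpObj.toAccDistMult

/-- The inclusion 2-functor `I : Acc-FOp ⥤ Acc-DISTMULT`. -/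
abbrev AccFOp.inclusion : StrictPseudofunctor AccFOp.{v, u} AccDistMult.{v, u} :=
  InducedBicategory.forget

/-! ### Strict 2-adjunctions -/

/-- A 2-adjunction `F ⊣ G` between 2-functors of (strict) 2-categories: isomorphisms of
hom-categories `C(F b, c) ≅ B(b, G c)`, 2-natural in `b` and `c`. The 2-naturality conditions are
equalities of functors `C(c, c') ⥤ C(F b, c) ⥤ B(b, G c')` and
`B(b', b) ⥤ C(F b, c) ⥤ B(b', G c)`. -/
structure TwoAdjunction {B : Type u₁} [Bicategory.{w₁, v₁} B] {C : Type u₂}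
    [Bicategory.{w₂, v₂} C] (F : StrictPseudofunctor B C) (G : StrictPseudofunctor C B) where
  homFunctor (b : B) (c : C) : (F.obj b ⟶ c) ⥤ (b ⟶ G.obj c)
  invFunctor (b : B) (c : C) : (b ⟶ G.obj c) ⥤ (F.obj b ⟶ c)
  hom_inv (b : B) (c : C) : homFunctor b c ⋙ invFunctor b c = 𝟭 _
  inv_hom (b : B) (c : C) : invFunctor b c ⋙ homFunctor b c = 𝟭 _
  naturality_right (b : B) (c c' : C) :
    postcomposing (F.obj b) c c' ⋙ (Functor.whiskeringRight _ _ _).obj (homFunctor b c') =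
      G.mapFunctor c c' ⋙ postcomposing b (G.obj c) (G.obj c') ⋙
        (Functor.whiskeringLeft _ _ _).obj (homFunctor b c)
  naturality_left (b b' : B) (c : C) :
    F.mapFunctor b' b ⋙ precomposing (F.obj b') (F.obj b) c ⋙
        (Functor.whiskeringRight _ _ _).obj (homFunctor b' c) =
      precomposing b' b (G.obj c) ⋙ (Functor.whiskeringLeft _ _ _).obj (homFunctor b c)

/-- The counit `F (G c) ⟶ c` of a 2-adjunction. -/
def TwoAdjunction.counit {B : Type u₁} [Bicategory.{w₁, v₁} B] {C : Type u₂}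
    [Bicategory.{w₂, v₂} C] {F : StrictPseudofunctor B C} {G : StrictPseudofunctor C B}
    (adj : TwoAdjunction F G) (c : C) : F.obj (G.obj c) ⟶ c :=
  (adj.invFunctor (G.obj c) c).obj (𝟙 (G.obj c))

/-! ### Lifted multitensors -/

/-- `IsLift E E'` says that `E'` is a lift of the multitensor `E` on `V` to the category `V^{E₁}`
of algebras of the unary part of `E`: `E'` is a distributive functor operad, `κ`-accessible
whenever `E` is, and there is an isomorphism of categories `E'-Cat ≅ E-Cat` over `𝒢(V^{E₁})`
(and hence over `𝒢V`). -/
structure Multitensor.IsLift {V : Type u} [Category.{v} V] (E : Multitensor V)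
    (E' : Multitensor E.unary.Algebra) : Prop where
  isFunctorOperad : E'.IsFunctorOperad
  isDistributive : E'.IsDistributive
  isCardinalAccessible : ∀ (κ : Cardinal.{v}) [Fact κ.IsRegular],
    E.IsCardinalAccessible κ → E'.IsCardinalAccessible κ
  enrichedCat_iso : ∃ (Φ : EnrichedCat E' ⥤ EnrichedCat E) (Ψ : EnrichedCat E ⥤ EnrichedCat E'),
    Φ ⋙ Ψ = 𝟭 _ ∧ Ψ ⋙ Φ = 𝟭 _ ∧
      Φ ⋙ EnrichedCat.toAlgebraGraph E = EnrichedCat.forget E'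

/-! For algebras `X₁, ..., Xₙ` of `E₁`, the lifted tensor `E'(X₁, ..., Xₙ)` is the hom from `0` to
`n` in the free `E`-category on the linear graph `0 → 1 → ... → n` whose `i`-th edge carries `Xᵢ`.
Only homs `p ≤ q` matter there, so the work is done with ordered `E`-categories on a preorder
(`OCat`). By freeness, maps `Xⱼ ⟶ Z(cⱼ, dⱼ)` along a path from `a` to `b` in any ordered category
`Z` induce a map `E'(X) ⟶ Z(a, b)` (`HasFree.ext`). The multitensor axioms for E' then reduce to
comparing generators (`ext_comp`, `map_ext`, `subst_ext`). For one algebra the free ordered category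
is built by hand with `X` itself as its nontrivial hom, so that `E'₁` is strictly the identity.

Free ordered categories exist by accessibility. Ordered categories on `I` are algebras for the
functor `F` of formal compositions along paths, acting on families indexed by intervals. `E` need
not be distributive at this point, so `F` need not be a monad; a second functor `G` of formal
compositions of compositions takes the place of `F ∘ F`. Partial algebras are completed to algebras
by a transfinite iteration which converges once `F` and `G` preserve colimits of its length
(`exists_reflection`). This provides quotients of ordered categories by relations. Applied to the
evident free ordered category on objects of `V`, whose homs are values of `E`, they give free ones
on algebras. Applied to the free one on a single algebra, they give coequalizers of algebras, hence
all colimits of algebras when `E` is distributive.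

That E' is distributive and accessible is shown by gluing. Given a colimit cocone on the sequence
`W`, the colimits of the homs of the free ordered categories on the terms of the diagram form again
an ordered category `T`, because `E` preserves these colimits. The generators of the free ordered
category on `W` lift to `T`, so the comparison map out of `T` has a section, and this section is an
inverse on the hom from `0` to `n`.

An `E`-category is an ordered category on the indiscrete preorder of its vertices, and `ext` makes
it an `E'`-category. Conversely the compositions of an `E'`-category are determined by the
underlying `E`-compositions (`comp_eq_ext`), whence the isomorphism of categories over graphs of
algebras.

For the adjunction, let `H` be a lax monoidal functor from a functor operad to `(V, E)`. Every
object of its source is an algebra in exactly one way, so `H` takes values in `E₁`-algebras, and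
`ext` supplies the coherences of a lift to E' (`sharp`). By `comp_eq_ext` again, the coherences of
any lift are forced (`coh_eq_ext`), and 2-cells lift uniquely. Composition with the forgetful
functor is therefore an isomorphism of hom-categories, and a family of such universal arrows
determines a strict right 2-adjoint. -/

/-! ### Algebras for a two-stage theory -/

/-- Operations `F` with identities `η`, together with composable pairs of operations `G`, their
composites `μ` and their evaluation `lift` along a partial action `F Q ⟶ R`. -/
structure TwoStage (C : Type u) [Category.{v} C] where
  F : C ⥤ C
  G : C ⥤ C
  η : 𝟭 C ⟶ F
  μ : G ⟶ F
  outer : F ⟶ G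
  lift {Q R : C} (a : F.obj Q ⟶ R) : G.obj Q ⟶ F.obj R
  lift_naturality {Q R Q' R' : C} (f : Q ⟶ Q') (g : R ⟶ R') (a : F.obj Q ⟶ R)
    (b : F.obj Q' ⟶ R') (w : F.map f ≫ b = a ≫ g) : G.map f ≫ lift b = lift a ≫ F.map g
  outer_μ (Q : C) : outer.app Q ≫ μ.app Q = 𝟙 _
  outer_lift {Q R : C} (a : F.obj Q ⟶ R) : outer.app Q ≫ lift a = a ≫ η.app R

namespace TwoStage

variable {C : Type u} [Category.{v} C] (T : TwoStage C)

/-- The structure maps of algebras for a two-stage theory. -/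
structure IsAlgebra {Z : C} (z : T.F.obj Z ⟶ Z) : Prop where
  unit : T.η.app Z ≫ z = 𝟙 Z
  assoc : T.lift z ≫ z = T.μ.app Z ≫ z

/-- Partial algebras: objects `Q`, `R` with an action `F Q ⟶ R`. -/
abbrev Partial := Comma T.F (𝟭 C)

namespace Partial

/-- The action, forgetting the identity functor. -/
abbrev act (X : T.Partial) : T.F.obj X.left ⟶ X.right := X.hom

/-- The map `Q ⟶ R` given by the identity operation. -/
def incl (X : T.Partial) : X.left ⟶ X.right := T.η.app X.left ≫ X.act

variable {T}

theorem act_naturality {X Y : T.Partial} (f : X ⟶ Y) :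
    T.F.map f.left ≫ Y.act = X.act ≫ f.right := f.w

theorem act_naturality_assoc {X Y : T.Partial} (f : X ⟶ Y) {Z : C} (g : Y.right ⟶ Z) :
    T.F.map f.left ≫ Y.act ≫ g = X.act ≫ f.right ≫ g := by
  rw [← Category.assoc, act_naturality, Category.assoc]

theorem incl_naturality {X Y : T.Partial} (f : X ⟶ Y) :
    f.left ≫ Y.incl = X.incl ≫ f.right := by
  have h := T.η.naturality f.left
  simp only [Functor.id_map] at h
  rw [incl, incl, ← Category.assoc, h, Category.assoc, Category.assoc, act_naturality]

theorem incl_naturality_assoc {X Y : T.Partial} (f : X ⟶ Y) {Z : C} (g : Y.right ⟶ Z) :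
    f.left ≫ Y.incl ≫ g = X.incl ≫ f.right ≫ g := by
  rw [← Category.assoc, incl_naturality, Category.assoc]

end Partial

variable {T}

/-- An algebra as a partial algebra. -/
abbrev ofAct {Z : C} (z : T.F.obj Z ⟶ Z) : T.Partial := { left := Z, right := Z, hom := z }

/-- In an algebra the identity operation acts as the identity, so a map from a partial algebra to an
algebra carries no more information than its component on the second object. -/
theorem IsAlgebra.left_eq_right {X : T.Partial} {Z : C} {z : T.F.obj Z ⟶ Z} (hz : T.IsAlgebra z)
    (f : X ⟶ ofAct z) : f.left = X.incl ≫ f.right := by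
  have h := Partial.incl_naturality f
  rw [← h]
  refine (Category.comp_id _).symm.trans (congrArg (f.left ≫ ·) ?_)
  exact hz.unit.symm

/-! ### Colimits of partial algebras. -/

section Colimits

variable {J : Type*} [Category* J] [HasColimitsOfShape J C] [HasPushouts C] (K : J ⥤ T.Partial)

/-- The canonical map from the colimit of the actions. -/
noncomputable def colimPost :
    colimit ((K ⋙ Comma.fst _ _) ⋙ T.F) ⟶ T.F.obj (colimit (K ⋙ Comma.fst _ _)) :=
  colimit.post _ _

/-- The colimit of the actions. -/
noncomputable def colimAct :
    colimit ((K ⋙ Comma.fst _ _) ⋙ T.F) ⟶ colimit (K ⋙ Comma.snd _ _) :=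
  colimMap { app := fun j => (K.obj j).hom, naturality := fun _ _ f => (K.map f).w }

/-- A colimit cocone of partial algebras. -/
noncomputable def colimCocone : Cocone K where
  -- `T.F` need not preserve the colimit, so the action on the colimit of the values of `F` is
  -- pushed out along the comparison map `colimPost`.
  pt := { left := colimit (K ⋙ Comma.fst _ _)
          right := pushout (colimPost K) (colimAct K)
          hom := pushout.inl _ _ }
  ι :=
    { app := fun j =>
        { left := colimit.ι (K ⋙ Comma.fst _ _) j
          right := colimit.ι (K ⋙ Comma.snd _ _) j ≫ pushout.inr _ _
          w := by
            have h₁ : colimit.ι ((K ⋙ Comma.fst _ _) ⋙ T.F) j ≫ colimPost K =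
              T.F.map (colimit.ι (K ⋙ Comma.fst _ _) j) := colimit.ι_post _ _ _
            have h₂ : colimit.ι ((K ⋙ Comma.fst _ _) ⋙ T.F) j ≫ colimAct K =
              (K.obj j).hom ≫ colimit.ι (K ⋙ Comma.snd _ _) j := ι_colimMap _ _
            have h₃ := congrArg (colimit.ι ((K ⋙ Comma.fst _ _) ⋙ T.F) j ≫ ·)
              (pushout.condition (f := colimPost K) (g := colimAct K))
            simp only [← Category.assoc, h₁, h₂] at h₃
            exact h₃.trans (Category.assoc _ _ _) }
      naturality := fun i j f => by
        apply CommaMorphism.ext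
        · exact (colimit.w (K ⋙ Comma.fst _ _) f).trans (Category.comp_id _).symm
        · refine Eq.trans ?_ (Category.comp_id _).symm
          exact (Category.assoc _ _ _).symm.trans
            (congrArg (· ≫ _) (colimit.w (K ⋙ Comma.snd _ _) f)) }

/-- The cocone `colimCocone` is colimiting. -/
noncomputable def isColimitColimCocone : IsColimit (colimCocone K) := by
  refine IsColimit.ofExistsUnique fun s => ?_
  let l : colimit (K ⋙ Comma.fst _ _) ⟶ s.pt.left :=
    colimit.desc (K ⋙ Comma.fst _ _) ((Comma.fst _ _).mapCocone s)
  let r : colimit (K ⋙ Comma.snd _ _) ⟶ s.pt.right :=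
    colimit.desc (K ⋙ Comma.snd _ _) ((Comma.snd _ _).mapCocone s)
  have hl : ∀ j, colimit.ι (K ⋙ Comma.fst _ _) j ≫ l = (s.ι.app j).left :=
    fun j => colimit.ι_desc _ _
  have hr : ∀ j, colimit.ι (K ⋙ Comma.snd _ _) j ≫ r = (s.ι.app j).right :=
    fun j => colimit.ι_desc _ _
  have hw : colimPost K ≫ T.F.map l ≫ s.pt.hom = colimAct K ≫ r := by
    refine colimit.hom_ext fun j => ?_
    have h₁ : colimit.ι ((K ⋙ Comma.fst _ _) ⋙ T.F) j ≫ colimPost K =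
      T.F.map (colimit.ι (K ⋙ Comma.fst _ _) j) := colimit.ι_post _ _ _
    have h₂ : colimit.ι ((K ⋙ Comma.fst _ _) ⋙ T.F) j ≫ colimAct K =
      (K.obj j).hom ≫ colimit.ι (K ⋙ Comma.snd _ _) j := ι_colimMap _ _
    rw [← Category.assoc, h₁, ← Category.assoc, ← T.F.map_comp, hl, ← Category.assoc, h₂]
    refine (s.ι.app j).w.trans ?_
    refine Eq.trans ?_ (Category.assoc _ _ _).symm
    exact congrArg ((K.obj j).hom ≫ ·) (hr j).symm
  refine ⟨{ left := l, right := pushout.desc (T.F.map l ≫ s.pt.hom) r hw, w := ?_ }, ?_, ?_⟩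
  · exact (pushout.inl_desc _ _ hw).symm
  · intro j
    apply CommaMorphism.ext
    · exact hl j
    · refine (Category.assoc _ _ _).trans ?_
      exact (congrArg (_ ≫ ·) (pushout.inr_desc _ _ hw)).trans (hr j)
  · intro m hm
    have hml : m.left = l := colimit.hom_ext fun j =>
      (congrArg CommaMorphism.left (hm j)).trans (hl j).symm
    apply CommaMorphism.ext
    · exact hml
    · apply pushout.hom_ext
      · refine Eq.trans ?_ (pushout.inl_desc _ _ hw).symm
        rw [← hml]
        exact m.w.symm
      · refine Eq.trans ?_ (pushout.inr_desc _ _ hw).symm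
        refine colimit.hom_ext fun j => ?_
        refine Eq.trans ?_ (hr j).symm
        exact (Category.assoc _ _ _).symm.trans (congrArg CommaMorphism.right (hm j))

instance hasColimitsOfShape_partial : HasColimitsOfShape J T.Partial where
  has_colimit K := ⟨⟨⟨colimCocone K, isColimitColimCocone K⟩⟩⟩

end Colimits

/-! ### One step of the free algebra construction. -/

section Successor

variable [HasCoequalizers C]

/-- The next stage of a partial algebra. -/
noncomputable def succ (X : T.Partial) : T.Partial where
  left := X.right
  right := coequalizer (T.lift X.act) (T.μ.app X.left ≫ T.F.map X.incl)
  hom := coequalizer.π _ _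

theorem succ_condition (X : T.Partial) :
    T.lift X.act ≫ (succ X).act = T.μ.app X.left ≫ T.F.map X.incl ≫ (succ X).act :=
  (coequalizer.condition (T.lift X.act) (T.μ.app X.left ≫ T.F.map X.incl)).trans
    (Category.assoc _ _ _)

-- Precomposing the coequalizer relation with a section of `μ` yields the square which makes
-- `toSucc` a map of partial algebras. This is what `T.outer` is for.
omit [HasCoequalizers C] in
theorem outer_condition {a b c d e : C} {o : a ⟶ b} {m : b ⟶ a} {l : b ⟶ c} {f : a ⟶ c}
    {π : c ⟶ d} {x : a ⟶ e} {i : e ⟶ c} (om : o ≫ m = 𝟙 a) (ol : o ≫ l = x ≫ i)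
    (h : l ≫ π = m ≫ f ≫ π) : f ≫ π = x ≫ i ≫ π := by
  rw [← Category.assoc x, ← ol, Category.assoc, h, ← Category.assoc, om, Category.id_comp]

/-- The inclusion into the next stage. -/
noncomputable def toSucc (X : T.Partial) : X ⟶ succ X where
  left := X.incl
  right := (succ X).incl
  w := outer_condition (T.outer_μ X.left) (T.outer_lift X.act) (succ_condition X)

/-- Maps of partial algebras along which the target of the first action is absorbed. -/
def IsAbsorbing {X Y : T.Partial} (f : X ⟶ Y) : Prop :=
  ∃ s : X.right ⟶ Y.left, X.incl ≫ s = f.left ∧ s ≫ Y.incl = f.right ∧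
    T.lift X.act ≫ T.F.map s ≫ Y.act = T.μ.app X.left ≫ T.F.map f.left ≫ Y.act

/-- The second object of `X` is the first object of `succ X`, so the identity serves as the
diagonal, and the remaining equation is the coequalizer relation. -/
theorem isAbsorbing_toSucc (X : T.Partial) : IsAbsorbing (toSucc X) := by
  refine ⟨𝟙 _, Category.comp_id _, Category.id_comp _, ?_⟩
  refine Eq.trans ?_ (succ_condition X)
  refine congrArg (_ ≫ ·) ?_
  exact (congrArg (· ≫ _) (T.F.map_id _)).trans (Category.id_comp _)

-- Needed because the successor maps of the transfinite iteration are `toSucc` followed by an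
-- identification.
omit [HasCoequalizers C] in
theorem IsAbsorbing.comp {X Y Z : T.Partial} {f : X ⟶ Y} (hf : IsAbsorbing f) (g : Y ⟶ Z) :
    IsAbsorbing (f ≫ g) := by
  obtain ⟨s, h₁, h₂, h₃⟩ := hf
  refine ⟨s ≫ g.left, ?_, ?_, ?_⟩
  · rw [← Category.assoc, h₁, Comma.comp_left]
  · rw [Category.assoc, Partial.incl_naturality, ← Category.assoc, h₂, Comma.comp_right]
  · rw [Comma.comp_left, T.F.map_comp, T.F.map_comp, Category.assoc, Category.assoc,
      Partial.act_naturality]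
    have := congrArg (· ≫ g.right) h₃
    simpa only [Category.assoc] using this

/-- The associativity axiom of an algebra says that a map into it respects the relation imposed by
the coequalizer. By `left_eq_right` an extension is determined by its first component, which has to
be `f.right`. -/
theorem toSucc_extend_existsUnique (X : T.Partial) {Z : C} {z : T.F.obj Z ⟶ Z}
    (hz : T.IsAlgebra z) : Function.Bijective (fun g : succ X ⟶ ofAct z => toSucc X ≫ g) := by
  have key : ∀ g : succ X ⟶ ofAct z, (toSucc X ≫ g).right = g.left := fun g =>
    Comma.comp_right.trans (hz.left_eq_right g).symm
  constructor
  · intro g g' h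
    have hl : g.left = g'.left := by rw [← key, ← key]; exact congrArg CommaMorphism.right h
    apply CommaMorphism.ext hl
    apply coequalizer.hom_ext (f := T.lift X.act) (g := T.μ.app X.left ≫ T.F.map X.incl)
    refine g.w.symm.trans (Eq.trans ?_ g'.w)
    rw [hl]
  · intro f
    have hf := hz.left_eq_right f
    have hw := Partial.act_naturality f
    have hc : T.lift X.act ≫ T.F.map f.right ≫ z =
        (T.μ.app X.left ≫ T.F.map X.incl) ≫ T.F.map f.right ≫ z := by
      have h₁ := T.lift_naturality f.left f.right X.act z hw
      rw [← Category.assoc, ← h₁, Category.assoc, hz.assoc, ← Category.assoc, T.μ.naturality,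
        Category.assoc, Category.assoc, ← T.F.map_comp_assoc X.incl, ← hf]
    let g : succ X ⟶ ofAct z :=
      { left := f.right
        right := coequalizer.desc (T.F.map f.right ≫ z) hc
        w := (coequalizer.π_desc (f := T.lift X.act)
          (g := T.μ.app X.left ≫ T.F.map X.incl) _ hc).symm }
    refine ⟨g, ?_⟩
    apply CommaMorphism.ext
    · exact hf.symm
    · exact key g

end Successor

/-! ### Chains in which every step is absorbing. -/

section Chain

variable {J : Type*} [LinearOrder J] [SuccOrder J] (K : J ⥤ T.Partial)
  (hK : ∀ j, IsAbsorbing (K.map (homOfLE (Order.le_succ j))))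
  {c : Cocone (K ⋙ Comma.fst _ _)} (hc : IsColimit c)
  (hF : IsColimit (T.F.mapCocone c)) (hG : IsColimit (T.G.mapCocone c))

include hK hc hF hG

/-- Each second object is absorbed by the first object of the next stage, so the actions assemble to
an action of the colimit of the first objects on itself. Preservation of the colimit by `F` defines
this action; preservation by `G` allows the associativity axiom to be tested on stages, where it is
the last clause of `IsAbsorbing`. -/
theorem exists_isAlgebra_of_isAbsorbing :
    ∃ (z : T.F.obj c.pt ⟶ c.pt) (_ : T.IsAlgebra z) (d : Cocone K) (_ : IsColimit d),
      d.pt = ofAct z := by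
  choose s hs₁ hs₂ hs₃ using hK
  let t : ∀ j, (K.obj j).right ⟶ c.pt := fun j => s j ≫ c.ι.app (Order.succ j)
  have hcw : ∀ {i j : J} (h : i ⟶ j), (K.map h).left ≫ c.ι.app j = c.ι.app i := fun h => c.w h
  -- The map `s i` leads from stage `i` to its successor, so compatibility is first proved for
  -- indices beyond the successor. In a linear order the only other morphisms are identities.
  have ht' : ∀ {i j : J} (h : i ⟶ j), Order.succ i ≤ j → (K.map h).right ≫ t j = t i := by
    intro i j h hij
    have e : h = homOfLE (Order.le_succ i) ≫ homOfLE hij := Subsingleton.elim _ _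
    rw [e, K.map_comp, Comma.comp_right, ← hs₂, Category.assoc, Category.assoc,
      ← Partial.incl_naturality_assoc, ← Category.assoc _ (s j), hs₁, hcw, hcw]
  have ht : ∀ {i j : J} (h : i ⟶ j), (K.map h).right ≫ t j = t i := by
    intro i j h
    rcases (leOfHom h).lt_or_eq with h' | h'
    · exact ht' h (Order.succ_le_of_lt h')
    · subst h'
      obtain rfl : h = 𝟙 _ := Subsingleton.elim _ _
      rw [K.map_id]
      exact Category.id_comp _
  let zc : Cocone ((K ⋙ Comma.fst _ _) ⋙ T.F) :=
    { pt := c.pt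
      ι := { app := fun j => (K.obj j).act ≫ t j
             naturality := fun i j h => by
              have h₁ := Partial.act_naturality (K.map h)
              refine Eq.trans ?_ (Category.comp_id _).symm
              change T.F.map (K.map h).left ≫ (K.obj j).act ≫ t j = _
              rw [← Category.assoc, h₁, Category.assoc, ht] } }
  let z : T.F.obj c.pt ⟶ c.pt := hF.desc zc
  have hz : ∀ j, T.F.map (c.ι.app j) ≫ z = (K.obj j).act ≫ t j := fun j => hF.fac zc j
  have hit : ∀ j, (K.obj j).incl ≫ t j = c.ι.app j := fun j => by
    rw [← Category.assoc, hs₁, hcw]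
  refine ⟨z, ⟨?_, ?_⟩, ?_⟩
  · refine hc.hom_ext fun j => ?_
    have h := T.η.naturality_assoc (c.ι.app j) z
    rw [hz] at h
    refine h.trans (Eq.trans ?_ (Category.comp_id _).symm)
    refine Eq.trans ?_ (hit j)
    exact (Category.assoc _ _ _).symm
  · refine hG.hom_ext fun j => ?_
    change T.G.map (c.ι.app j) ≫ _ = T.G.map (c.ι.app j) ≫ _
    have hμ : T.G.map (c.ι.app j) ≫ T.μ.app c.pt ≫ z = T.μ.app (K.obj j).left ≫
      T.F.map (c.ι.app j) ≫ z := T.μ.naturality_assoc (c.ι.app j) z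
    rw [hμ, hz, ← Category.assoc, T.lift_naturality (c.ι.app j) (t j) (K.obj j).act z (hz j),
      T.F.map_comp, Category.assoc, Category.assoc, hz, ← Category.assoc (T.F.map (s j)),
      ← Category.assoc, hs₃, Category.assoc, Category.assoc, Partial.act_naturality_assoc, ht]
  · let d : Cocone K :=
      { pt := ofAct z
        ι := { app := fun j => { left := c.ι.app j, right := t j, w := hz j }
               naturality := fun i j h => by
                apply CommaMorphism.ext
                · exact (hcw h).trans (Category.comp_id _).symm
                · exact (ht h).trans (Category.comp_id _).symm } }
    refine ⟨d, IsColimit.ofExistsUnique fun e => ?_, rfl⟩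
    let l : c.pt ⟶ e.pt.left := hc.desc ((Comma.fst _ _).mapCocone e)
    have hl : ∀ j, c.ι.app j ≫ l = (e.ι.app j).left :=
      fun j => hc.fac ((Comma.fst _ _).mapCocone e) j
    have her : ∀ {i j : J} (h : i ⟶ j), (K.map h).right ≫ (e.ι.app j).right =
        (e.ι.app i).right := fun h => congrArg CommaMorphism.right (e.w h)
    -- Every second object factors through the first object of the next stage, which forces the
    -- second component of the comparison map to be `l ≫ e.pt.incl`.
    have htr : ∀ j, t j ≫ l ≫ e.pt.incl = (e.ι.app j).right := fun j => by
      have h₁ : (e.ι.app (Order.succ j)).left ≫ e.pt.incl = _ :=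
        Partial.incl_naturality (e.ι.app (Order.succ j))
      rw [Category.assoc, ← Category.assoc _ l, hl, h₁, ← Category.assoc, hs₂, her]
    refine ⟨{ left := l, right := l ≫ e.pt.incl, w := ?_ }, fun j => ?_, fun m hm => ?_⟩
    · refine hF.hom_ext fun j => ?_
      change T.F.map (c.ι.app j) ≫ T.F.map l ≫ e.pt.act =
        T.F.map (c.ι.app j) ≫ z ≫ l ≫ e.pt.incl
      rw [← Category.assoc, ← T.F.map_comp, hl, ← Category.assoc _ z, hz, Category.assoc, htr]
      exact Partial.act_naturality _
    · exact CommaMorphism.ext (hl j) (htr j)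
    · have hml : m.left = l := hc.hom_ext fun j =>
        (congrArg CommaMorphism.left (hm j)).trans (hl j).symm
      apply CommaMorphism.ext hml
      have h := Partial.incl_naturality m
      change m.right = l ≫ e.pt.incl
      rw [← hml, h]
      have : Partial.incl T d.pt = 𝟙 _ := by
        refine hc.hom_ext fun j => ?_
        have h := T.η.naturality_assoc (c.ι.app j) z
        rw [hz] at h
        refine h.trans (Eq.trans ?_ (Category.comp_id _).symm)
        refine Eq.trans ?_ (hit j)
        exact (Category.assoc _ _ _).symm
      rw [this]
      exact (Category.id_comp _).symm

end Chain

/-! ### Reflecting partial algebras into algebras. -/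

section Reflection

open SmallObject

variable (T) in
/-- Partial algebras which are algebras. -/
def algebraProperty : ObjectProperty T.Partial := fun X =>
  ∃ (Z : C) (z : T.F.obj Z ⟶ Z), T.IsAlgebra z ∧ X = ofAct z

/-- The iteration of the passage to the next stage. -/
noncomputable def succStruct [HasCoequalizers C] (X : T.Partial) : SuccStruct T.Partial where
  X₀ := X
  succ := succ
  toSucc := toSucc

theorem bijective_precomp_comp_iso {D : Type*} [Category* D] {X A B Y : D} {i : X ⟶ A} (φ : A ≅ B)
    (h : Function.Bijective (fun g : A ⟶ Y => i ≫ g)) :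
    Function.Bijective (fun g : B ⟶ Y => (i ≫ φ.hom) ≫ g) := by
  have e : (fun g : B ⟶ Y => (i ≫ φ.hom) ≫ g) = (fun g => i ≫ g) ∘ (fun g => φ.hom ≫ g) :=
    funext fun g => Category.assoc _ _ _
  rw [e]
  exact h.comp ⟨fun g g' => (cancel_epi φ.hom).1, fun g => ⟨φ.inv ≫ g, φ.hom_inv_id_assoc g⟩⟩

/-- Iterating `succ` along `κ` arrives at an algebra because `F` and `G` preserve colimits of this
length. Maps into an algebra extend uniquely along each `toSucc`, and this property passes to
transfinite composites. -/
theorem exists_reflection [HasColimitsOfSize.{w₁, w₁} C] (κ : Cardinal.{w₁}) [Fact κ.IsRegular]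
    [PreservesColimitsOfShape κ.ord.ToType T.F] [PreservesColimitsOfShape κ.ord.ToType T.G]
    (X : T.Partial) :
    ∃ (Z : C) (z : T.F.obj Z ⟶ Z) (_ : T.IsAlgebra z) (i : X ⟶ ofAct z),
      ∀ (Y : C) (y : T.F.obj Y ⟶ Y), T.IsAlgebra y →
        Function.Bijective (fun g : ofAct z ⟶ ofAct y => i ≫ g) := by
  have : HasPushouts C := inferInstance
  have : HasColimitsOfSize.{w₁, w₁} T.Partial := ⟨fun _ _ => inferInstance⟩
  have : HasIterationOfShape κ.ord.ToType T.Partial := { }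
  have : HasCoequalizers C := inferInstance
  have : Nonempty κ.ord.ToType := by simpa using Cardinal.IsRegular.ne_zero Fact.out
  have := WellFoundedLT.toOrderBot κ.ord.ToType
  have : NoMaxOrder κ.ord.ToType :=
    Cardinal.noMaxOrder (Fact.elim inferInstance : κ.IsRegular).aleph0_le
  let H := (succStruct X).transfiniteCompositionOfShapeιIteration κ.ord.ToType
  have hK : ∀ j, IsAbsorbing (H.F.map (homOfLE (Order.le_succ j))) := by
    intro j
    change IsAbsorbing (((succStruct X).iterationFunctor κ.ord.ToType).map _)
    rw [SuccStruct.iterationFunctor_map_succ _ _ (not_isMax j)]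
    exact (isAbsorbing_toSucc _).comp _
  have hc := colimit.isColimit (H.F ⋙ Comma.fst _ _)
  obtain ⟨z, hz, d, hd, e⟩ := exists_isAlgebra_of_isAbsorbing H.F hK hc
    (isColimitOfPreserves T.F hc) (isColimitOfPreserves T.G hc)
  have hP : (algebraProperty T).isLocal ((succStruct X).ιIteration κ.ord.ToType) := by
    refine (algebraProperty T).isLocal.transfiniteCompositionsOfShape_le κ.ord.ToType _ ⟨H.ofLE ?_⟩
    rintro Z₀ _ _ ⟨_⟩
    rintro _ ⟨Y, y, hy, rfl⟩
    exact toSucc_extend_existsUnique Z₀ hy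
  let φ := (H.isColimit.coconePointUniqueUpToIso hd).trans (eqToIso e)
  refine ⟨_, z, hz, (succStruct X).ιIteration κ.ord.ToType ≫ φ.hom, fun Y y hy => ?_⟩
  exact bijective_precomp_comp_iso φ (hP (ofAct y) ⟨Y, y, hy, rfl⟩)

/-- An algebra `W` has a universal map to an algebra factoring through a given epimorphism. -/
theorem exists_quotient [HasColimitsOfSize.{w₁, w₁} C] (κ : Cardinal.{w₁}) [Fact κ.IsRegular]
    [PreservesColimitsOfShape κ.ord.ToType T.F] [PreservesColimitsOfShape κ.ord.ToType T.G]
    {W Q : C} {w : T.F.obj W ⟶ W} (hw : T.IsAlgebra w) (r : W ⟶ Q) [Epi r] :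
    ∃ (Z : C) (z : T.F.obj Z ⟶ Z) (φ : W ⟶ Z) (g : Q ⟶ Z), T.IsAlgebra z ∧
      T.F.map φ ≫ z = w ≫ φ ∧ r ≫ g = φ ∧
      ∀ (Y : C) (y : T.F.obj Y ⟶ Y) (ψ : W ⟶ Y) (g' : Q ⟶ Y), T.IsAlgebra y →
        T.F.map ψ ≫ y = w ≫ ψ → r ≫ g' = ψ →
        ∃! χ : Z ⟶ Y, T.F.map χ ≫ y = z ≫ χ ∧ φ ≫ χ = ψ := by
  -- A map from this partial algebra to an algebra amounts to an algebra map out of `W` with a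
  -- factorization of it through `r`, so its reflection is the quotient sought.
  obtain ⟨Z, z, hz, i, hi⟩ := exists_reflection κ
    ({ left := W, right := Q, hom := w ≫ r } : T.Partial)
  have hil : i.left = r ≫ i.right := by
    refine (hz.left_eq_right i).trans ?_
    refine congrArg (· ≫ i.right) ?_
    refine (Category.assoc _ _ _).symm.trans ?_
    exact (congrArg (· ≫ r) hw.unit).trans (Category.id_comp r)
  refine ⟨Z, z, i.left, i.right, hz, ?_, hil.symm, ?_⟩
  · refine (Partial.act_naturality i).trans ((Category.assoc _ _ _).trans ?_)
    rw [hil]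
  · intro Y y ψ g' hy hψ hg'
    let f : ({ left := W, right := Q, hom := w ≫ r } : T.Partial) ⟶ ofAct y :=
      { left := ψ
        right := g'
        w := by
          refine hψ.trans (Eq.trans ?_ (Category.assoc _ _ _).symm)
          exact congrArg (w ≫ ·) hg'.symm }
    obtain ⟨χ, hχ⟩ := (hi Y y hy).2 f
    have hχ' : χ.left = χ.right := (hy.left_eq_right χ).trans
      ((congrArg (· ≫ χ.right) hz.unit).trans (Category.id_comp _))
    refine ⟨χ.left, ⟨?_, ?_⟩, ?_⟩
    · refine (Partial.act_naturality χ).trans ?_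
      rw [hχ']
    · exact congrArg CommaMorphism.left hχ
    · rintro χ₁ ⟨h₁, h₂⟩
      let χ₂ : ofAct z ⟶ ofAct y := { left := χ₁, right := χ₁, w := h₁ }
      have : χ₂ = χ := by
        apply (hi Y y hy).1
        refine Eq.trans ?_ hχ.symm
        apply CommaMorphism.ext
        · exact h₂
        · refine (cancel_epi r).1 (Eq.trans ?_ hg'.symm)
          refine Eq.trans ?_ h₂
          change r ≫ i.right ≫ χ₁ = _
          rw [hil, Category.assoc]
      exact congrArg CommaMorphism.left this

end Reflection

end TwoStage

/-! ### Monotone paths -/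

namespace IsConcat

theorem map₂ {α β γ : Type*} {k : ℕ} {n : Fin k → ℕ} {Y : ∀ i, Fin (n i) → α}
    {Y' : ∀ i, Fin (n i) → β} {m : ℕ} {X : Fin m → α} {X' : Fin m → β} (h : IsConcat Y X)
    (h' : IsConcat Y' X') (f : α → β → γ) :
    IsConcat (fun i j => f (Y i j) (Y' i j)) (fun s => f (X s) (X' s)) :=
  ⟨h.length_eq, fun i j => congrArg₂ f (h.entry_eq i j) (h'.entry_eq i j)⟩

end IsConcat

/-- The entries of `c` and `d` are the sources and targets of the successive steps of a monotone
path from `a` to `b`. -/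
def MonoPath {I : Type*} [Preorder I] {k : ℕ} (c d : Fin k → I) (a b : I) : Prop :=
  ∃ x : Fin (k + 1) → I, Monotone x ∧ x 0 = a ∧ x (Fin.last k) = b ∧
    (∀ i, x i.castSucc = c i) ∧ ∀ i, x i.succ = d i

namespace MonoPath

variable {I : Type*} [Preorder I] {I' : Type*} [Preorder I'] {k m : ℕ}

theorem le {c d : Fin k → I} {a b : I} (h : MonoPath c d a b) : a ≤ b := by
  obtain ⟨x, hx, rfl, rfl, -, -⟩ := h
  exact hx (Fin.zero_le _)

theorem step {c d : Fin k → I} {a b : I} (h : MonoPath c d a b) (i : Fin k) : c i ≤ d i := by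
  obtain ⟨x, hx, -, -, hc, hd⟩ := h
  rw [← hc, ← hd]
  exact hx (Fin.castSucc_le_succ i)

theorem source_le {c d : Fin k → I} {a b : I} (h : MonoPath c d a b) (i : Fin k) : a ≤ c i := by
  obtain ⟨x, hx, rfl, -, hc, -⟩ := h
  rw [← hc]
  exact hx (Fin.zero_le _)

theorem le_target {c d : Fin k → I} {a b : I} (h : MonoPath c d a b) (i : Fin k) : d i ≤ b := by
  obtain ⟨x, hx, -, rfl, -, hd⟩ := h
  rw [← hd]
  exact hx (Fin.le_last _)

theorem of_monotone {x : Fin (k + 1) → I} (hx : Monotone x) :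
    MonoPath (fun i : Fin k => x i.castSucc) (fun i => x i.succ) (x 0) (x (Fin.last k)) :=
  ⟨x, hx, rfl, rfl, fun _ => rfl, fun _ => rfl⟩

theorem map {c d : Fin k → I} {a b : I} (h : MonoPath c d a b) {f : I → I'} (hf : Monotone f) :
    MonoPath (fun i => f (c i)) (fun i => f (d i)) (f a) (f b) := by
  obtain ⟨x, hx, rfl, rfl, hc, hd⟩ := h
  exact ⟨fun i => f (x i), hf.comp hx, rfl, rfl, fun i => congrArg f (hc i),
    fun i => congrArg f (hd i)⟩

theorem edge {p q : I} (h : p ≤ q) : MonoPath (fun _ : Fin 1 => p) (fun _ => q) p q := by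
  refine ⟨![p, q], ?_, rfl, rfl, fun i => ?_, fun i => ?_⟩
  · intro i j hij
    fin_cases i <;> fin_cases j
    · exact le_rfl
    · exact h
    · exact absurd hij (by decide)
    · exact le_rfl
  · obtain rfl : i = 0 := Subsingleton.elim _ _
    rfl
  · obtain rfl : i = 0 := Subsingleton.elim _ _
    rfl

end MonoPath

section Cuts

variable {k m : ℕ} (n : Fin k → ℕ) (hm : ∑ i, n i = m)

theorem monotone_partialSum : Monotone (Fin.partialSum n) :=
  Fin.monotone_iff_le_succ.2 fun i => by rw [Fin.partialSum_succ]; omega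

theorem monotone_cutVertex : Monotone (cutVertex n hm) := fun _ _ h => monotone_partialSum n h

theorem monotone_blockVertex (i : Fin k) : Monotone (blockVertex n hm i) :=
  fun _ _ h => Nat.add_le_add_left h _

end Cuts

namespace MonoPath

variable {I : Type*} [Preorder I] {k m : ℕ} {n : Fin k → ℕ} (hm : ∑ i, n i = m)

theorem cuts {x : Fin (m + 1) → I} (hx : Monotone x) :
    MonoPath (fun i => x (cutVertex n hm i.castSucc)) (fun i => x (cutVertex n hm i.succ))
      (x 0) (x (Fin.last m)) :=
  ⟨_, hx.comp (monotone_cutVertex n hm), congrArg x (cutVertex_zero n hm),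
    congrArg x (cutVertex_last n hm), fun _ => rfl, fun _ => rfl⟩

theorem block {x : Fin (m + 1) → I} (hx : Monotone x) (i : Fin k) :
    MonoPath (fun j => x (blockPos n hm i j).castSucc) (fun j => x (blockPos n hm i j).succ)
      (x (cutVertex n hm i.castSucc)) (x (cutVertex n hm i.succ)) :=
  ⟨_, hx.comp (monotone_blockVertex n hm i), rfl, congrArg x (blockVertex_last n hm i),
    fun _ => rfl, fun _ => rfl⟩

/-- The vertices of a path are determined by its sources and targets, so the path of cuts and all
the blocks can be read off from one function `x`. Arbitrary decompositions thereby reduce to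
canonical ones by substitution. -/
theorem exists_blocks {c d : Fin m → I} {c₂ d₂ : ∀ i, Fin (n i) → I} {c' d' : Fin k → I} {a b : I}
    (hc : IsConcat c₂ c) (hd : IsConcat d₂ d) (h : MonoPath c d a b) (h' : MonoPath c' d' a b)
    (h₂ : ∀ i, MonoPath (c₂ i) (d₂ i) (c' i) (d' i)) :
    ∃ x : Fin (m + 1) → I, Monotone x ∧ a = x 0 ∧ b = x (Fin.last m) ∧
      (c = fun s => x s.castSucc) ∧ (d = fun s => x s.succ) ∧
      (c' = fun i => x (cutVertex n hm i.castSucc)) ∧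
      (d' = fun i => x (cutVertex n hm i.succ)) ∧
      (c₂ = fun i j => x (blockPos n hm i j).castSucc) ∧
      (d₂ = fun i j => x (blockPos n hm i j).succ) := by
  obtain ⟨x, hx, rfl, rfl, hcx, hdx⟩ := h
  obtain ⟨z, hz, hz0, hzl, hcz, hdz⟩ := h'
  choose y hy hy0 hyl hcy hdy using h₂
  -- Induction over the cuts; inside a block, an induction over its vertices carries the equality
  -- from one cut to the next.
  have key : ∀ i, z i = x (cutVertex n hm i) := by
    intro i
    induction i using Fin.induction with
    | zero => rw [hz0, cutVertex_zero]
    | succ i ih =>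
      have hyi : ∀ j, y i j = x (blockVertex n hm i j) := by
        intro j
        induction j using Fin.induction with
        | zero => rw [hy0, ← hcz, ih]; rfl
        | succ j _ => rw [hdy, hd.entry_eq, ← hdx]; rfl
      rw [hdz, ← hyl, hyi, blockVertex_last]
  refine ⟨x, hx, rfl, rfl, funext fun s => (hcx s).symm, funext fun s => (hdx s).symm,
    funext fun i => (hcz i).symm.trans (key _), funext fun i => (hdz i).symm.trans (key _),
    funext fun i => funext fun j => (hc.entry_eq i j).trans (hcx _).symm,
    funext fun i => funext fun j => (hd.entry_eq i j).trans (hdx _).symm⟩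

end MonoPath

namespace Multitensor

variable {V : Type u} [Category.{v} V] {E : Multitensor V}

/-- The structure map of an algebra for the unary part of a multitensor. -/
def act (X : E.unary.Algebra) : (E.tensor 1).obj (fun _ => X.A) ⟶ X.A := X.a

theorem unit_act (X : E.unary.Algebra) : E.unit X.A ≫ act X = 𝟙 X.A := X.unit

theorem subst_act (X : E.unary.Algebra) :
    E.subst (IsConcat.single (fun _ : Fin 1 => X.A)) ≫ act X =
      (E.tensor 1).map (fun _ => act X) ≫ act X := X.assoc

theorem map_act {X Y : E.unary.Algebra} (f : X ⟶ Y) :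
    (E.tensor 1).map (fun _ => f.f) ≫ act Y = act X ≫ f.f := f.h

end Multitensor

/-! ### Ordered enriched categories -/

/-- An ordered `E`-category on a preorder `I`: homs `hom p q`, of which only those with `p ≤ q` are
relevant, which are algebras for the unary part of `E`, and compositions along monotone paths,
extending the algebra structures and satisfying the associativity axiom. -/
structure OCat {V : Type u} [Category.{v} V] (E : Multitensor V) (I : Type w₁) [Preorder I] where
  hom : I → I → E.unary.Algebra
  comp {k : ℕ} {c d : Fin k → I} {a b : I} (h : MonoPath c d a b) :
    (E.tensor k).obj (fun i => (hom (c i) (d i)).A) ⟶ (hom a b).A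
  comp_edge {p q : I} (h : MonoPath (fun _ : Fin 1 => p) (fun _ => q) p q) :
    comp h = Multitensor.act (hom p q)
  comp_subst {k m : ℕ} {n : Fin k → ℕ} {c d : Fin m → I} {c₂ d₂ : ∀ i, Fin (n i) → I}
    {c' d' : Fin k → I} {a b : I} (hc : IsConcat c₂ c) (hd : IsConcat d₂ d)
    (h : MonoPath c d a b) (h' : MonoPath c' d' a b)
    (h₂ : ∀ i, MonoPath (c₂ i) (d₂ i) (c' i) (d' i)) :
    (E.tensor k).map (fun i => comp (h₂ i)) ≫ comp h' =
      E.subst (hc.map₂ hd fun p q => (hom p q).A) ≫ comp h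

namespace OCat

variable {V : Type u} [Category.{v} V] {E : Multitensor V} {I : Type w₁} [Preorder I]

/-- A morphism of ordered `E`-categories which is the identity on vertices. -/
@[ext]
structure Hom (X Y : OCat E I) where
  app {p q : I} (h : p ≤ q) : X.hom p q ⟶ Y.hom p q
  app_comp {k : ℕ} {c d : Fin k → I} {a b : I} (h : MonoPath c d a b) :
    (E.tensor k).map (fun i => (app (h.step i)).f) ≫ Y.comp h = X.comp h ≫ (app h.le).f

/-- A morphism of ordered `E`-categories from maps in `V`. -/
def Hom.ofMaps {X Y : OCat E I} (f : ∀ {p q : I}, p ≤ q → ((X.hom p q).A ⟶ (Y.hom p q).A))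
    (hf : ∀ {k : ℕ} {c d : Fin k → I} {a b : I} (h : MonoPath c d a b),
      (E.tensor k).map (fun i => f (h.step i)) ≫ Y.comp h = X.comp h ≫ f h.le) : Hom X Y where
  app {p q} h :=
    { f := f h
      h := by
        have := hf (MonoPath.edge h)
        rw [Y.comp_edge, X.comp_edge] at this
        exact this }
  app_comp h := hf h

instance : Category (OCat E I) where
  Hom := Hom
  id X :=
    { app := fun _ => 𝟙 _
      app_comp := fun {k _ _ _ _} h => by
        refine (congrArg (· ≫ _) ((E.tensor k).map_id _)).trans ?_
        exact (Category.id_comp _).trans (Category.comp_id _).symm }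
  comp f g :=
    { app := fun h => f.app h ≫ g.app h
      app_comp := fun {k _ _ _ _} h => by
        refine (congrArg (· ≫ _) ((E.tensor k).map_comp
          (fun i => (f.app (h.step i)).f) (fun i => (g.app (h.step i)).f))).trans ?_
        refine (Category.assoc _ _ _).trans ?_
        refine (congrArg (_ ≫ ·) (g.app_comp h)).trans ?_
        refine (Category.assoc _ _ _).symm.trans ?_
        refine (congrArg (· ≫ _) (f.app_comp h)).trans ?_
        exact Category.assoc _ _ _ }
  id_comp f := by cases f; exact Hom.ext (by funext p q h; exact Category.id_comp _)
  comp_id f := by cases f; exact Hom.ext (by funext p q h; exact Category.comp_id _)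
  assoc f g h := Hom.ext (by funext p q h; exact Category.assoc _ _ _)

@[ext]
theorem hom_ext {X Y : OCat E I} {f g : X ⟶ Y}
    (h : ∀ {p q : I} (h : p ≤ q), (Hom.app f h).f = (Hom.app g h).f) : f = g :=
  Hom.ext (by funext p q hpq; exact Monad.Algebra.Hom.ext (h hpq))

/-- Restriction along a monotone map. -/
def pull (X : OCat E I) {I' : Type w₂} [Preorder I'] {y : I' → I} (hy : Monotone y) :
    OCat E I' where
  hom p q := X.hom (y p) (y q)
  comp h := X.comp (h.map hy)
  comp_edge h := X.comp_edge (h.map hy)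
  comp_subst hc hd h h' h₂ := X.comp_subst (hc.map y) (hd.map y) (h.map hy) (h'.map hy)
    fun i => (h₂ i).map hy

/-- Restriction of morphisms. -/
def pullMap {X Y : OCat E I} (f : X ⟶ Y) {I' : Type w₂} [Preorder I'] {y : I' → I}
    (hy : Monotone y) : X.pull hy ⟶ Y.pull hy where
  app h := Hom.app f (hy h)
  app_comp h := Hom.app_comp f (h.map hy)

end OCat

/-! ### Base change along a lax monoidal functor. -/

namespace LaxMonCat.Hom

variable {A B : LaxMonCat.{v, u}} (H : LaxMonCat.Hom A B)

/-- The functor induced by a lax monoidal functor on algebras for the unary parts. -/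
def mapAlgebra : A.mult.unary.Algebra ⥤ B.mult.unary.Algebra where
  obj X :=
    { A := H.functor.obj X.A
      a := H.coh (fun _ => X.A) ≫ H.functor.map X.a
      unit := by
        have h₁ := H.unit_coh X.A
        have h₂ : A.mult.unit X.A ≫ X.a = 𝟙 _ := X.unit
        refine (Category.assoc _ _ _).symm.trans ((congrArg (· ≫ _) h₁).trans ?_)
        refine (H.functor.map_comp _ _).symm.trans ((congrArg H.functor.map h₂).trans ?_)
        exact H.functor.map_id _
      assoc := by
        have h₁ := H.subst_coh (IsConcat.single (fun _ : Fin 1 => X.A))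
        have h₂ := Multitensor.subst_act X
        have h₃ := H.coh_naturality (fun _ : Fin 1 => Multitensor.act X)
        have h₄ := congrArg H.functor.map h₂
        rw [H.functor.map_comp, H.functor.map_comp] at h₄
        have h₅ := (B.mult.tensor 1).map_comp (fun _ : Fin 1 => H.coh (fun _ : Fin 1 => X.A))
          (fun _ : Fin 1 => H.functor.map (Multitensor.act X))
        refine (Category.assoc _ _ _).symm.trans ((congrArg (· ≫ _) h₁.symm).trans ?_)
        refine Eq.trans ?_ (congrArg (· ≫ _) h₅).symm
        refine (Category.assoc _ _ _).trans (Eq.trans ?_ (Category.assoc _ _ _).symm)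
        refine congrArg (_ ≫ ·) ?_
        refine (Category.assoc _ _ _).trans ((congrArg (_ ≫ ·) h₄).trans ?_)
        refine (Category.assoc _ _ _).symm.trans ((congrArg (· ≫ _) h₃.symm).trans ?_)
        exact Category.assoc _ _ _ }
  map f :=
    { f := H.functor.map f.f
      h := by
        have h₁ := H.coh_naturality (fun _ : Fin 1 => f.f)
        have h₂ := congrArg H.functor.map (Multitensor.map_act f)
        rw [H.functor.map_comp, H.functor.map_comp] at h₂
        refine (Category.assoc _ _ _).symm.trans ((congrArg (· ≫ _) h₁).trans ?_)
        refine (Category.assoc _ _ _).trans ((congrArg (_ ≫ ·) h₂).trans ?_)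
        exact (Category.assoc _ _ _).symm }
  map_id X := Monad.Algebra.Hom.ext (H.functor.map_id _)
  map_comp f g := Monad.Algebra.Hom.ext (H.functor.map_comp _ _)

/-- Base change of ordered categories along a lax monoidal functor. -/
def mapOCat {I : Type w₁} [Preorder I] (X : OCat A.mult I) : OCat B.mult I where
  hom p q := H.mapAlgebra.obj (X.hom p q)
  comp h := H.coh _ ≫ H.functor.map (X.comp h)
  comp_edge h := congrArg (fun f => H.coh _ ≫ H.functor.map f) (X.comp_edge h)
  comp_subst {k m n c d c₂ d₂ c' d' a b} hc hd h h' h₂ := by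
    have h₁ := H.subst_coh (hc.map₂ hd fun p q => (X.hom p q).A)
    have h₃ := congrArg H.functor.map (X.comp_subst hc hd h h' h₂)
    rw [H.functor.map_comp, H.functor.map_comp] at h₃
    have h₄ := H.coh_naturality (fun i => X.comp (h₂ i))
    have h₅ := (B.mult.tensor k).map_comp
      (fun i => H.coh (fun j => (X.hom (c₂ i j) (d₂ i j)).A))
      (fun i => H.functor.map (X.comp (h₂ i)))
    refine (congrArg (· ≫ _) h₅).trans ?_
    refine (Category.assoc _ _ _).trans ?_
    refine (congrArg (_ ≫ ·) ((Category.assoc _ _ _).symm.trans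
      (congrArg (· ≫ _) h₄))).trans ?_
    refine (congrArg (_ ≫ ·) ((Category.assoc _ _ _).trans (congrArg (_ ≫ ·) h₃))).trans ?_
    refine Eq.trans ?_ ((congrArg (· ≫ _) h₁).trans (Category.assoc _ _ _))
    refine Eq.trans ?_ (Category.assoc _ _ _).symm
    exact congrArg (_ ≫ ·) (Category.assoc _ _ _).symm

/-- Base change of morphisms of ordered categories. -/
def mapOCatMap {I : Type w₁} [Preorder I] {X Y : OCat A.mult I} (f : X ⟶ Y) :
    H.mapOCat X ⟶ H.mapOCat Y where
  app h := H.mapAlgebra.map (OCat.Hom.app f h)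
  app_comp h := by
    have h₁ := H.coh_naturality (fun i => (OCat.Hom.app f (h.step i)).f)
    have h₂ := congrArg H.functor.map (OCat.Hom.app_comp f h)
    rw [H.functor.map_comp, H.functor.map_comp] at h₂
    refine (Category.assoc _ _ _).symm.trans ((congrArg (· ≫ _) h₁).trans ?_)
    refine (Category.assoc _ _ _).trans ((congrArg (_ ≫ ·) h₂).trans ?_)
    exact (Category.assoc _ _ _).symm

end LaxMonCat.Hom

/-! ### Colimits in categories of families -/

section Families

variable {ι : Type*} {D : Type*} [Category* D] {V : Type u} [Category.{v} V] {J : Type*} [Category* J]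

/-- A cocone in a category of families is colimiting if its components are. -/
noncomputable def isColimitOfEval {K : J ⥤ (ι → V)} (c : Cocone K)
    (hc : ∀ i, IsColimit ((Pi.eval (fun _ => V) i).mapCocone c)) : IsColimit c where
  desc s i := (hc i).desc ((Pi.eval (fun _ => V) i).mapCocone s)
  fac s j := funext fun i => (hc i).fac ((Pi.eval (fun _ => V) i).mapCocone s) j
  uniq s m hm := funext fun i => (hc i).uniq ((Pi.eval (fun _ => V) i).mapCocone s) (m i)
    fun j => congrFun (hm j) i

/-- The pointwise colimit of a diagram of families. -/
noncomputable def piColimitCocone [HasColimitsOfShape J V] (K : J ⥤ (ι → V)) : Cocone K where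
  pt i := colimit (K ⋙ Pi.eval (fun _ => V) i)
  ι :=
    { app := fun j i => colimit.ι (K ⋙ Pi.eval (fun _ => V) i) j
      naturality := fun _ _ f => funext fun i =>
        (colimit.w (K ⋙ Pi.eval (fun _ => V) i) f).trans (Category.comp_id _).symm }

/-- The pointwise colimit is pointwise colimiting. -/
noncomputable def isColimitEvalPiColimitCocone [HasColimitsOfShape J V] (K : J ⥤ (ι → V)) (i : ι) :
    IsColimit ((Pi.eval (fun _ => V) i).mapCocone (piColimitCocone K)) :=
  IsColimit.ofIsoColimit (colimit.isColimit (K ⋙ Pi.eval (fun _ => V) i))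
    (Cocone.ext (Iso.refl _) fun _ => Category.comp_id _)

theorem hasColimitsOfShape_families [HasColimitsOfShape J V] : HasColimitsOfShape J (ι → V) where
  has_colimit K := ⟨⟨⟨piColimitCocone K, isColimitOfEval _ (isColimitEvalPiColimitCocone K)⟩⟩⟩

theorem hasColimitsOfSize_families [HasColimitsOfSize.{w₁, w₂} V] :
    HasColimitsOfSize.{w₁, w₂} (ι → V) :=
  ⟨fun _ _ => hasColimitsOfShape_families⟩

theorem preservesColimitsOfShape_eval [HasColimitsOfShape J V] (i : ι) :
    PreservesColimitsOfShape J (Pi.eval (fun _ : ι => V) i) where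
  preservesColimit {K} := preservesColimit_of_preserves_colimit_cocone
    (isColimitOfEval _ (isColimitEvalPiColimitCocone K)) (isColimitEvalPiColimitCocone K i)

theorem preservesColimitsOfShape_pi' (L : ι → D ⥤ V) [∀ i, PreservesColimitsOfShape J (L i)] :
    PreservesColimitsOfShape J (Functor.pi' L) where
  preservesColimit := ⟨fun hc => ⟨isColimitOfEval _ fun i =>
    isColimitOfPreserves (L i) hc⟩⟩

theorem preservesColimitsOfShape_comap [HasColimitsOfShape J V] {ι' : Type*} (f : ι' → ι) :
    PreservesColimitsOfShape J (Pi.comap (fun _ : ι => V) f) where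
  preservesColimit := ⟨fun hc => ⟨isColimitOfEval _ fun i =>
    have := preservesColimitsOfShape_eval (V := V) (J := J) (f i)
    isColimitOfPreserves (Pi.eval (fun _ => V) (f i)) hc⟩⟩

/-- The coproduct of a family of functors. -/
noncomputable def sigmaFunctor {O : Type*} [HasCoproductsOfShape O V] (L : O → D ⥤ V) : D ⥤ V where
  obj Q := ∐ fun o => (L o).obj Q
  map f := Limits.Sigma.map fun o => (L o).map f
  map_id Q := by ext; simp
  map_comp f g := by ext; simp

theorem preservesColimitsOfShape_sigmaFunctor {O : Type*} [HasCoproductsOfShape O V]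
    (L : O → D ⥤ V) [∀ o, PreservesColimitsOfShape J (L o)] :
    PreservesColimitsOfShape J (sigmaFunctor L) where
  preservesColimit {K} := ⟨fun {c} hc => ⟨by
    have hL := fun o => isColimitOfPreserves (L o) hc
    have hι : ∀ j o, Sigma.ι (fun o => (L o).obj (K.obj j)) o ≫ (sigmaFunctor L).map (c.ι.app j) =
        (L o).map (c.ι.app j) ≫ Sigma.ι (fun o => (L o).obj c.pt) o := fun j o =>
      Sigma.ι_map (fun o => (L o).map (c.ι.app j)) o
    let s' : ∀ (s : Cocone (K ⋙ sigmaFunctor L)) (o : O), Cocone (K ⋙ L o) := fun s o =>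
      { pt := s.pt
        ι := { app := fun j => Sigma.ι (fun o => (L o).obj (K.obj j)) o ≫ s.ι.app j
               naturality := fun i j f => by
                have h : Sigma.ι (fun o => (L o).obj (K.obj i)) o ≫ (sigmaFunctor L).map (K.map f) =
                  (L o).map (K.map f) ≫ Sigma.ι (fun o => (L o).obj (K.obj j)) o :=
                  Sigma.ι_map (fun o => (L o).map (K.map f)) o
                refine Eq.trans ?_ (Category.comp_id _).symm
                refine (Category.assoc _ _ _).symm.trans ((congrArg (· ≫ _) h.symm).trans ?_)
                refine (Category.assoc _ _ _).trans ?_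
                exact congrArg (_ ≫ ·) (s.w f) } }
    refine IsColimit.ofExistsUnique fun s => ⟨Sigma.desc fun o => (hL o).desc (s' s o), ?_, ?_⟩
    · intro j
      refine Sigma.hom_ext _ _ fun o => ?_
      refine (Category.assoc _ _ _).symm.trans ((congrArg (· ≫ _) (hι j o)).trans ?_)
      refine (Category.assoc _ _ _).trans ((congrArg (_ ≫ ·)
        (Sigma.ι_desc (fun o => (hL o).desc (s' s o)) o)).trans ?_)
      exact (hL o).fac (s' s o) j
    · intro m hm
      refine Sigma.hom_ext _ _ fun o => ?_
      refine Eq.trans ?_ (Sigma.ι_desc (fun o => (hL o).desc (s' s o)) o).symm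
      refine (hL o).uniq (s' s o) _ fun j => ?_
      refine (Category.assoc _ _ _).symm.trans ((congrArg (· ≫ m) (hι j o).symm).trans ?_)
      refine (Category.assoc _ _ _).trans ?_
      exact congrArg (_ ≫ ·) (hm j)⟩⟩

end Families

/-! ### Ordered categories as algebras -/

namespace OCat

variable {V : Type u} [Category.{v} V] (E : Multitensor V) (I : Type) [Preorder I]

/-- The intervals of a preorder. -/
abbrev Ivl := { p : I × I // p.1 ≤ p.2 }

variable {I}

/-- The monotone paths along an interval. -/
structure PathOp (p : Ivl I) where
  {k : ℕ}
  {c : Fin k → I}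
  {d : Fin k → I}
  path : MonoPath c d p.1.1 p.1.2

/-- The steps of a path. -/
abbrev PathOp.src {p : Ivl I} (o : PathOp p) (i : Fin o.k) : Ivl I := ⟨(o.c i, o.d i), o.path.step i⟩

/-- The monotone paths along an interval which are decomposed into blocks. -/
structure BlockOp (p : Ivl I) where
  {k m : ℕ}
  {n : Fin k → ℕ}
  {c d : Fin m → I}
  {c₂ d₂ : ∀ i, Fin (n i) → I}
  {c' d' : Fin k → I}
  concat_c : IsConcat c₂ c
  concat_d : IsConcat d₂ d
  path : MonoPath c d p.1.1 p.1.2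
  cuts : MonoPath c' d' p.1.1 p.1.2
  block : ∀ i, MonoPath (c₂ i) (d₂ i) (c' i) (d' i)

namespace BlockOp

variable {p : Ivl I} (o : BlockOp p)

/-- The path underlying a decomposed path. -/
abbrev total : PathOp p := ⟨o.path⟩

/-- The path of cuts of a decomposed path. -/
abbrev outer : PathOp p := ⟨o.cuts⟩

/-- The blocks of a decomposed path. -/
abbrev inner (i : Fin o.k) : PathOp (o.outer.src i) := ⟨o.block i⟩

theorem isConcat {α : Type*} (Q : Ivl I → α) :
    IsConcat (fun i (j : Fin (o.n i)) => Q ((o.inner i).src j)) (fun s => Q (o.total.src s)) :=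
  ⟨o.concat_c.length_eq, fun i j => congrArg Q (Subtype.ext
    (Prod.ext (o.concat_c.entry_eq i j) (o.concat_d.entry_eq i j)))⟩

/-- The decomposition of a path into a single block. -/
abbrev single (o : PathOp p) : BlockOp p where
  k := 1
  m := o.k
  n := fun _ => o.k
  c₂ := fun _ => o.c
  d₂ := fun _ => o.d
  c' := fun _ => p.1.1
  d' := fun _ => p.1.2
  concat_c := IsConcat.single _
  concat_d := IsConcat.single _
  path := o.path
  cuts := MonoPath.edge p.2
  block := fun _ => o.path

end BlockOp

/-- The path of length one along an interval. -/
abbrev PathOp.edge (p : Ivl I) : PathOp p := ⟨MonoPath.edge p.2⟩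

/-- The functor of formal compositions along a path. -/
abbrev pathFunctor {p : Ivl I} (o : PathOp p) : (Ivl I → V) ⥤ V :=
  Pi.comap (fun _ => V) o.src ⋙ E.tensor o.k

/-- The functor of formal iterated compositions along a decomposed path. -/
abbrev blockFunctor {p : Ivl I} (o : BlockOp p) : (Ivl I → V) ⥤ V :=
  Functor.pi' (fun i => pathFunctor E (o.inner i)) ⋙ E.tensor o.k

/-! ### Formal compositions and their theory. -/

variable [∀ O : Type, HasCoproductsOfShape O V]

/-- Formal compositions. -/
noncomputable abbrev opFunctor : (Ivl I → V) ⥤ (Ivl I → V) :=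
  Functor.pi' fun p : Ivl I => sigmaFunctor fun o : PathOp p => pathFunctor E o

/-- Formal iterated compositions. -/
noncomputable abbrev opFunctor₂ : (Ivl I → V) ⥤ (Ivl I → V) :=
  Functor.pi' fun p : Ivl I => sigmaFunctor fun o : BlockOp p => blockFunctor E o

/-- The inclusion of a formal composition. -/
noncomputable def opι (Q : Ivl I → V) {p : Ivl I} (o : PathOp p) :
    (E.tensor o.k).obj (fun i => Q (o.src i)) ⟶ (opFunctor E).obj Q p :=
  Sigma.ι (fun o => (pathFunctor E o).obj Q) o

/-- The inclusion of a formal iterated composition. -/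
noncomputable def opι₂ (Q : Ivl I → V) {p : Ivl I} (o : BlockOp p) :
    (E.tensor o.k).obj (fun i => (E.tensor (o.n i)).obj fun j => Q ((o.inner i).src j)) ⟶
      (opFunctor₂ E).obj Q p :=
  Sigma.ι (fun o => (blockFunctor E o).obj Q) o

variable {E}

theorem op_hom_ext {Q : Ivl I → V} {p : Ivl I} {Y : V} {f g : (opFunctor E).obj Q p ⟶ Y}
    (h : ∀ o : PathOp p, opι E Q o ≫ f = opι E Q o ≫ g) : f = g := Sigma.hom_ext _ _ h

theorem op₂_hom_ext {Q : Ivl I → V} {p : Ivl I} {Y : V} {f g : (opFunctor₂ E).obj Q p ⟶ Y}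
    (h : ∀ o : BlockOp p, opι₂ E Q o ≫ f = opι₂ E Q o ≫ g) : f = g := Sigma.hom_ext _ _ h

/-- Maps out of formal compositions. -/
noncomputable def opDesc {Q : Ivl I → V} {p : Ivl I} {Y : V}
    (f : ∀ o : PathOp p, (E.tensor o.k).obj (fun i => Q (o.src i)) ⟶ Y) :
    (opFunctor E).obj Q p ⟶ Y := Sigma.desc f

/-- Maps out of formal iterated compositions. -/
noncomputable def op₂Desc {Q : Ivl I → V} {p : Ivl I} {Y : V}
    (f : ∀ o : BlockOp p, (E.tensor o.k).obj
      (fun i => (E.tensor (o.n i)).obj fun j => Q ((o.inner i).src j)) ⟶ Y) :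
    (opFunctor₂ E).obj Q p ⟶ Y := Sigma.desc f

theorem opι_desc {Q : Ivl I → V} {p : Ivl I} {Y : V}
    (f : ∀ o : PathOp p, (E.tensor o.k).obj (fun i => Q (o.src i)) ⟶ Y) (o : PathOp p) :
    opι E Q o ≫ opDesc f = f o := Sigma.ι_desc _ _

theorem opι_desc_assoc {Q : Ivl I → V} {p : Ivl I} {Y Z : V}
    (f : ∀ o : PathOp p, (E.tensor o.k).obj (fun i => Q (o.src i)) ⟶ Y) (o : PathOp p)
    (g : Y ⟶ Z) : opι E Q o ≫ opDesc f ≫ g = f o ≫ g := by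
  rw [← Category.assoc, opι_desc]

theorem op₂ι_desc {Q : Ivl I → V} {p : Ivl I} {Y : V}
    (f : ∀ o : BlockOp p, (E.tensor o.k).obj
      (fun i => (E.tensor (o.n i)).obj fun j => Q ((o.inner i).src j)) ⟶ Y) (o : BlockOp p) :
    opι₂ E Q o ≫ op₂Desc f = f o := Sigma.ι_desc _ _

theorem op₂ι_desc_assoc {Q : Ivl I → V} {p : Ivl I} {Y Z : V}
    (f : ∀ o : BlockOp p, (E.tensor o.k).obj
      (fun i => (E.tensor (o.n i)).obj fun j => Q ((o.inner i).src j)) ⟶ Y) (o : BlockOp p)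
    (g : Y ⟶ Z) : opι₂ E Q o ≫ op₂Desc f ≫ g = f o ≫ g := by
  rw [← Category.assoc, op₂ι_desc]

theorem opι_map {Q R : Ivl I → V} (f : Q ⟶ R) {p : Ivl I} (o : PathOp p) :
    opι E Q o ≫ (opFunctor E).map f p =
      (E.tensor o.k).map (fun i => f (o.src i)) ≫ opι E R o :=
  Sigma.ι_map (fun o : PathOp p => (pathFunctor E o).map f) o

theorem opι_map_assoc {Q R : Ivl I → V} (f : Q ⟶ R) {p : Ivl I} (o : PathOp p) {Z : V}
    (g : (opFunctor E).obj R p ⟶ Z) : opι E Q o ≫ (opFunctor E).map f p ≫ g =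
      (E.tensor o.k).map (fun i => f (o.src i)) ≫ opι E R o ≫ g := by
  rw [← Category.assoc, opι_map, Category.assoc]

theorem op₂ι_map {Q R : Ivl I → V} (f : Q ⟶ R) {p : Ivl I} (o : BlockOp p) :
    opι₂ E Q o ≫ (opFunctor₂ E).map f p =
      (E.tensor o.k).map (fun i => (E.tensor (o.n i)).map (fun j => f ((o.inner i).src j))) ≫
        opι₂ E R o :=
  Sigma.ι_map (fun o : BlockOp p => (blockFunctor E o).map f) o

theorem op₂ι_map_assoc {Q R : Ivl I → V} (f : Q ⟶ R) {p : Ivl I} (o : BlockOp p) {Z : V}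
    (g : (opFunctor₂ E).obj R p ⟶ Z) : opι₂ E Q o ≫ (opFunctor₂ E).map f p ≫ g =
      (E.tensor o.k).map (fun i => (E.tensor (o.n i)).map (fun j => f ((o.inner i).src j))) ≫
        opι₂ E R o ≫ g := by
  rw [← Category.assoc, op₂ι_map, Category.assoc]

omit [∀ O : Type, HasCoproductsOfShape O V] in
theorem subst_naturality_blockOp {Q R : Ivl I → V} (f : Q ⟶ R) {p : Ivl I} (o : BlockOp p) :
    (E.tensor o.k).map (fun i => (E.tensor (o.n i)).map (fun j => f ((o.inner i).src j))) ≫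
        E.subst (o.isConcat R) =
      E.subst (o.isConcat Q) ≫ (E.tensor o.m).map (fun s => f (o.total.src s)) := by
  refine E.subst_naturality_of_heq _ _ _ _ fun i j => ?_
  have : (o.inner i).src j = o.total.src (blockPos o.n (o.isConcat Q).length_eq i j) :=
    Subtype.ext (Prod.ext (o.concat_c.entry_eq i j) (o.concat_d.entry_eq i j))
  rw [this]

variable (E I) in
/-- The two-stage theory of ordered `E`-categories. -/
noncomputable def theory : TwoStage (Ivl I → V) where
  F := opFunctor E
  G := opFunctor₂ E
  η :=
    { app := fun Q p => E.unit (Q p) ≫ opι E Q (PathOp.edge p)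
      naturality := fun Q R f => funext fun p => by
        have h := opι_map (E := E) f (PathOp.edge p)
        have h' := E.unit_naturality (f p)
        refine (Category.assoc _ _ _).symm.trans ((congrArg (· ≫ _) h').trans ?_)
        refine (Category.assoc _ _ _).trans (Eq.trans ?_ (Category.assoc _ _ _).symm)
        exact congrArg (_ ≫ ·) h.symm }
  -- Since `G` is a coproduct over decomposed paths rather than `F ∘ F`, substitution defines `μ`
  -- without the tensors having to commute with coproducts.
  μ :=
    { app := fun Q p => op₂Desc fun o => E.subst (o.isConcat Q) ≫ opι E Q o.total
      naturality := fun Q R f => funext fun p => by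
        refine op₂_hom_ext fun o => ?_
        change opι₂ E Q o ≫ (opFunctor₂ E).map f p ≫ op₂Desc _ = opι₂ E Q o ≫ op₂Desc _ ≫
          (opFunctor E).map f p
        rw [op₂ι_map_assoc, op₂ι_desc, op₂ι_desc_assoc, Category.assoc, opι_map,
          ← Category.assoc, ← Category.assoc, subst_naturality_blockOp] }
  outer :=
    { app := fun Q p => opDesc fun o => E.unit _ ≫ opι₂ E Q (BlockOp.single o)
      naturality := fun Q R f => funext fun p => by
        refine op_hom_ext fun o => ?_
        change opι E Q o ≫ (opFunctor E).map f p ≫ opDesc _ = opι E Q o ≫ opDesc _ ≫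
          (opFunctor₂ E).map f p
        rw [opι_map_assoc, opι_desc, opι_desc_assoc, Category.assoc, op₂ι_map,
          ← Category.assoc, E.unit_naturality, Category.assoc] }
  lift {Q R} a p := op₂Desc fun o =>
    (E.tensor o.k).map (fun i => opι E Q (o.inner i) ≫ a (o.outer.src i)) ≫ opι E R o.outer
  lift_naturality {Q R Q' R'} f g a b w := funext fun p => by
    refine op₂_hom_ext fun o => ?_
    change opι₂ E Q o ≫ (opFunctor₂ E).map f p ≫ op₂Desc _ = opι₂ E Q o ≫ op₂Desc _ ≫
      (opFunctor E).map g p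
    rw [op₂ι_map_assoc, op₂ι_desc, op₂ι_desc_assoc, Category.assoc, opι_map, ← Category.assoc,
      ← Category.assoc]
    refine congrArg (· ≫ opι E R' o.outer) ?_
    refine ((E.tensor o.k).map_comp _ _).symm.trans (Eq.trans ?_ ((E.tensor o.k).map_comp _ _))
    refine congrArg (E.tensor o.k).map (funext fun i => ?_)
    have h := opι_map (E := E) f (o.inner i)
    have h' : (opFunctor E).map f (o.outer.src i) ≫ b (o.outer.src i) =
      a (o.outer.src i) ≫ g (o.outer.src i) := congrFun w (o.outer.src i)
    refine (Category.assoc _ _ _).symm.trans ((congrArg (· ≫ _) h.symm).trans ?_)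
    refine (Category.assoc _ _ _).trans (Eq.trans ?_ (Category.assoc _ _ _).symm)
    exact congrArg (_ ≫ ·) h'
  outer_μ Q := funext fun p => by
    refine op_hom_ext fun o => ?_
    change opι E Q o ≫ opDesc _ ≫ op₂Desc _ = opι E Q o ≫ 𝟙 _
    rw [opι_desc_assoc, Category.assoc, op₂ι_desc, Category.comp_id]
    have h := E.unit_outer (fun i => Q (o.src i))
    refine (Category.assoc _ _ _).symm.trans ((congrArg (· ≫ _) h).trans ?_)
    exact Category.id_comp _
  outer_lift {Q R} a := funext fun p => by
    refine op_hom_ext fun o => ?_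
    change opι E Q o ≫ opDesc _ ≫ op₂Desc _ = opι E Q o ≫ a p ≫ E.unit (R p) ≫ _
    rw [opι_desc_assoc, Category.assoc, op₂ι_desc]
    have h := E.unit_naturality (opι E Q o ≫ a p)
    refine (Category.assoc _ _ _).symm.trans ((congrArg (· ≫ _) h.symm).trans ?_)
    exact (Category.assoc _ _ _).trans (Category.assoc _ _ _)

/-- Formal compositions are coproducts of tensors of projections. This instance and the next are how
accessibility of `E` reaches the construction of algebras. -/
instance preserves_opFunctor {J : Type*} [Category* J] [HasColimitsOfShape J V]
    [∀ k, PreservesColimitsOfShape J (E.tensor k)] :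
    PreservesColimitsOfShape J (theory E I).F := by
  have : ∀ {p : Ivl I} (o : PathOp p), PreservesColimitsOfShape J (pathFunctor E o) := fun o =>
    have := preservesColimitsOfShape_comap (V := V) (J := J) o.src
    inferInstance
  have := fun p : Ivl I =>
    preservesColimitsOfShape_sigmaFunctor (J := J) (fun o : PathOp p => pathFunctor E o)
  exact preservesColimitsOfShape_pi' _

instance preserves_opFunctor₂ {J : Type*} [Category* J] [HasColimitsOfShape J V]
    [∀ k, PreservesColimitsOfShape J (E.tensor k)] :
    PreservesColimitsOfShape J (theory E I).G := by
  have : ∀ {p : Ivl I} (o : PathOp p), PreservesColimitsOfShape J (pathFunctor E o) := fun o =>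
    have := preservesColimitsOfShape_comap (V := V) (J := J) o.src
    inferInstance
  have : ∀ {p : Ivl I} (o : BlockOp p), PreservesColimitsOfShape J (blockFunctor E o) := fun o =>
    have := preservesColimitsOfShape_pi' (J := J) (fun i => pathFunctor E (o.inner i))
    inferInstance
  have := fun p : Ivl I =>
    preservesColimitsOfShape_sigmaFunctor (J := J) (fun o : BlockOp p => blockFunctor E o)
  exact preservesColimitsOfShape_pi' _

/-- The family of homs of an ordered category. -/
abbrev homs (X : OCat E I) : Ivl I → V := fun p => (X.hom p.1.1 p.1.2).A

/-- The structure map of an ordered category as an algebra. -/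
noncomputable def str (X : OCat E I) : (theory E I).F.obj X.homs ⟶ X.homs :=
  fun _ => opDesc fun o => X.comp o.path

theorem opι_str (X : OCat E I) {p : Ivl I} (o : PathOp p) :
    opι E X.homs o ≫ X.str p = X.comp o.path := opι_desc _ _

/-- On the summand of a decomposed path the associativity axiom is `comp_subst`; the unit axiom is
that of the hom algebras, by `comp_edge`. -/
theorem isAlgebra_str (X : OCat E I) : (theory E I).IsAlgebra X.str where
  unit := funext fun p => by
    refine (Category.assoc _ _ _).trans ?_
    refine (congrArg (_ ≫ ·) ((X.opι_str (PathOp.edge p)).trans (X.comp_edge _))).trans ?_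
    exact Multitensor.unit_act _
  assoc := funext fun p => by
    refine op₂_hom_ext fun o => ?_
    refine (op₂ι_desc_assoc _ _ _).trans (Eq.trans ?_ (op₂ι_desc_assoc _ _ _).symm)
    refine (Category.assoc _ _ _).trans (Eq.trans ?_ (Category.assoc _ _ _).symm)
    refine (congrArg (_ ≫ ·) (X.opι_str o.outer)).trans
      (Eq.trans ?_ (congrArg (_ ≫ ·) (X.opι_str o.total)).symm)
    refine Eq.trans ?_ (X.comp_subst o.concat_c o.concat_d o.path o.cuts o.block)
    refine congrArg (· ≫ _) (congrArg (E.tensor o.k).map (funext fun i => ?_))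
    exact X.opι_str (o.inner i)

/-- The map of families underlying a morphism of ordered categories. -/
def vals {X Y : OCat E I} (f : X ⟶ Y) : X.homs ⟶ Y.homs := fun p => (Hom.app f p.2).f

theorem map_vals_str {X Y : OCat E I} (f : X ⟶ Y) :
    (theory E I).F.map (vals f) ≫ Y.str = X.str ≫ vals f := funext fun p => by
  refine op_hom_ext fun o => ?_
  refine (opι_map_assoc _ _ _).trans ?_
  refine (congrArg (_ ≫ ·) (Y.opι_str o)).trans ?_
  refine Eq.trans ?_ (Category.assoc _ _ _)
  refine Eq.trans ?_ (congrArg (· ≫ vals f p) (X.opι_str o).symm)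
  exact Hom.app_comp f o.path

/-- Morphisms of ordered categories are maps of algebras. -/
noncomputable def homOfVals {X Y : OCat E I} (f : X.homs ⟶ Y.homs)
    (hf : (theory E I).F.map f ≫ Y.str = X.str ≫ f) : X ⟶ Y :=
  Hom.ofMaps (fun {p q} h => f ⟨(p, q), h⟩) fun {k c d a b} h => by
    have h₁ := congrArg (opι E X.homs (p := ⟨(a, b), h.le⟩) ⟨h⟩ ≫ ·) (congrFun hf ⟨(a, b), h.le⟩)
    refine Eq.trans ?_ (h₁.trans ?_)
    · refine Eq.trans ?_ (opι_map_assoc f (⟨h⟩ : PathOp (⟨(a, b), h.le⟩ : Ivl I))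
        (Y.str ⟨(a, b), h.le⟩)).symm
      exact congrArg (_ ≫ ·) (Y.opι_str (⟨h⟩ : PathOp (⟨(a, b), h.le⟩ : Ivl I))).symm
    · refine (Category.assoc _ _ _).symm.trans ?_
      exact congrArg (· ≫ f ⟨(a, b), h.le⟩) (X.opι_str (⟨h⟩ : PathOp (⟨(a, b), h.le⟩ : Ivl I)))

omit [∀ O : Type, HasCoproductsOfShape O V] in
theorem vals_injective {X Y : OCat E I} {f g : X ⟶ Y} (h : vals f = vals g) : f = g :=
  hom_ext fun {p q} hpq => congrFun h (⟨(p, q), hpq⟩ : Ivl I)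

/-- The ordered category corresponding to an algebra. -/
noncomputable def ofAlgebra (hom : I → I → E.unary.Algebra)
    (z : (theory E I).F.obj (fun p => (hom p.1.1 p.1.2).A) ⟶ fun p => (hom p.1.1 p.1.2).A)
    (hz : (theory E I).IsAlgebra z)
    (hact : ∀ p : Ivl I, opι E (fun p : Ivl I => (hom p.1.1 p.1.2).A) (PathOp.edge p) ≫ z p =
      Multitensor.act (hom p.1.1 p.1.2)) : OCat E I where
  hom := hom
  comp {_ _ _ a b} h := opι E (fun p : Ivl I => (hom p.1.1 p.1.2).A)
    (p := ⟨(a, b), h.le⟩) ⟨h⟩ ≫ z ⟨(a, b), h.le⟩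
  comp_edge {p q} h := hact ⟨(p, q), h.le⟩
  comp_subst {k m n c d c₂ d₂ c' d' a b} hc hd h h' h₂ := by
    let p : Ivl I := ⟨(a, b), h.le⟩
    let o : BlockOp p := ⟨hc, hd, h, h', h₂⟩
    have h₁ := congrArg (opι₂ E (fun p : Ivl I => (hom p.1.1 p.1.2).A) o ≫ ·) (congrFun hz.assoc p)
    have h₃ := (op₂ι_desc_assoc _ o (z p)).symm.trans (h₁.trans (op₂ι_desc_assoc _ o (z p)))
    exact (Category.assoc _ _ _).symm.trans (h₃.trans (Category.assoc _ _ _))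

theorem str_ofAlgebra (hom : I → I → E.unary.Algebra)
    (z : (theory E I).F.obj (fun p => (hom p.1.1 p.1.2).A) ⟶ fun p => (hom p.1.1 p.1.2).A)
    (hz : (theory E I).IsAlgebra z)
    (hact : ∀ p : Ivl I, opι E (fun p : Ivl I => (hom p.1.1 p.1.2).A) (PathOp.edge p) ≫ z p =
      Multitensor.act (hom p.1.1 p.1.2)) : (ofAlgebra hom z hz hact).str = z :=
  funext fun _ => op_hom_ext fun _ => opι_desc _ _

/-- An algebra for the theory of ordered categories comes from algebras for the unary part. -/
theorem exists_hom_of_isAlgebra (X : OCat E I) {Z : Ivl I → V} {z : (theory E I).F.obj Z ⟶ Z}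
    (hz : (theory E I).IsAlgebra z) :
    ∃ hom : I → I → E.unary.Algebra, ∀ p : Ivl I, ∃ hA : (hom p.1.1 p.1.2).A = Z p,
      (E.tensor 1).map (fun _ => eqToHom hA) ≫ opι E Z (PathOp.edge p) ≫ z p =
        Multitensor.act (hom p.1.1 p.1.2) ≫ eqToHom hA := by
  have hlift : ∀ p : Ivl I, (E.tensor 1).map (fun _ => opι E Z (PathOp.edge p) ≫ z p) ≫
      opι E Z (PathOp.edge p) ≫ z p = E.subst (IsConcat.single (fun _ : Fin 1 => Z p)) ≫
      opι E Z (PathOp.edge p) ≫ z p := fun p => by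
    have h₁ := congrArg (opι₂ E Z (BlockOp.single (PathOp.edge p)) ≫ ·) (congrFun hz.assoc p)
    have h₃ := (op₂ι_desc_assoc _ (BlockOp.single (PathOp.edge p)) (z p)).symm.trans
      (h₁.trans (op₂ι_desc_assoc _ (BlockOp.single (PathOp.edge p)) (z p)))
    exact (Category.assoc _ _ _).symm.trans (h₃.trans (Category.assoc _ _ _))
  let alg : Ivl I → E.unary.Algebra := fun p =>
    { A := Z p
      a := opι E Z (PathOp.edge p) ≫ z p
      unit := (Category.assoc _ _ _).symm.trans (congrFun hz.unit p)
      assoc := (hlift p).symm }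
  classical
  -- Homs outside the order are subject to no condition and are filled with those of `X`, which
  -- serves only this purpose.
  refine ⟨fun p q => if h : p ≤ q then alg ⟨(p, q), h⟩ else X.hom p q, fun p => ?_⟩
  suffices key : ∀ X' : E.unary.Algebra, X' = alg p → ∃ hA : X'.A = Z p,
      (E.tensor 1).map (fun _ => eqToHom hA) ≫ opι E Z (PathOp.edge p) ≫ z p =
        Multitensor.act X' ≫ eqToHom hA from key _ (dif_pos p.2)
  rintro _ rfl
  refine ⟨rfl, ?_⟩
  refine (congrArg (· ≫ _) ((E.tensor 1).map_id _)).trans ?_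
  exact (Category.id_comp _).trans (Category.comp_id _).symm

/-- Together with `isAlgebra_str`, this identifies ordered categories with algebras. The families of
homs agree by an equality that need not be definitional, hence the heterogeneous comparison of the
actions. -/
theorem exists_eq_str (X : OCat E I) {Z : Ivl I → V} {z : (theory E I).F.obj Z ⟶ Z}
    (hz : (theory E I).IsAlgebra z) : ∃ (Y : OCat E I) (_ : Y.homs = Z), HEq Y.str z := by
  obtain ⟨hom, hhom⟩ := exists_hom_of_isAlgebra X hz
  choose hA hact using hhom
  obtain rfl : (fun p : Ivl I => (hom p.1.1 p.1.2).A) = Z := funext hA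
  refine ⟨ofAlgebra hom z hz fun p => ?_, rfl, heq_of_eq (str_ofAlgebra _ _ _ _)⟩
  have h := hact p
  refine Eq.trans ?_ (h.trans (Category.comp_id _))
  refine Eq.trans ?_ (congrArg (· ≫ _) ((E.tensor 1).map_id _)).symm
  exact (Category.id_comp _).symm

omit [∀ O : Type, HasCoproductsOfShape O V] in
/-- An ordered category has a universal quotient by a small family of relations. -/
theorem exists_quotient [HasColimitsOfSize.{v, v} V] (κ : Cardinal.{v}) [Fact κ.IsRegular]
    (hE : E.IsCardinalAccessible κ) (W : OCat E I) {B : Type} (s t : B → I)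
    (hst : ∀ b, s b ≤ t b) {A : B → V} (f g : ∀ b, A b ⟶ (W.hom (s b) (t b)).A) :
    ∃ (Z : OCat E I) (φ : W ⟶ Z),
      (∀ b, f b ≫ (Hom.app φ (hst b)).f = g b ≫ (Hom.app φ (hst b)).f) ∧
      ∀ (Y : OCat E I) (ψ : W ⟶ Y),
        (∀ b, f b ≫ (Hom.app ψ (hst b)).f = g b ≫ (Hom.app ψ (hst b)).f) →
        ∃! χ : Z ⟶ Y, φ ≫ χ = ψ := by
  have : ∀ O : Type, HasCoproductsOfShape O V := fun O =>
    have := hasColimitsOfSizeShrink.{0, 0} V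
    inferInstance
  have : ∀ k, PreservesColimitsOfShape κ.ord.ToType (E.tensor k) := fun k =>
    have := hE k
    (E.tensor k).preservesColimitsOfShape_of_isCardinalAccessible κ _
  have : HasColimitsOfSize.{v, v} (Ivl I → V) := hasColimitsOfSize_families
  let ivl : B → Ivl I := fun b => ⟨(s b, t b), hst b⟩
  -- Relations are grouped by interval, so that one coequalizer at each interval imposes all of
  -- them; an interval without relations gets an empty coproduct.
  let F₁ : ∀ p : Ivl I, (∐ fun b : {b // ivl b = p} => A b.1) ⟶ W.homs p := fun p =>
    Limits.Sigma.desc fun b => f b.1 ≫ eqToHom (congrArg W.homs b.2)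
  let F₂ : ∀ p : Ivl I, (∐ fun b : {b // ivl b = p} => A b.1) ⟶ W.homs p := fun p =>
    Limits.Sigma.desc fun b => g b.1 ≫ eqToHom (congrArg W.homs b.2)
  let Q : Ivl I → V := fun p => coequalizer (F₁ p) (F₂ p)
  let r : W.homs ⟶ Q := fun p => coequalizer.π (F₁ p) (F₂ p)
  have hr : Epi r := ⟨fun a b hab => funext fun p =>
    coequalizer.hom_ext (congrFun hab p)⟩
  have hfac : ∀ {Y : Ivl I → V} (ψ : W.homs ⟶ Y), (∃ h : Q ⟶ Y, r ≫ h = ψ) ↔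
      ∀ b, f b ≫ ψ (ivl b) = g b ≫ ψ (ivl b) := by
    intro Y ψ
    constructor
    · rintro ⟨h, rfl⟩ b
      have h₁ := congrArg (Limits.Sigma.ι (fun b' : {b' // ivl b' = ivl b} => A b'.1) ⟨b, rfl⟩ ≫ ·)
        (coequalizer.condition (F₁ (ivl b)) (F₂ (ivl b)))
      simp only [F₁, F₂, Limits.Sigma.ι_desc_assoc, eqToHom_refl, Category.comp_id] at h₁
      have h₂ := congrArg (· ≫ h (ivl b)) h₁
      exact (Category.assoc _ _ _).symm.trans (h₂.trans (Category.assoc _ _ _))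
    · intro h
      have : ∀ p, F₁ p ≫ ψ p = F₂ p ≫ ψ p := by
        intro p
        refine Limits.Sigma.hom_ext _ _ fun b => ?_
        obtain ⟨b, rfl⟩ := b
        simpa [F₁, F₂] using h b
      exact ⟨fun p => coequalizer.desc (ψ p) (this p), funext fun p => coequalizer.π_desc _ _⟩
  obtain ⟨Z, z, φ, q, hz, hφ, hq, huniv⟩ := TwoStage.exists_quotient κ W.isAlgebra_str r
  obtain ⟨Z, rfl, hZ⟩ := exists_eq_str W hz
  obtain rfl := eq_of_heq hZ
  refine ⟨Z, homOfVals φ hφ, (hfac φ).1 ⟨q, hq⟩, fun Y ψ hψ => ?_⟩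
  obtain ⟨q', hq'⟩ := (hfac (vals ψ)).2 hψ
  obtain ⟨χ, ⟨hχ, hχ'⟩, hu⟩ := huniv Y.homs Y.str (vals ψ) q' Y.isAlgebra_str (map_vals_str ψ) hq'
  refine ⟨homOfVals χ hχ, vals_injective hχ', fun χ₁ h₁ => vals_injective ?_⟩
  exact hu (vals χ₁) ⟨map_vals_str χ₁, congrArg vals h₁⟩

end OCat

/-! ### Substitution along general concatenations -/

namespace Multitensor

variable {V : Type u} [Category.{v} V] (E : Multitensor V)

/-- No concatenation is required to be canonical here. Bundling each length with its sequence in a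
sigma type lets a single `IsConcat` record both, so that it can be eliminated by substitution. -/
theorem subst_assoc_of_isConcat {k m r : ℕ} {n : Fin k → ℕ} {p : Fin m → ℕ}
    {p₂ : ∀ i, Fin (n i) → ℕ} {Y : ∀ s, Fin (p s) → V} {Y₂ : ∀ i j, Fin (p₂ i j) → V}
    {X : Fin r → V} {q : Fin k → ℕ} {W : ∀ i, Fin (q i) → V}
    (hp : IsConcat (fun i j => (⟨p₂ i j, Y₂ i j⟩ : Σ a, Fin a → V)) (fun s => ⟨p s, Y s⟩))
    (hX : IsConcat Y X) (hW : IsConcat W X) (hY : ∀ i, IsConcat (Y₂ i) (W i)) :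
    (E.tensor k).map (fun i => E.subst (hY i)) ≫ E.subst hW =
      E.subst (hp.map fun a => (E.tensor a.1).obj a.2) ≫ E.subst hX := by
  obtain ⟨hm, hp⟩ := hp
  obtain ⟨hr, hYX⟩ := hX
  obtain rfl : Y = fun s l => X (blockPos p hr s l) := funext fun s => funext fun l => hYX s l
  obtain rfl : p₂ = fun i j => p (blockPos n hm i j) :=
    funext fun i => funext fun j => congrArg Sigma.fst (hp i j)
  obtain rfl : Y₂ = fun i j l => X (blockPos p hr (blockPos n hm i j) l) :=
    funext fun i => funext fun j => eq_of_heq (Sigma.mk.inj_iff.1 (hp i j)).2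
  exact E.subst_assoc n hm p hr X hW hY

/-- The unit into the value of a multitensor on a sequence of length one. -/
def unitCast {m : ℕ} {A : V} {Y : Fin m → V} (hm : m = 1) (hY : ∀ j, Y j = A) :
    A ⟶ (E.tensor m).obj Y :=
  E.unit A ≫ eqToHom (by
    subst hm
    exact congrArg (E.tensor 1).obj (funext fun j => (hY j).symm))

theorem unitCast_eq (A : V) : E.unitCast (Y := fun _ => A) rfl (fun _ => rfl) = E.unit A :=
  Category.comp_id _

/-- The axiom `unit_inner`, for blocks that are only provably of length one. -/
theorem map_unitCast_subst {k : ℕ} {n : Fin k → ℕ} {Y : ∀ i, Fin (n i) → V} {X : Fin k → V}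
    (h : IsConcat Y X) (hn : ∀ i, n i = 1) (hY : ∀ i j, Y i j = X i) :
    (E.tensor k).map (fun i => E.unitCast (hn i) (hY i)) ≫ E.subst h = 𝟙 _ := by
  obtain rfl : n = fun _ => 1 := funext hn
  obtain rfl : Y = fun i _ => X i := funext fun i => funext fun j => hY i j
  refine Eq.trans ?_ (E.unit_inner X)
  exact congrArg (fun f => (E.tensor k).map f ≫ E.subst (IsConcat.singletons X))
    (funext fun i => E.unitCast_eq (X i))

/-- The values of a multitensor are algebras for its unary part. -/
def tensorAlgebra {m : ℕ} (X : Fin m → V) : E.unary.Algebra where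
  A := (E.tensor m).obj X
  a := E.subst (IsConcat.single X)
  unit := E.unit_outer X
  assoc := (E.subst_assoc_of_isConcat (IsConcat.single (fun _ : Fin 1 => (⟨m, X⟩ : Σ a, Fin a → V)))
    (IsConcat.single X) (IsConcat.single X) (fun _ => IsConcat.single X)).symm

end Multitensor

/-! ### The ordered category of a sequence -/

section Interval

variable {α β : Type*} {n : ℕ}

/-- The entries of a sequence strictly between two cuts. -/
def interval (X : Fin n → α) (p q : Fin (n + 1)) : Fin (q.val - p.val) → α :=
  fun j => X ⟨j + p, by have := q.is_le; have := j.is_lt; omega⟩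

/-- The sum telescopes; monotonicity makes the truncated subtraction harmless. -/
theorem partialSum_sub {k : ℕ} {x : Fin (k + 1) → ℕ} (hx : Monotone x) (i : Fin (k + 1)) :
    Fin.partialSum (fun i : Fin k => x i.succ - x i.castSucc) i = x i - x 0 := by
  induction i using Fin.induction with
  | zero => simp
  | succ i ih =>
    have h₁ := hx (Fin.zero_le i.castSucc)
    have h₂ := hx (Fin.castSucc_le_succ i)
    rw [Fin.partialSum_succ, ih]
    omega

/-- The intervals between consecutive vertices of a path follow one another and exhaust the interval
between its ends. Composition in `ofSeq` can therefore be plain substitution. -/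
theorem MonoPath.isConcat_interval {k : ℕ} {c d : Fin k → Fin (n + 1)} {a b : Fin (n + 1)}
    (h : MonoPath c d a b) (X : Fin n → α) :
    IsConcat (fun i => interval X (c i) (d i)) (interval X a b) := by
  obtain ⟨x, hx, rfl, rfl, hc, hd⟩ := h
  obtain rfl : (fun i : Fin k => x i.castSucc) = c := funext hc
  obtain rfl : (fun i : Fin k => x i.succ) = d := funext hd
  have hx' : Monotone fun i => (x i).val := hx
  have hs := partialSum_sub hx'
  refine ⟨(partialSum_last_eq _).symm.trans (hs _), fun i j => ?_⟩
  refine congrArg X (Fin.ext ?_)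
  have h₁ := hs i.castSucc
  have h₂ := hx' (Fin.zero_le i.castSucc)
  simp only [blockPos] at h₁ h₂ ⊢
  rw [h₁]
  omega

/-- The finest path from `p` to `q`, along which the generators are composed. -/
theorem monoPath_interval {p q : Fin (n + 1)} (h : p ≤ q) :
    MonoPath (interval Fin.castSucc p q) (interval Fin.succ p q) p q := by
  have hq := q.is_le
  refine ⟨fun j => ⟨j + p, ?_⟩, ?_, ?_, ?_, fun i => ?_, fun i => ?_⟩
  · have := j.is_le
    have : p.val ≤ q.val := h
    omega
  · intro i j hij
    exact Nat.add_le_add_right hij _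
  · exact Fin.ext (by simp)
  · exact Fin.ext (Nat.sub_add_cancel h)
  · rfl
  · refine Fin.ext ?_
    simp only [interval, Fin.val_succ]
    omega

end Interval

namespace OCat

variable {V : Type u} [Category.{v} V] (E : Multitensor V) {n : ℕ}

/-- The ordered category freely generated by a sequence of objects. -/
def ofSeq (X : Fin n → V) : OCat E (Fin (n + 1)) where
  hom p q := E.tensorAlgebra (interval X p q)
  comp h := E.subst (h.isConcat_interval X)
  comp_edge _ := rfl
  comp_subst hc hd h h' h₂ := E.subst_assoc_of_isConcat
    (hc.map₂ hd fun p q => (⟨q.val - p.val, interval X p q⟩ : Σ a, Fin a → V))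
    (h.isConcat_interval X) (h'.isConcat_interval X) (fun i => (h₂ i).isConcat_interval X)

variable {E}

/-- The generators of the free ordered category. -/
def gen (X : Fin n → V) {p q : Fin (n + 1)} (b : Fin n) (hp : p = b.castSucc) (hq : q = b.succ) :
    X b ⟶ ((ofSeq E X).hom p q).A :=
  E.unitCast (by subst hp hq; simp) fun j => congrArg X (Fin.ext (by
    subst hp hq
    have := j.is_lt
    simp only [Fin.val_succ, Fin.val_castSucc] at this ⊢
    omega))

/-- The inner unit axiom, read as follows: every hom of the free ordered category consists of
composites of generators. -/
theorem map_gen_comp (X : Fin n → V) {p q : Fin (n + 1)} (h : p ≤ q) :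
    (E.tensor (q.val - p.val)).map (fun j => gen (E := E) X ⟨j + p, by
      have := q.is_le; have := j.is_lt; omega⟩ rfl rfl) ≫
      (ofSeq E X).comp (monoPath_interval h) = 𝟙 ((ofSeq E X).hom p q).A :=
  E.map_unitCast_subst ((monoPath_interval h).isConcat_interval X) _ _

variable {Y : OCat E (Fin (n + 1))}

/-- In the applications the length and the entries are those of a one-step path only up to
propositional equality; after substitution the claim is the unit law of an algebra. -/
theorem unitCast_map_comp {I : Type w₁} [Preorder I] (Y : OCat E I) {m : ℕ} {A : V}
    {Z : Fin m → V} (hm : m = 1) (hZ : ∀ j, Z j = A) {p q : I} {c d : Fin m → I}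
    (hc : ∀ j, c j = p) (hd : ∀ j, d j = q) (h : MonoPath c d p q) (f : A ⟶ (Y.hom p q).A)
    (g : ∀ j, Z j ⟶ (Y.hom (c j) (d j)).A) (hg : ∀ j, HEq (g j) f) :
    E.unitCast hm hZ ≫ (E.tensor m).map g ≫ Y.comp h = f := by
  subst hm
  obtain rfl : Z = fun _ => A := funext hZ
  obtain rfl : c = fun _ => p := funext hc
  obtain rfl : d = fun _ => q := funext hd
  obtain rfl : g = fun _ => f := funext fun j => eq_of_heq (hg j)
  rw [Y.comp_edge, E.unitCast_eq, ← Category.assoc, ← E.unit_naturality, Category.assoc,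
    Multitensor.unit_act, Category.comp_id]

/-- Extension of a family of maps to the free ordered category. -/
def seqDesc {X : Fin n → V} (f : ∀ b, X b ⟶ (Y.hom b.castSucc b.succ).A) : ofSeq E X ⟶ Y :=
  Hom.ofMaps (fun {p q} h => (E.tensor (q.val - p.val)).map
      (X := interval X p q) (fun j => f ⟨j + p, by have := q.is_le; have := j.is_lt; omega⟩) ≫
      Y.comp (monoPath_interval h)) fun {k c d a b} h => by
    -- Composing the unit steps of each block and then the blocks is the same as composing all the
    -- unit steps.
    have h₁ := Y.comp_subst (h.isConcat_interval Fin.castSucc) (h.isConcat_interval Fin.succ)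
      (monoPath_interval h.le) h (fun i => monoPath_interval (h.step i))
    refine (congrArg (· ≫ _) ((E.tensor k).map_comp _ _)).trans ?_
    refine (Category.assoc _ _ _).trans ((congrArg (_ ≫ ·) h₁).trans ?_)
    refine (Category.assoc _ _ _).symm.trans (Eq.trans ?_ (Category.assoc _ _ _))
    refine congrArg (· ≫ _) ?_
    refine E.subst_naturality_of_heq _ _ _ _ fun i j => ?_
    have hb := (h.isConcat_interval (id : Fin n → Fin n)).entry_eq i j
    simp only [interval, id] at hb
    exact congr_arg_heq f hb

theorem gen_seqDesc {X : Fin n → V} (f : ∀ b, X b ⟶ (Y.hom b.castSucc b.succ).A) (b : Fin n) :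
    gen X b rfl rfl ≫ (Hom.app (seqDesc f) (Fin.castSucc_le_succ b)).f = f b := by
  have hb : ∀ j : Fin (b.succ.val - b.castSucc.val), ∀ h,
      (⟨j.val + b.castSucc.val, h⟩ : Fin n) = b := fun j h => Fin.ext (by
    have := j.is_lt
    simp only [Fin.val_succ, Fin.val_castSucc] at this ⊢
    omega)
  exact unitCast_map_comp Y _ _ (fun j => congrArg Fin.castSucc (hb j _))
    (fun j => congrArg Fin.succ (hb j _)) _ (f b) _ fun j => congr_arg_heq f (hb j _)

/-- By `map_gen_comp`, a morphism is recovered from its values on generators. -/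
theorem seq_hom_ext {X : Fin n → V} {φ ψ : ofSeq E X ⟶ Y}
    (h : ∀ b, gen X b rfl rfl ≫ (Hom.app φ (Fin.castSucc_le_succ b)).f =
      gen X b rfl rfl ≫ (Hom.app ψ (Fin.castSucc_le_succ b)).f) : φ = ψ := by
  have key : ∀ (φ : ofSeq E X ⟶ Y) {p q : Fin (n + 1)} (h : p ≤ q), (Hom.app φ h).f =
      (E.tensor (q.val - p.val)).map (X := interval X p q) (fun j => gen (E := E) X ⟨j + p, by
        have := q.is_le; have := j.is_lt; omega⟩ rfl rfl ≫
          (Hom.app φ (Fin.castSucc_le_succ _)).f) ≫ Y.comp (monoPath_interval h) := by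
    intro φ p q h
    refine (Category.id_comp _).symm.trans ?_
    refine (congrArg (· ≫ _) (map_gen_comp X h).symm).trans ?_
    refine (Category.assoc _ _ _).trans ?_
    refine (congrArg (_ ≫ ·) (Hom.app_comp φ (monoPath_interval h)).symm).trans ?_
    refine (Category.assoc _ _ _).symm.trans (congrArg (· ≫ _) ?_)
    exact ((E.tensor _).map_comp _ _).symm
  refine hom_ext fun {p q} hpq => ?_
  rw [key φ, key ψ]
  refine congrArg (fun g => (E.tensor _).map g ≫ _) (funext fun j => h _)

/-- An ordered category on a family of retracts of the homs of an ordered category. -/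
def retract {I : Type w₁} [Preorder I] (W : OCat E I) (hom' : I → I → E.unary.Algebra)
    (r : ∀ p q, (W.hom p q).A ⟶ (hom' p q).A) (s : ∀ p q, (hom' p q).A ⟶ (W.hom p q).A)
    (hsr : ∀ p q, s p q ≫ r p q = 𝟙 _)
    (hact : ∀ {p q}, p ≤ q → Multitensor.act (W.hom p q) ≫ r p q =
      (E.tensor 1).map (fun _ => r p q) ≫ Multitensor.act (hom' p q))
    (hrs : ∀ {k : ℕ} {c d : Fin k → I} {a b : I} (h : MonoPath c d a b),
      (E.tensor k).map (fun i => r (c i) (d i) ≫ s (c i) (d i)) ≫ W.comp h ≫ r a b =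
        W.comp h ≫ r a b) : OCat E I where
  hom := hom'
  comp {k c d a b} h := (E.tensor k).map (fun i => s (c i) (d i)) ≫ W.comp h ≫ r a b
  comp_edge {p q} h := by
    rw [W.comp_edge, hact h.le]
    refine (Category.assoc _ _ _).symm.trans ?_
    refine (congrArg (· ≫ _) ((E.tensor 1).map_comp _ _).symm).trans ?_
    refine (congrArg (fun f => (E.tensor 1).map f ≫ _) (funext fun _ => hsr p q)).trans ?_
    exact (congrArg (· ≫ _) ((E.tensor 1).map_id _)).trans (Category.id_comp _)
  comp_subst {k m n c d c₂ d₂ c' d' a b} hc hd h h' h₂ := by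
    have h₁ := W.comp_subst hc hd h h' h₂
    have h₃ : (E.tensor k).map (fun i => (E.tensor (n i)).map
        (fun j => s (c₂ i j) (d₂ i j))) ≫ E.subst (hc.map₂ hd fun p q => (W.hom p q).A) =
        E.subst (hc.map₂ hd fun p q => (hom' p q).A) ≫
          (E.tensor m).map (fun i => s (c i) (d i)) :=
      E.subst_naturality_of_heq _ _ _ _ fun i j => by rw [hc.entry_eq, hd.entry_eq]
    have h₄ : (E.tensor k).map (fun i => (E.tensor (n i)).map (fun j => s (c₂ i j) (d₂ i j)) ≫
        W.comp (h₂ i) ≫ r (c' i) (d' i)) ≫ (E.tensor k).map (fun i => s (c' i) (d' i)) =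
        (E.tensor k).map (fun i => (E.tensor (n i)).map (fun j => s (c₂ i j) (d₂ i j))) ≫
        (E.tensor k).map (fun i => W.comp (h₂ i)) ≫
        (E.tensor k).map (fun i => r (c' i) (d' i) ≫ s (c' i) (d' i)) := by
      refine ((E.tensor k).map_comp _ _).symm.trans ?_
      refine Eq.trans ?_ (congrArg (_ ≫ ·) ((E.tensor k).map_comp _ _))
      refine Eq.trans ?_ ((E.tensor k).map_comp _ _)
      refine congrArg (E.tensor k).map (funext fun i => ?_)
      exact (Category.assoc _ _ _).trans (congrArg (_ ≫ ·) (Category.assoc _ _ _))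
    rw [← Category.assoc, h₄, Category.assoc, Category.assoc, hrs h', ← Category.assoc _ _ (r a b),
      h₁, Category.assoc, ← Category.assoc, h₃, Category.assoc]

section Retract

variable {I : Type w₁} [Preorder I] (W : OCat E I) (hom' : I → I → E.unary.Algebra)
    (r : ∀ p q, (W.hom p q).A ⟶ (hom' p q).A) (s : ∀ p q, (hom' p q).A ⟶ (W.hom p q).A)
    (hsr : ∀ p q, s p q ≫ r p q = 𝟙 _)
    (hact : ∀ {p q}, p ≤ q → Multitensor.act (W.hom p q) ≫ r p q =
      (E.tensor 1).map (fun _ => r p q) ≫ Multitensor.act (hom' p q))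
    (hrs : ∀ {k : ℕ} {c d : Fin k → I} {a b : I} (h : MonoPath c d a b),
      (E.tensor k).map (fun i => r (c i) (d i) ≫ s (c i) (d i)) ≫ W.comp h ≫ r a b =
        W.comp h ≫ r a b)

/-- The projection to a retract. -/
def toRetract : W ⟶ retract W hom' r s hsr hact hrs :=
  Hom.ofMaps (fun {p q} _ => r p q) fun {k c d a b} h => by
    refine (Category.assoc _ _ _).symm.trans ?_
    refine (congrArg (· ≫ _) ((E.tensor k).map_comp _ _).symm).trans ?_
    exact hrs h

/-- Maps out of a retract. -/
def retractDesc {Y : OCat E I} (φ : W ⟶ Y)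
    (hφ : ∀ {p q} (h : p ≤ q), r p q ≫ s p q ≫ (Hom.app φ h).f = (Hom.app φ h).f) :
    retract W hom' r s hsr hact hrs ⟶ Y :=
  Hom.ofMaps (fun {p q} h => s p q ≫ (Hom.app φ h).f) fun {k c d a b} h => by
    have h₁ := Hom.app_comp φ h
    refine (congrArg (· ≫ _) ((E.tensor k).map_comp _ _)).trans ?_
    refine (Category.assoc _ _ _).trans ((congrArg (_ ≫ ·) h₁).trans ?_)
    refine Eq.trans ?_ (Category.assoc _ _ _).symm
    refine congrArg (_ ≫ ·) (Eq.trans ?_ (Category.assoc _ _ _).symm)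
    exact congrArg (_ ≫ ·) (hφ h.le).symm

end Retract

end OCat

/-! ### The free ordered category on a single algebra -/

namespace OCat

variable {V : Type u} [Category.{v} V] {E : Multitensor V}

/-- The homs of the free ordered category on an algebra. -/
def singleHom (X : E.unary.Algebra) : ℕ → E.unary.Algebra
  | 0 => E.tensorAlgebra (fun _ : Fin 0 => X.A)
  | 1 => X
  -- Over `Fin 2` only lengths `0` and `1` occur, so this is a default value.
  | m + 2 => E.tensorAlgebra (fun _ : Fin (m + 2) => X.A)

/-- The projection onto the homs of the free ordered category on an algebra. -/
def singleProj (X : E.unary.Algebra) :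
    ∀ m, (E.tensor m).obj (fun _ => X.A) ⟶ (singleHom X m).A
  | 0 => 𝟙 _
  | 1 => Multitensor.act X
  | _ + 2 => 𝟙 _

/-- The section of `singleProj`. -/
def singleSection (X : E.unary.Algebra) :
    ∀ m, (singleHom X m).A ⟶ (E.tensor m).obj (fun _ => X.A)
  | 0 => 𝟙 _
  | 1 => E.unit X.A
  | _ + 2 => 𝟙 _

theorem singleSection_proj (X : E.unary.Algebra) :
    ∀ m, singleSection X m ≫ singleProj X m = 𝟙 _
  | 0 => Category.comp_id _
  | 1 => Multitensor.unit_act X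
  | _ + 2 => Category.comp_id _

theorem act_singleProj (X : E.unary.Algebra) :
    ∀ m, Multitensor.act (E.tensorAlgebra (fun _ : Fin m => X.A)) ≫ singleProj X m =
      (E.tensor 1).map (fun _ => singleProj X m) ≫ Multitensor.act (singleHom X m)
  | 0 => (Category.comp_id _).trans
      ((congrArg (· ≫ _) ((E.tensor 1).map_id _)).trans (Category.id_comp _)).symm
  | 1 => Multitensor.subst_act X
  | _ + 2 => (Category.comp_id _).trans
      ((congrArg (· ≫ _) ((E.tensor 1).map_id _)).trans (Category.id_comp _)).symm

/-- A section of the substitution `Eₘ E₁ ⟶ Eₘ`. -/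
def singleInsert (X : E.unary.Algebra) : ∀ m, (E.tensor m).obj (fun _ => X.A) ⟶
    (E.tensor m).obj (fun _ => (E.tensor 1).obj (fun _ => X.A))
  | 0 => (E.tensor 0).map fun _ => E.unit X.A
  | 1 => E.unit ((E.tensor 1).obj (fun _ => X.A))
  | m + 2 => (E.tensor (m + 2)).map fun _ => E.unit X.A

theorem singleInsert_subst (X : E.unary.Algebra) : ∀ m, singleInsert X m ≫
    E.subst (IsConcat.singletons (fun _ : Fin m => X.A)) = 𝟙 _
  | 0 => E.unit_inner _
  | 1 => E.unit_outer (fun _ : Fin 1 => X.A)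
  | _ + 2 => E.unit_inner _

theorem map_unit_map_act (X : E.unary.Algebra) (m : ℕ) :
    (E.tensor m).map (fun _ => E.unit X.A) ≫ (E.tensor m).map (fun _ => Multitensor.act X) =
      𝟙 ((E.tensor m).obj fun _ => X.A) := by
  refine ((E.tensor m).map_comp _ _).symm.trans (Eq.trans ?_ ((E.tensor m).map_id _))
  exact congrArg (E.tensor m).map (funext fun _ => Multitensor.unit_act X)

/-- In length one this is naturality of the unit, which is why `singleInsert` uses the outer unit
there; in the other lengths the inner units cancel against the actions. -/
theorem singleProj_section (X : E.unary.Algebra) : ∀ m, singleProj X m ≫ singleSection X m =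
    singleInsert X m ≫ (E.tensor m).map fun _ => Multitensor.act X
  | 0 => (Category.comp_id _).trans (map_unit_map_act X _).symm
  | 1 => E.unit_naturality (Multitensor.act X)
  | m + 2 => (Category.comp_id _).trans (map_unit_map_act X (m + 2)).symm

/-- Without entries there is only one family of maps to tensor, so `unit_inner` applies; with one
entry this is associativity of the algebra. Longer sequences are excluded. -/
theorem subst_singleProj (X : E.unary.Algebra) : ∀ {m}, m ≤ 1 →
    (E.tensor m).map (fun _ => Multitensor.act X) ≫ singleProj X m =
      E.subst (IsConcat.singletons (fun _ : Fin m => X.A)) ≫ singleProj X m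
  | 0, _ => by
      refine congrArg (· ≫ _) ?_
      refine (Category.comp_id _).symm.trans ?_
      refine (congrArg (_ ≫ ·) (E.unit_inner (fun _ : Fin 0 => X.A)).symm).trans ?_
      refine (Category.assoc _ _ _).symm.trans ?_
      refine (congrArg (· ≫ _) ?_).trans (Category.id_comp _)
      refine ((E.tensor 0).map_comp _ _).symm.trans (Eq.trans ?_ ((E.tensor 0).map_id _))
      exact congrArg (E.tensor 0).map (funext fun i => i.elim0)
  | 1, _ => (Multitensor.subst_act X).symm

/-- The idempotent `singleProj ≫ singleSection` inserts units and then acts. Naturality of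
substitution moves the action outside, where `subst_singleProj` trades it for a substitution;
associativity brings this back inside, and there it cancels the insertion. -/
theorem singleProj_comp (X : E.unary.Algebra) {k : ℕ} {n : Fin k → ℕ} {m : ℕ} (hm : m ≤ 1)
    (h : IsConcat (fun i (_ : Fin (n i)) => X.A) (fun _ : Fin m => X.A)) :
    (E.tensor k).map (fun i => singleProj X (n i) ≫ singleSection X (n i)) ≫
      E.subst h ≫ singleProj X m = E.subst h ≫ singleProj X m := by
  have h₁ : IsConcat (fun i (_ : Fin (n i)) => (E.tensor 1).obj (fun _ => X.A))
    (fun _ : Fin m => (E.tensor 1).obj (fun _ => X.A)) := ⟨h.length_eq, fun _ _ => rfl⟩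
  have h₂ : (E.tensor k).map (fun i => (E.tensor (n i)).map fun _ => Multitensor.act X) ≫
      E.subst h = E.subst h₁ ≫ (E.tensor m).map fun _ => Multitensor.act X :=
    E.subst_naturality_of_heq _ _ _ _ fun _ _ => HEq.rfl
  have h₃ : (E.tensor k).map (fun i => E.subst (IsConcat.singletons (fun _ : Fin (n i) => X.A))) ≫
      E.subst h = E.subst h₁ ≫ E.subst (IsConcat.singletons (fun _ : Fin m => X.A)) :=
    E.subst_assoc_of_isConcat (p := fun _ => 1) (Y := fun _ _ => X.A)
      ⟨h.length_eq, fun _ _ => rfl⟩ _ _ _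
  have h₄ : (E.tensor k).map (fun i => singleProj X (n i) ≫ singleSection X (n i)) =
      (E.tensor k).map (fun i => singleInsert X (n i)) ≫
        (E.tensor k).map (fun i => (E.tensor (n i)).map fun _ => Multitensor.act X) :=
    Eq.trans (congrArg (E.tensor k).map (funext fun i => singleProj_section X (n i)))
      ((E.tensor k).map_comp _ _)
  have h₅ : (E.tensor k).map (fun i => singleInsert X (n i)) ≫
      (E.tensor k).map (fun i => E.subst (IsConcat.singletons (fun _ : Fin (n i) => X.A))) =
      𝟙 _ := by
    refine ((E.tensor k).map_comp _ _).symm.trans (Eq.trans ?_ ((E.tensor k).map_id _))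
    exact congrArg (E.tensor k).map (funext fun i => singleInsert_subst X (n i))
  rw [h₄, Category.assoc, ← Category.assoc _ (E.subst h), h₂, Category.assoc,
    subst_singleProj X hm, ← Category.assoc (E.subst h₁), ← h₃, Category.assoc,
    ← Category.assoc, h₅, Category.id_comp]

theorem singleProj_comp_ofSeq (X : E.unary.Algebra) {k : ℕ} {c d : Fin k → Fin 2} {a b : Fin 2}
    (h : MonoPath c d a b) :
    (E.tensor k).map (fun i => singleProj X ((d i).val - (c i).val) ≫
      singleSection X ((d i).val - (c i).val)) ≫
      (ofSeq E (fun _ : Fin 1 => X.A)).comp h ≫ singleProj X (b.val - a.val) =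
        (ofSeq E (fun _ : Fin 1 => X.A)).comp h ≫ singleProj X (b.val - a.val) :=
  singleProj_comp X (by omega) (h.isConcat_interval (fun _ : Fin 1 => X.A))

/-- The free ordered category on an algebra. -/
def single (X : E.unary.Algebra) : OCat E (Fin 2) :=
  retract (ofSeq E (fun _ : Fin 1 => X.A)) (fun p q => singleHom X (q.val - p.val))
    (fun p q => singleProj X (q.val - p.val)) (fun p q => singleSection X (q.val - p.val))
    (fun _ _ => singleSection_proj X _) (fun _ => act_singleProj X _) (singleProj_comp_ofSeq X)

/-- The projection onto the free ordered category on an algebra. -/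
def toSingle (X : E.unary.Algebra) : ofSeq E (fun _ : Fin 1 => X.A) ⟶ single X :=
  toRetract (ofSeq E (fun _ : Fin 1 => X.A)) (fun p q => singleHom X (q.val - p.val))
    (fun p q => singleProj X (q.val - p.val)) (fun p q => singleSection X (q.val - p.val))
    (fun _ _ => singleSection_proj X _) (fun _ => act_singleProj X _) (singleProj_comp_ofSeq X)

variable {X : E.unary.Algebra} {Y : OCat E (Fin 2)}

/-- The family of maps given by a single map. -/
def singleFamily (f : X ⟶ Y.hom 0 1) :
    ∀ b : Fin 1, X.A ⟶ (Y.hom b.castSucc b.succ).A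
  | ⟨0, _⟩ => f.f

theorem unit_seqDesc_singleFamily (f : X ⟶ Y.hom 0 1) :
    E.unit X.A ≫ (Hom.app (seqDesc (X := fun _ : Fin 1 => X.A) (singleFamily f))
      (Fin.castSucc_le_succ 0)).f = f.f :=
  (congrArg (· ≫ _) (E.unitCast_eq X.A).symm).trans
    (gen_seqDesc (X := fun _ : Fin 1 => X.A) (singleFamily f) 0)

/-- Only the hom from `0` to `1` needs an argument: since `f` is a map of algebras, its extension to
`E₁ X` factors through the action of `X`. -/
theorem singleProj_section_desc (f : X ⟶ Y.hom 0 1) {p q : Fin 2} (h : p ≤ q) :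
    singleProj X (q.val - p.val) ≫ singleSection X (q.val - p.val) ≫
      (Hom.app (seqDesc (X := fun _ : Fin 1 => X.A) (singleFamily f)) h).f =
      (Hom.app (seqDesc (X := fun _ : Fin 1 => X.A) (singleFamily f)) h).f := by
  fin_cases p <;> fin_cases q
  · exact (Category.id_comp _).trans (Category.id_comp _)
  · have h₁ := unit_seqDesc_singleFamily f
    have h₂ := Multitensor.map_act (Hom.app (seqDesc (X := fun _ : Fin 1 => X.A)
      (singleFamily f)) (Fin.castSucc_le_succ 0))
    refine (congrArg (_ ≫ ·) h₁).trans ((Multitensor.map_act f).symm.trans ?_)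
    refine (congrArg (fun g => (E.tensor 1).map g ≫ _) (funext fun _ => h₁.symm)).trans ?_
    refine (congrArg (· ≫ _) ((E.tensor 1).map_comp _ _)).trans ?_
    refine (Category.assoc _ _ _).trans ((congrArg (_ ≫ ·) h₂).trans ?_)
    refine (Category.assoc _ _ _).symm.trans ?_
    exact (congrArg (· ≫ _) (E.unit_inner (fun _ : Fin 1 => X.A))).trans (Category.id_comp _)
  · exact absurd h (by decide)
  · exact (Category.id_comp _).trans (Category.id_comp _)

/-- Maps out of the free ordered category on an algebra. -/
def singleDesc (f : X ⟶ Y.hom 0 1) : single X ⟶ Y :=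
  retractDesc (ofSeq E (fun _ : Fin 1 => X.A)) (fun p q => singleHom X (q.val - p.val))
    (fun p q => singleProj X (q.val - p.val)) (fun p q => singleSection X (q.val - p.val))
    (fun _ _ => singleSection_proj X _) (fun _ => act_singleProj X _) (singleProj_comp_ofSeq X)
    (seqDesc (X := fun _ : Fin 1 => X.A) (singleFamily f)) (singleProj_section_desc f)

theorem singleDesc_app (f : X ⟶ Y.hom 0 1) :
    Hom.app (singleDesc f) (Fin.castSucc_le_succ (0 : Fin 1)) = f :=
  Monad.Algebra.Hom.ext ((show _ = E.unit X.A ≫ _ from rfl).trans (unit_seqDesc_singleFamily f))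

/-- `toSingle` is split on every hom, so morphisms can be compared on `ofSeq`, and there on the
unique generator. -/
theorem single_hom_ext {φ ψ : single X ⟶ Y}
    (h : Hom.app φ (Fin.castSucc_le_succ (0 : Fin 1)) =
      Hom.app ψ (Fin.castSucc_le_succ (0 : Fin 1))) : φ = ψ := by
  have key : toSingle X ≫ φ = toSingle X ≫ ψ :=
    seq_hom_ext fun b => by
      obtain rfl : b = 0 := Subsingleton.elim _ _
      exact congrArg (fun f : X ⟶ Y.hom (Fin.castSucc (0 : Fin 1)) (Fin.succ 0) =>
        gen (E := E) (fun _ : Fin 1 => X.A) 0 rfl rfl ≫ singleProj X 1 ≫ f.f) h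
  refine hom_ext fun {p q} hpq => ?_
  have h₁ := congrArg (singleSection X (q.val - p.val) ≫ ·)
    (congrArg (fun χ => (Hom.app χ hpq).f) key)
  have h₂ : ∀ χ : single X ⟶ Y, singleSection X (q.val - p.val) ≫
      singleProj X (q.val - p.val) ≫ (Hom.app χ hpq).f = (Hom.app χ hpq).f := fun χ =>
    (Category.assoc _ _ _).symm.trans ((congrArg (· ≫ _) (singleSection_proj X _)).trans
      (Category.id_comp _))
  exact (h₂ φ).symm.trans (h₁.trans (h₂ ψ))

end OCat

/-! ### Free ordered categories on sequences of algebras -/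

section Cuts

variable {k m r : ℕ} (n : Fin k → ℕ) (hm : ∑ i, n i = m) (p : Fin m → ℕ) (hr : ∑ s, p s = r)

/-- The total splits into the earlier blocks and the part of the current one. From this, cuts made
in two stages are compared with cuts made at once, as associativity of the lifted substitution
requires. -/
theorem partialSum_blockVertex (i : Fin k) (j : Fin (n i + 1)) :
    Fin.partialSum p (blockVertex n hm i j) = Fin.partialSum p (cutVertex n hm i.castSucc) +
      Fin.partialSum (fun j => p (blockPos n hm i j)) j := by
  induction j using Fin.induction with
  | zero => rw [blockVertex_zero, Fin.partialSum_zero, Nat.add_zero]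
  | succ j ih =>
    rw [Fin.partialSum_succ, ← Nat.add_assoc, ← ih]
    exact Fin.partialSum_succ p (blockPos n hm i j)

theorem partialSum_cutVertex (q : Fin k → ℕ) (hq : ∀ i, ∑ j, p (blockPos n hm i j) = q i)
    (i : Fin (k + 1)) : Fin.partialSum p (cutVertex n hm i) = Fin.partialSum q i := by
  induction i using Fin.induction with
  | zero => rw [cutVertex_zero, Fin.partialSum_zero, Fin.partialSum_zero]
  | succ i ih =>
    rw [← blockVertex_last, partialSum_blockVertex, ih, partialSum_last_eq, hq,
      Fin.partialSum_succ]

theorem isConcat_blockPos (q : Fin k → ℕ) (hq : ∀ i, ∑ j, p (blockPos n hm i j) = q i)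
    (hqr : ∑ i, q i = r) (i : Fin k) :
    IsConcat (fun j l => blockPos p hr (blockPos n hm i j) l) (blockPos q hqr i) where
  length_eq := hq i
  entry_eq j l := Fin.ext (by
    have h := partialSum_blockVertex n hm p i j.castSucc
    rw [partialSum_cutVertex n hm p q hq] at h
    have h' : Fin.partialSum p (blockPos n hm i j).castSucc = _ := h
    simp only [blockPos] at h' ⊢
    rw [h']
    omega)

theorem monoPath_block_cuts (q : Fin k → ℕ) (hq : ∀ i, ∑ j, p (blockPos n hm i j) = q i)
    (hqr : ∑ i, q i = r) (i : Fin k) :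
    MonoPath (fun j => cutVertex p hr (blockPos n hm i j).castSucc)
      (fun j => cutVertex p hr (blockPos n hm i j).succ)
      (cutVertex q hqr i.castSucc) (cutVertex q hqr i.succ) := by
  have h := MonoPath.block hm (monotone_cutVertex p hr) i
  have hv : ∀ i, cutVertex p hr (cutVertex n hm i) = cutVertex q hqr i := fun i =>
    Fin.ext (partialSum_cutVertex n hm p q hq i)
  rwa [hv, hv] at h

end Cuts

theorem MonoPath.succ_step (n : ℕ) :
    MonoPath (Fin.castSucc : Fin n → Fin (n + 1)) Fin.succ 0 (Fin.last n) :=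
  MonoPath.of_monotone monotone_id

namespace OCat

variable {V : Type u} [Category.{v} V] {E : Multitensor V} {n : ℕ}

/-- A free ordered category on a sequence of algebras. -/
structure Free (X : Fin n → E.unary.Algebra) where
  cat : OCat E (Fin (n + 1))
  ι (b : Fin n) : X b ⟶ cat.hom b.castSucc b.succ
  existsUnique_desc (Y : OCat E (Fin (n + 1))) (f : ∀ b, X b ⟶ Y.hom b.castSucc b.succ) :
    ∃! φ : cat ⟶ Y, ∀ b, ι b ≫ Hom.app φ (Fin.castSucc_le_succ b) = f b

/-- The free ordered category on a single algebra. -/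
def freeSingle (X : Fin 1 → E.unary.Algebra) : Free X where
  cat := single (X 0)
  ι
    | ⟨0, _⟩ => 𝟙 (X 0)
  existsUnique_desc Y f := by
    refine ⟨singleDesc (f 0), fun b => ?_, fun φ hφ => single_hom_ext ?_⟩
    · obtain rfl : b = 0 := Subsingleton.elim _ _
      exact (Category.id_comp _).trans (singleDesc_app (f 0))
    · refine (Category.id_comp _).symm.trans ((hφ 0).trans ?_)
      exact (singleDesc_app (f 0)).symm

/-- Free ordered categories exist. -/
theorem nonempty_free [HasColimitsOfSize.{v, v} V] (κ : Cardinal.{v}) [Fact κ.IsRegular]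
    (hE : E.IsCardinalAccessible κ) (X : Fin n → E.unary.Algebra) : Nonempty (Free X) := by
  let W := ofSeq E (fun b => (X b).A)
  let γ : ∀ b, (X b).A ⟶ (W.hom b.castSucc b.succ).A := fun b => gen (fun b => (X b).A) b rfl rfl
  -- The relations say precisely that the generators, so far mere maps in `V`, become maps of
  -- algebras.
  obtain ⟨Z, φ, hφ, hZ⟩ := W.exists_quotient κ hE Fin.castSucc Fin.succ Fin.castSucc_le_succ
    (fun b => (E.tensor 1).map (fun _ => γ b) ≫ Multitensor.act (W.hom b.castSucc b.succ))
    (fun b => Multitensor.act (X b) ≫ γ b)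
  have key : ∀ {Y : OCat E (Fin (n + 1))} (ψ : W ⟶ Y) (b : Fin n)
      (f : (X b).A ⟶ (Y.hom b.castSucc b.succ).A)
      (hf : γ b ≫ (Hom.app ψ (Fin.castSucc_le_succ b)).f = f),
      (E.tensor 1).map (fun _ => f) ≫ Multitensor.act (Y.hom b.castSucc b.succ) =
        ((E.tensor 1).map (fun _ => γ b) ≫ Multitensor.act (W.hom b.castSucc b.succ)) ≫
          (Hom.app ψ (Fin.castSucc_le_succ b)).f := by
    rintro Y ψ b f rfl
    refine (congrArg (· ≫ _) ((E.tensor 1).map_comp _ _)).trans ?_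
    refine (Category.assoc _ _ _).trans (Eq.trans ?_ (Category.assoc _ _ _).symm)
    exact congrArg (_ ≫ ·) (Multitensor.map_act _)
  refine ⟨⟨Z, fun b => ⟨γ b ≫ (Hom.app φ (Fin.castSucc_le_succ b)).f, ?_⟩, fun Y f => ?_⟩⟩
  · refine (key φ b _ rfl).trans ((hφ b).trans ?_)
    exact Category.assoc _ _ _
  · have hψ : ∀ b, γ b ≫ (Hom.app (seqDesc (Y := Y) fun b => (f b).f)
        (Fin.castSucc_le_succ b)).f = (f b).f := gen_seqDesc _
    obtain ⟨χ, hχ, hu⟩ := hZ Y (seqDesc fun b => (f b).f) fun b => by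
      refine (key _ b _ (hψ b)).symm.trans ((Multitensor.map_act (f b)).trans ?_)
      refine Eq.trans ?_ (Category.assoc _ _ _).symm
      exact congrArg (_ ≫ ·) (hψ b).symm
    refine ⟨χ, fun b => Monad.Algebra.Hom.ext ?_, fun χ' hχ' => hu χ' (seq_hom_ext fun b => ?_)⟩
    · refine (Category.assoc _ _ _).trans (Eq.trans ?_ (hψ b))
      exact congrArg (γ b ≫ ·) (congrArg (fun φ => (Hom.app φ (Fin.castSucc_le_succ b)).f) hχ)
    · refine Eq.trans ?_ (hψ b).symm
      refine Eq.trans ?_ (congrArg Monad.Algebra.Hom.f (hχ' b))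
      exact (Category.assoc _ _ _).symm

namespace Free

variable {X : Fin n → E.unary.Algebra} (S : Free X) {Y : OCat E (Fin (n + 1))}

/-- Maps out of a free ordered category. -/
noncomputable def desc (f : ∀ b, X b ⟶ Y.hom b.castSucc b.succ) : S.cat ⟶ Y :=
  (S.existsUnique_desc Y f).choose

theorem ι_desc (f : ∀ b, X b ⟶ Y.hom b.castSucc b.succ) (b : Fin n) :
    S.ι b ≫ Hom.app (S.desc f) (Fin.castSucc_le_succ b) = f b :=
  (S.existsUnique_desc Y f).choose_spec.1 b

theorem hom_ext {φ ψ : S.cat ⟶ Y} (h : ∀ b, S.ι b ≫ Hom.app φ (Fin.castSucc_le_succ b) =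
    S.ι b ≫ Hom.app ψ (Fin.castSucc_le_succ b)) : φ = ψ :=
  (S.existsUnique_desc Y _).unique h fun _ => rfl

end Free

end OCat

namespace Multitensor

variable {V : Type u} [Category.{v} V] {E : Multitensor V}

/-- The existence of free ordered categories. -/
def HasFree (E : Multitensor V) : Prop :=
  ∀ (n : ℕ) (X : Fin n → E.unary.Algebra), Nonempty (OCat.Free X)

namespace HasFree

/-- A choice of free ordered categories. -/
noncomputable def free (hS : E.HasFree) : ∀ {n : ℕ} (X : Fin n → E.unary.Algebra), OCat.Free X
  | 0, X => (hS 0 X).some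
  -- This choice makes the lifted unary part the identity on objects by definition, as needed for a
  -- functor operad in the strict sense.
  | 1, X => OCat.freeSingle X
  | n + 2, X => (hS (n + 2) X).some

variable (hS : E.HasFree) {n : ℕ}

/-- The value of the lifted multitensor on objects. -/
noncomputable def obj (X : Fin n → E.unary.Algebra) : E.unary.Algebra :=
  (hS.free X).cat.hom 0 (Fin.last n)

variable {X : Fin n → E.unary.Algebra} {I : Type w₁} [Preorder I] {Z : OCat E I}

/-- The map out of a value of the lifted multitensor given by maps along a sequence of vertices. -/
noncomputable def extAux {c d : Fin n → I} {a b : I} (x : Fin (n + 1) → I) (hx : Monotone x)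
    (ha : x 0 = a) (hb : x (Fin.last n) = b) (hc : ∀ i, x i.castSucc = c i)
    (hd : ∀ i, x i.succ = d i) (f : ∀ j, X j ⟶ Z.hom (c j) (d j)) : hS.obj X ⟶ Z.hom a b :=
  OCat.Hom.app ((hS.free X).desc (Y := Z.pull hx) fun j =>
    f j ≫ eqToHom (congrArg₂ Z.hom (hc j).symm (hd j).symm)) (Fin.zero_le _) ≫
      eqToHom (congrArg₂ Z.hom ha hb)

theorem extAux_eq {x y : Fin (n + 1) → I} (hy : Monotone y) (hx : Monotone x) (h : y = x) (ha hb)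
    (hc hd) (f : ∀ j : Fin n, X j ⟶ Z.hom (x j.castSucc) (x j.succ)) :
    hS.extAux y hy ha hb hc hd f =
      OCat.Hom.app ((hS.free X).desc (Y := Z.pull hx) f) (Fin.zero_le (Fin.last n)) := by
  subst h
  refine (Category.comp_id _).trans ?_
  refine congrArg (fun f => OCat.Hom.app ((hS.free X).desc (Y := Z.pull hx) f) _) ?_
  exact funext fun j => Category.comp_id _

/-- The map out of a value of the lifted multitensor given by maps along a path. -/
noncomputable def ext {c d : Fin n → I} {a b : I} (h : MonoPath c d a b)
    (f : ∀ j, X j ⟶ Z.hom (c j) (d j)) : hS.obj X ⟶ Z.hom a b :=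
  hS.extAux h.choose h.choose_spec.1 h.choose_spec.2.1 h.choose_spec.2.2.1 h.choose_spec.2.2.2.1
    h.choose_spec.2.2.2.2 f

/-- A path is determined by its start and its targets, so the vertices chosen in `ext` are the given
ones and all transports disappear. Every computation with `ext` passes through this case. -/
theorem ext_of_monotone {x : Fin (n + 1) → I} (hx : Monotone x)
    (f : ∀ j : Fin n, X j ⟶ Z.hom (x j.castSucc) (x j.succ)) :
    hS.ext (MonoPath.of_monotone hx) f =
      OCat.Hom.app ((hS.free X).desc (Y := Z.pull hx) f) (Fin.zero_le (Fin.last n)) := by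
  refine hS.extAux_eq _ hx (funext fun i => ?_) _ _ _ _ f
  obtain ⟨-, h₁, -, -, h₂⟩ := (MonoPath.of_monotone hx).choose_spec
  induction i using Fin.cases with
  | zero => exact h₁
  | succ i => exact h₂ i

/-- Both sides come from morphisms out of the same free ordered category, and these agree on
generators. -/
theorem ext_comp {Z' : OCat E I} (φ : Z ⟶ Z') {c d : Fin n → I} {a b : I} (h : MonoPath c d a b)
    (f : ∀ j, X j ⟶ Z.hom (c j) (d j)) :
    hS.ext h f ≫ OCat.Hom.app φ h.le = hS.ext h fun j => f j ≫ OCat.Hom.app φ (h.step j) := by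
  obtain ⟨x, hx, rfl, rfl, hc, hd⟩ := h
  obtain rfl := funext hc
  obtain rfl := funext hd
  refine (congrArg (· ≫ _) (hS.ext_of_monotone hx f)).trans
    (Eq.trans ?_ (hS.ext_of_monotone hx _).symm)
  refine congrArg (fun φ => OCat.Hom.app φ (Fin.zero_le (Fin.last n))) (a₁ :=
    (hS.free X).desc (Y := Z.pull hx) f ≫ OCat.pullMap φ hx) ?_
  refine (hS.free X).hom_ext fun b => ?_
  refine (Category.assoc _ _ _).symm.trans ((congrArg (· ≫ _) ((hS.free X).ι_desc _ b)).trans ?_)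
  exact ((hS.free X).ι_desc (Y := Z'.pull hx)
    (fun j => f j ≫ OCat.Hom.app φ (hx (Fin.castSucc_le_succ j))) b).symm

theorem ext_map {I' : Type w₂} [Preorder I'] {y : I → I'} (hy : Monotone y) {Z : OCat E I'}
    {c d : Fin n → I} {a b : I} (h : MonoPath c d a b)
    (f : ∀ j, X j ⟶ Z.hom (y (c j)) (y (d j))) :
    hS.ext (h.map hy) f = hS.ext (Z := Z.pull hy) h f := by
  obtain ⟨x, hx, rfl, rfl, hc, hd⟩ := h
  obtain rfl := funext hc
  obtain rfl := funext hd
  exact (hS.ext_of_monotone (hy.comp hx) f).trans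
    (hS.ext_of_monotone (Z := Z.pull hy) hx f).symm

theorem ext_ι (X : Fin n → E.unary.Algebra) :
    hS.ext (MonoPath.succ_step n) (hS.free X).ι = 𝟙 (hS.obj X) := by
  refine (hS.ext_of_monotone monotone_id _).trans ?_
  refine congrArg (fun φ : (hS.free X).cat ⟶ (hS.free X).cat =>
    OCat.Hom.app φ (Fin.zero_le (Fin.last n))) (a₂ := 𝟙 _) ?_
  refine (hS.free X).hom_ext fun b => ?_
  exact ((hS.free X).ι_desc _ b).trans (Category.comp_id _).symm

/-- The value of the lifted multitensor on morphisms. -/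
noncomputable def map {X Y : Fin n → E.unary.Algebra} (g : ∀ j, X j ⟶ Y j) :
    hS.obj X ⟶ hS.obj Y :=
  hS.ext (MonoPath.succ_step n) fun j => g j ≫ (hS.free Y).ι j

theorem map_ext {Y : Fin n → E.unary.Algebra} (g : ∀ j, Y j ⟶ X j) {c d : Fin n → I} {a b : I}
    (h : MonoPath c d a b) (f : ∀ j, X j ⟶ Z.hom (c j) (d j)) :
    hS.map g ≫ hS.ext h f = hS.ext h fun j => g j ≫ f j := by
  obtain ⟨x, hx, rfl, rfl, hc, hd⟩ := h
  obtain rfl := funext hc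
  obtain rfl := funext hd
  refine (congrArg (_ ≫ ·) (hS.ext_of_monotone hx f)).trans ?_
  refine (hS.ext_comp _ _ _).trans (Eq.trans ?_ (hS.ext_map (Z := Z) hx
    (MonoPath.succ_step n) (fun j => g j ≫ f j)).symm)
  refine congrArg (hS.ext (Z := Z.pull hx) _) (funext fun j => ?_)
  exact (Category.assoc _ _ _).trans (congrArg (_ ≫ ·) ((hS.free X).ι_desc _ j))

/-- The unit of the lifted multitensor. -/
noncomputable def unit (X : E.unary.Algebra) : X ⟶ hS.obj (fun _ : Fin 1 => X) := 𝟙 X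

theorem unit_ext {X : E.unary.Algebra} {c d : Fin 1 → I} (h : MonoPath c d (c 0) (d 0))
    (f : ∀ j, X ⟶ Z.hom (c j) (d j)) : hS.unit X ≫ hS.ext h f = f 0 := by
  obtain ⟨x, hx, -, -, hc, hd⟩ := h
  obtain rfl := funext hc
  obtain rfl := funext hd
  refine (congrArg (_ ≫ ·) (hS.ext_of_monotone hx f)).trans ?_
  exact (hS.free fun _ : Fin 1 => X).ι_desc (Y := Z.pull hx) f 0

/-- The substitution of the lifted multitensor. -/
noncomputable def subst {k : ℕ} {n : Fin k → ℕ} {Y : ∀ i, Fin (n i) → E.unary.Algebra} {m : ℕ}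
    {X : Fin m → E.unary.Algebra} (h : IsConcat Y X) :
    hS.obj (fun i => hS.obj (Y i)) ⟶ hS.obj X :=
  hS.ext (MonoPath.cuts h.length_eq monotone_id) fun i =>
    hS.ext (Z := (hS.free X).cat) (MonoPath.block h.length_eq monotone_id i) fun j =>
      eqToHom (h.entry_eq i j) ≫ (hS.free X).ι (blockPos n h.length_eq i j)

/-- Extending along a path at once or block by block gives the same map; this is what turns the
substitution axioms of `lift` into identities between nested extensions. -/
theorem subst_ext {k m : ℕ} {n : Fin k → ℕ} {Y : ∀ i, Fin (n i) → E.unary.Algebra}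
    {X : Fin m → E.unary.Algebra} (hX : IsConcat Y X) {c d : Fin m → I} {c₂ d₂ : ∀ i, Fin (n i) → I}
    {c' d' : Fin k → I} {a b : I} (hc : IsConcat c₂ c) (hd : IsConcat d₂ d)
    (h : MonoPath c d a b) (h' : MonoPath c' d' a b)
    (h₂ : ∀ i, MonoPath (c₂ i) (d₂ i) (c' i) (d' i)) (f : ∀ s, X s ⟶ Z.hom (c s) (d s))
    (g : ∀ i j, Y i j ⟶ Z.hom (c₂ i j) (d₂ i j))
    (hgf : ∀ i j, HEq (g i j) (f (blockPos n hX.length_eq i j))) :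
    hS.subst hX ≫ hS.ext h f = hS.ext h' fun i => hS.ext (h₂ i) (g i) := by
  obtain ⟨hm, hYX⟩ := hX
  obtain rfl : Y = fun i j => X (blockPos n hm i j) := funext fun i => funext fun j => hYX i j
  obtain ⟨x, hx, rfl, rfl, rfl, rfl, rfl, rfl, rfl, rfl⟩ :=
    MonoPath.exists_blocks hm hc hd h h' h₂
  obtain rfl : g = fun i j => f (blockPos n hm i j) :=
    funext fun i => funext fun j => eq_of_heq (hgf i j)
  refine (congrArg (_ ≫ ·) (hS.ext_of_monotone hx f)).trans ?_
  refine (hS.ext_comp _ _ _).trans (Eq.trans ?_ (hS.ext_map (Z := Z) hx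
    (MonoPath.cuts hm monotone_id) _).symm)
  refine congrArg (hS.ext (Z := Z.pull hx) _) (funext fun i => ?_)
  refine (hS.ext_comp _ _ _).trans (Eq.trans ?_ (hS.ext_map (Z := Z) hx
    (MonoPath.block hm monotone_id i) _).symm)
  refine congrArg (hS.ext (Z := Z.pull hx) _) (funext fun j => ?_)
  refine (congrArg (· ≫ _) (Category.id_comp _)).trans ?_
  exact (hS.free X).ι_desc _ _

theorem subst_eq_ext {k m : ℕ} {n : Fin k → ℕ} {Y : ∀ i, Fin (n i) → E.unary.Algebra}
    {X : Fin m → E.unary.Algebra} (hX : IsConcat Y X) {c₂ d₂ : ∀ i, Fin (n i) → Fin (m + 1)}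
    {c' d' : Fin k → Fin (m + 1)} (hc : IsConcat c₂ Fin.castSucc) (hd : IsConcat d₂ Fin.succ)
    (h' : MonoPath c' d' 0 (Fin.last m)) (h₂ : ∀ i, MonoPath (c₂ i) (d₂ i) (c' i) (d' i))
    (g : ∀ i j, Y i j ⟶ (hS.free X).cat.hom (c₂ i j) (d₂ i j))
    (hg : ∀ i j, HEq (g i j) ((hS.free X).ι (blockPos n hX.length_eq i j))) :
    hS.subst hX = hS.ext h' fun i => hS.ext (h₂ i) (g i) := by
  refine (Category.comp_id _).symm.trans ((congrArg (_ ≫ ·) (hS.ext_ι X).symm).trans ?_)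
  exact hS.subst_ext hX hc hd _ _ _ _ _ hg

end HasFree

end Multitensor

/-! ### The lifted multitensor -/

/-- Once the functor and the unit are trivial, the left unit law makes the multiplication trivial as
well. -/
theorem CategoryTheory.Monad.eq_id_of_toFunctor_eq {V : Type u} [Category.{v} V]
    {M : CategoryTheory.Monad V}
    (h : M.toFunctor = 𝟭 V)
    (hη : ∀ X, M.η.app X = eqToHom (congrArg (fun F : V ⥤ V => F.obj X) h).symm) :
    M = Monad.id V := by
  have hμ := M.left_unit
  obtain ⟨F, η, μ, h₁, h₂, h₃⟩ := M
  obtain rfl : F = 𝟭 V := h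
  obtain rfl : η = 𝟙 (𝟭 V) := NatTrans.ext (funext hη)
  obtain rfl : μ = 𝟙 (𝟭 V) :=
    NatTrans.ext (funext fun X => (Category.id_comp _).symm.trans (hμ X))
  rfl

theorem CategoryTheory.Monad.Algebra.eqToHom_comp_f_heq {V : Type u} [Category.{v} V]
    {M : CategoryTheory.Monad V} {A B C : M.Algebra} (h : A = B) (f : B ⟶ C) :
    HEq (eqToHom h ≫ f).f f.f := by
  subst h
  exact heq_of_eq (Category.id_comp _)

namespace Multitensor

namespace HasFree

variable {V : Type u} [Category.{v} V] {E : Multitensor V} (hS : E.HasFree) {n : ℕ}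

theorem subst_canonical {k m : ℕ} (n : Fin k → ℕ) (hm : ∑ i, n i = m)
    (X : Fin m → E.unary.Algebra) : hS.subst (IsConcat.canonical n hm X) =
      hS.ext (MonoPath.cuts hm monotone_id) fun i =>
        hS.ext (Z := (hS.free X).cat) (MonoPath.block hm monotone_id i) fun j =>
          (hS.free X).ι (blockPos n hm i j) :=
  congrArg (hS.ext _) (funext fun _ => congrArg (hS.ext (Z := (hS.free X).cat) _)
    (funext fun _ => Category.id_comp _))

/-- The lifted multitensor on the category of algebras for the unary part. -/
noncomputable def lift : Multitensor E.unary.Algebra where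
  tensor n :=
    { obj := fun X => hS.obj X
      map := fun g => hS.map g
      map_id := fun X => by
        refine Eq.trans ?_ (hS.ext_ι X)
        exact congrArg (hS.ext _) (funext fun j => Category.id_comp _)
      map_comp := fun f g => by
        refine Eq.trans ?_ (hS.map_ext f _ _).symm
        exact congrArg (hS.ext _) (funext fun j => Category.assoc _ _ _) }
  unit X := hS.unit X
  subst h := hS.subst h
  unit_naturality f :=
    (hS.unit_ext (Z := (hS.free fun _ => _).cat) (MonoPath.succ_step 1)
      fun j => f ≫ (hS.free fun _ => _).ι j).symm
  subst_naturality {k m} n hm X X' f := by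
    rw [hS.subst_canonical n hm X']
    refine (hS.map_ext _ _ _).trans ?_
    refine Eq.trans ?_ (hS.subst_ext (IsConcat.canonical n hm X)
      (IsConcat.canonical n hm Fin.castSucc) (IsConcat.canonical n hm Fin.succ)
      (MonoPath.succ_step m) (MonoPath.cuts hm monotone_id)
      (fun i => MonoPath.block hm monotone_id i) (fun s => f s ≫ (hS.free X').ι s) _
      (fun i j => HEq.rfl)).symm
    exact congrArg (hS.ext _) (funext fun i => hS.map_ext _ _ _)
  unit_inner {k} X := by
    have hid := IsConcat.singletons (id : Fin k → Fin k)
    have h₁ := hS.subst_eq_ext (IsConcat.singletons X) (hid.map Fin.castSucc) (hid.map Fin.succ)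
      (MonoPath.succ_step k) (fun i => MonoPath.edge (Fin.castSucc_le_succ i))
      (fun i _ => (hS.free X).ι i) (fun _ _ => congr_arg_heq (hS.free X).ι (hid.entry_eq _ _))
    refine (congrArg (_ ≫ ·) h₁).trans ((hS.map_ext _ _ _).trans (Eq.trans ?_ (hS.ext_ι X)))
    exact congrArg (hS.ext _) (funext fun _ => hS.unit_ext (c := fun _ => _) (d := fun _ => _) _ _)
  unit_outer {m} X := by
    have hid := IsConcat.single (id : Fin m → Fin m)
    have h₁ := hS.subst_eq_ext (IsConcat.single X) (hid.map Fin.castSucc) (hid.map Fin.succ)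
      (MonoPath.edge (Fin.zero_le (Fin.last m))) (fun _ => MonoPath.succ_step m)
      (fun _ j => (hS.free X).ι j) (fun _ _ => congr_arg_heq (hS.free X).ι (hid.entry_eq _ _))
    refine (congrArg (_ ≫ ·) h₁).trans (Eq.trans ?_ (hS.ext_ι X))
    exact hS.unit_ext (c := fun _ => _) (d := fun _ => _) _ _
  subst_assoc {k m r} n hm p hr X {q W} hW hY := by
    have hq : ∀ i, ∑ j, p (blockPos n hm i j) = q i := fun i => (hY i).length_eq
    have hb : ∀ i, IsConcat (fun j l => blockPos p hr (blockPos n hm i j) l)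
      (blockPos q hW.length_eq i) := isConcat_blockPos n hm p hr q hq hW.length_eq
    have hm₂ := monoPath_block_cuts n hm p hr q hq hW.length_eq
    -- Both composites turn out to be the same threefold nested extension of the generators: along
    -- the outer cuts, along the cuts inside each outer block, and along the innermost blocks.
    have h₁ : ∀ i, hS.subst (hY i) ≫
        hS.ext (Z := (hS.free X).cat) (MonoPath.block hW.length_eq monotone_id i) (fun j =>
          eqToHom (hW.entry_eq i j) ≫ (hS.free X).ι (blockPos q hW.length_eq i j)) =
        hS.ext (hm₂ i) fun j => hS.ext
          (MonoPath.block hr monotone_id (blockPos n hm i j)) fun l =>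
            (hS.free X).ι (blockPos p hr (blockPos n hm i j) l) := fun i => by
      refine hS.subst_ext (hY i) ((hb i).map Fin.castSucc) ((hb i).map Fin.succ) _ _ _ _ _ ?_
      intro j l
      refine HEq.trans ?_ (eqToHom_comp_heq _ _).symm
      exact congr_arg_heq (hS.free X).ι ((hb i).entry_eq j l)
    refine (hS.map_ext _ _ _).trans ?_
    refine (congrArg (hS.ext (Z := (hS.free X).cat) _) (funext h₁)).trans ?_
    rw [hS.subst_canonical p hr X]
    exact (hS.subst_ext (Z := (hS.free X).cat) (IsConcat.canonical n hm fun s =>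
        hS.obj fun l => X (blockPos p hr s l))
      (IsConcat.canonical n hm _) (IsConcat.canonical n hm _)
      (MonoPath.cuts hr monotone_id) (MonoPath.cuts hW.length_eq monotone_id) hm₂
      (fun s => hS.ext (Z := (hS.free X).cat) (MonoPath.block hr monotone_id s) fun l =>
        (hS.free X).ι (blockPos p hr s l)) _ (fun i j => HEq.rfl)).symm

/-- The unit is an identity by construction, so its naturality shows that the unary functor is the
identity on morphisms too. -/
theorem isFunctorOperad_lift : hS.lift.IsFunctorOperad := by
  have h : hS.lift.unary.toFunctor = 𝟭 _ := CategoryTheory.Functor.ext (fun X => rfl) fun X Y f => by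
    refine Eq.trans ?_ (Category.id_comp _).symm
    refine Eq.trans ?_ (Category.comp_id _).symm
    exact (Category.id_comp _).symm.trans ((hS.lift.unit_naturality f).symm.trans
      (Category.comp_id f))
  exact CategoryTheory.Monad.eq_id_of_toFunctor_eq h fun X => rfl

/-- The comparison between the values of a multitensor and of its lift. -/
noncomputable def coh (X : Fin n → E.unary.Algebra) :
    (E.tensor n).obj (fun i => (X i).A) ⟶ (hS.obj X).A :=
  (E.tensor n).map (fun i => ((hS.free X).ι i).f) ≫ (hS.free X).cat.comp (MonoPath.succ_step n)

/-- Composition along a path factors through the lifted multitensor. -/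
theorem coh_ext {X : Fin n → E.unary.Algebra} {I : Type w₁} [Preorder I] {Z : OCat E I}
    {c d : Fin n → I} {a b : I} (h : MonoPath c d a b) (f : ∀ j, X j ⟶ Z.hom (c j) (d j)) :
    hS.coh X ≫ (hS.ext h f).f = (E.tensor n).map (fun j => (f j).f) ≫ Z.comp h := by
  obtain ⟨x, hx, rfl, rfl, hc, hd⟩ := h
  obtain rfl := funext hc
  obtain rfl := funext hd
  refine (congrArg (fun g : hS.obj X ⟶ _ => _ ≫ g.f) (hS.ext_of_monotone hx f)).trans ?_
  have h₁ := OCat.Hom.app_comp ((hS.free X).desc (Y := Z.pull hx) f) (MonoPath.succ_step n)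
  refine (Category.assoc _ _ _).trans ((congrArg (_ ≫ ·) h₁.symm).trans ?_)
  refine (Category.assoc _ _ _).symm.trans (congrArg (· ≫ Z.comp (MonoPath.of_monotone hx)) ?_)
  refine ((E.tensor n).map_comp _ _).symm.trans ?_
  exact congrArg (E.tensor n).map (funext fun j =>
    congrArg Monad.Algebra.Hom.f ((hS.free X).ι_desc (Y := Z.pull hx) f j))

end HasFree

/-! ### The forgetful lax monoidal functor. -/

namespace HasFree

variable {V : Type (max v u)} [Category.{v} V] {E : Multitensor V} (hS : E.HasFree) {n : ℕ}

/-- The category of algebras for the unary part, with the lifted multitensor. -/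
noncomputable abbrev algebraCat : LaxMonCat.{v, max v u} := ⟨E.unary.Algebra, hS.lift⟩

/-- The forgetful functor from algebras, as a lax monoidal functor from the lifted multitensor. -/
noncomputable def forget : LaxMonCat.Hom hS.algebraCat (LaxMonCat.mk V E) where
  functor := E.unary.forget
  coh X := hS.coh X
  coh_naturality {n X Y} g := by
    refine Eq.trans ?_ (hS.coh_ext (MonoPath.succ_step n) fun j => g j ≫ (hS.free Y).ι j).symm
    refine (Category.assoc _ _ _).symm.trans (congrArg (· ≫ _) ?_)
    exact ((E.tensor n).map_comp _ _).symm
  unit_coh X := by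
    refine (congrArg (· ≫ _) (E.unitCast_eq X.A).symm).trans ?_
    exact OCat.unitCast_map_comp (hS.free fun _ : Fin 1 => X).cat (A := X.A) (p := 0)
      (q := Fin.last 1) rfl (fun _ => rfl) (fun j => by fin_cases j; rfl)
      (fun j => by fin_cases j; rfl) (MonoPath.succ_step 1) (𝟙 X.A) _
      (fun j => by fin_cases j; rfl)
  subst_coh {k n Y m X} h := by
    refine (congrArg (_ ≫ ·) (hS.coh_ext (Z := (hS.free X).cat) _ _)).trans ?_
    refine (Category.assoc _ _ _).symm.trans ?_
    refine (congrArg (· ≫ _) ((E.tensor k).map_comp _ _).symm).trans ?_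
    refine (congrArg (fun f => (E.tensor k).map f ≫ _) (funext fun i =>
      hS.coh_ext (Z := (hS.free X).cat) _ _)).trans ?_
    refine (congrArg (· ≫ _) ((E.tensor k).map_comp _ _)).trans ?_
    refine (Category.assoc _ _ _).trans ((congrArg (_ ≫ ·) ((hS.free X).cat.comp_subst
      (IsConcat.canonical n h.length_eq Fin.castSucc) (IsConcat.canonical n h.length_eq Fin.succ)
      (MonoPath.succ_step m) _ _)).trans ?_)
    refine (Category.assoc _ _ _).symm.trans (Eq.trans ?_ (Category.assoc _ _ _))
    refine congrArg (· ≫ _) ?_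
    refine E.subst_naturality_of_heq _ _ _ _ fun i j => ?_
    exact Monad.Algebra.eqToHom_comp_f_heq (h.entry_eq i j) _

end HasFree

end Multitensor

/-! ### Ordered categories enriched in the lifted multitensor -/

namespace OCat

theorem map_comp_edge {V : Type u} [Category.{v} V] {E : Multitensor V} {I : Type w₁} [Preorder I]
    (Y : OCat E I) {A : V} {p q : I} {c d : Fin 1 → I} (hc : ∀ j, c j = p) (hd : ∀ j, d j = q)
    (h : MonoPath c d p q) (f : A ⟶ (Y.hom p q).A) (g : ∀ j, A ⟶ (Y.hom (c j) (d j)).A)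
    (hg : ∀ j, HEq (g j) f) :
    (E.tensor 1).map g ≫ Y.comp h = (E.tensor 1).map (fun _ => f) ≫ Multitensor.act _ := by
  obtain rfl : c = fun _ => p := funext hc
  obtain rfl : d = fun _ => q := funext hd
  obtain rfl : g = fun _ => f := funext fun j => eq_of_heq (hg j)
  rw [Y.comp_edge]

end OCat

namespace Multitensor.HasFree

variable {V : Type (max v u)} [Category.{v} V] {E : Multitensor V} (hS : E.HasFree) {n : ℕ}

theorem coh_single (X : E.unary.Algebra) : hS.coh (fun _ : Fin 1 => X) = act X := by
  refine (OCat.map_comp_edge (hS.free fun _ : Fin 1 => X).cat (A := X.A) (p := 0)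
    (q := Fin.last 1) (fun j => by fin_cases j; rfl) (fun j => by fin_cases j; rfl)
    (MonoPath.succ_step 1) (𝟙 X.A) _ (fun j => by fin_cases j; rfl)).trans ?_
  exact (congrArg (· ≫ act X) ((E.tensor 1).map_id _)).trans (Category.id_comp _)

variable {I : Type w₁} [Preorder I]

/-- The unit of the lift is an identity, so the unit law forces the structure maps of algebras for
its unary part to be identities. -/
theorem comp_edge_lift (Y : OCat hS.lift I) {p q : I}
    (h : MonoPath (fun _ : Fin 1 => p) (fun _ => q) p q) : Y.comp h = 𝟙 (Y.hom p q).A :=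
  (Y.comp_edge h).trans ((Category.id_comp _).symm.trans (unit_act (Y.hom p q)))

/-- The ordered `E`-category underlying an ordered category enriched in the lift of `E`. -/
noncomputable def under (Y : OCat hS.lift I) : OCat E I where
  hom p q := (Y.hom p q).A
  comp {k c d a b} h := hS.coh (fun i => (Y.hom (c i) (d i)).A) ≫ (Y.comp h).f
  comp_edge {p q} h := by
    rw [hS.comp_edge_lift Y h]
    exact (Category.comp_id _).trans (hS.coh_single _)
  comp_subst hc hd h h' h₂ := (hS.forget.mapOCat Y).comp_subst hc hd h h' h₂

/-- Underlying morphisms of ordered categories. -/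
noncomputable def underMap {Y Y' : OCat hS.lift I} (φ : Y ⟶ Y') : hS.under Y ⟶ hS.under Y' where
  app h := (OCat.Hom.app φ h).f
  app_comp h := OCat.Hom.app_comp (hS.forget.mapOCatMap φ) h

/-- The comparison from the free ordered category enriched in the lifted multitensor. -/
noncomputable def underSeqDesc (X : Fin n → E.unary.Algebra) :
    hS.under (OCat.ofSeq hS.lift X) ⟶ (hS.free X).cat where
  app {p q} h := hS.ext (X := interval X p q) (Z := (hS.free X).cat) (monoPath_interval h)
    fun j => (hS.free X).ι ⟨j + p, by have := q.is_le; have := j.is_lt; omega⟩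
  app_comp {k c d a b} h := by
    refine (hS.coh_ext (Z := (hS.free X).cat) h _).symm.trans ?_
    refine Eq.trans ?_ (Category.assoc _ _ _).symm
    have h₁ := hS.subst_ext (Z := (hS.free X).cat) (h.isConcat_interval X)
      (h.isConcat_interval Fin.castSucc) (h.isConcat_interval Fin.succ) (monoPath_interval h.le) h
      (fun i => monoPath_interval (h.step i))
      (fun j => (hS.free X).ι ⟨j + a, by have := b.is_le; have := j.is_lt; omega⟩)
      (fun i j => (hS.free X).ι ⟨j + c i, by have := (d i).is_le; have := j.is_lt; omega⟩)
      fun i j => congr_arg_heq (hS.free X).ι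
        ((h.isConcat_interval (id : Fin n → Fin n)).entry_eq i j)
    exact congrArg (_ ≫ ·) (congrArg Monad.Algebra.Hom.f h₁).symm

/-- The comparison to the free ordered category enriched in the lifted multitensor. -/
noncomputable def toUnderSeq (X : Fin n → E.unary.Algebra) :
    (hS.free X).cat ⟶ hS.under (OCat.ofSeq hS.lift X) :=
  (hS.free X).desc fun b => OCat.gen (E := hS.lift) X b rfl rfl

theorem unitCast_ext {Z : OCat E I} {m : ℕ} {A : E.unary.Algebra} {X : Fin m → E.unary.Algebra}
    (hm : m = 1) (hX : ∀ j, X j = A) {p q : I} {c d : Fin m → I} (hc : ∀ j, c j = p)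
    (hd : ∀ j, d j = q) (h : MonoPath c d p q) (f : A ⟶ Z.hom p q)
    (g : ∀ j, X j ⟶ Z.hom (c j) (d j)) (hg : ∀ j, HEq (g j) f) :
    hS.lift.unitCast hm hX ≫ hS.ext h g = f := by
  subst hm
  obtain rfl : X = fun _ => A := funext hX
  obtain rfl : c = fun _ => p := funext hc
  obtain rfl : d = fun _ => q := funext hd
  obtain rfl : g = fun _ => f := funext fun j => eq_of_heq (hg j)
  rw [unitCast_eq]
  exact hS.unit_ext h fun _ => f

theorem gen_ext {X : Fin n → E.unary.Algebra} {Z : OCat E (Fin (n + 1))} (b : Fin n)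
    (f : ∀ b, X b ⟶ Z.hom b.castSucc b.succ) :
    OCat.gen (E := hS.lift) X b rfl rfl ≫ hS.ext (X := interval X b.castSucc b.succ)
      (monoPath_interval (Fin.castSucc_le_succ b)) (fun j => f ⟨j + b.castSucc.val, by
        have := b.succ.is_le; have := j.is_lt; omega⟩) = f b := by
  have hb : ∀ j : Fin (b.succ.val - b.castSucc.val), ∀ h,
      (⟨j.val + b.castSucc.val, h⟩ : Fin n) = b := fun j h => Fin.ext (by
    have := j.is_lt
    simp only [Fin.val_succ, Fin.val_castSucc] at this ⊢
    omega)
  exact hS.unitCast_ext _ _ (fun j => congrArg Fin.castSucc (hb j _))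
    (fun j => congrArg Fin.succ (hb j _)) _ (f b) _ fun j => congr_arg_heq f (hb j _)

theorem toUnderSeq_desc (X : Fin n → E.unary.Algebra) :
    hS.toUnderSeq X ≫ hS.underSeqDesc X = 𝟙 _ := by
  refine (hS.free X).hom_ext fun b => ?_
  refine (Category.assoc _ _ _).symm.trans ((congrArg (· ≫ _) ((hS.free X).ι_desc _ b)).trans ?_)
  refine (hS.gen_ext b (hS.free X).ι).trans (Category.comp_id _).symm

/-- The interval from `0` to `n` is definitionally the whole sequence, so both homs are `hS.obj X`.
There `underSeqDesc` is the identity by `ext_ι`, and `toUnderSeq_desc` gives the claim. -/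
theorem toUnderSeq_app (X : Fin n → E.unary.Algebra) :
    OCat.Hom.app (hS.toUnderSeq X) (Fin.zero_le (Fin.last n)) = 𝟙 (hS.obj X) := by
  refine (Category.comp_id _).symm.trans ((congrArg (_ ≫ ·) (hS.ext_ι X).symm).trans ?_)
  exact congrArg (fun φ => OCat.Hom.app φ (Fin.zero_le (Fin.last n))) (hS.toUnderSeq_desc X)

/-- Compositions in an ordered category enriched in the lifted multitensor are determined by the
underlying ordered category. -/
theorem comp_eq_ext (Y : OCat hS.lift I) {c d : Fin n → I} {a b : I} (h : MonoPath c d a b) :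
    Y.comp h = hS.ext (X := fun j => (Y.hom (c j) (d j)).A) (Z := hS.under Y) h fun _ => 𝟙 _ := by
  obtain ⟨x, hx, rfl, rfl, hc, hd⟩ := h
  obtain rfl := funext hc
  obtain rfl := funext hd
  refine Eq.trans ?_ (hS.ext_of_monotone (Z := hS.under Y) hx _).symm
  let X : Fin n → E.unary.Algebra := fun j => (Y.hom (x j.castSucc) (x j.succ)).A
  -- The composite along the path is the value, from `0` to `n`, of the morphism extending the
  -- identities. Through `toUnderSeq`, its underlying morphism is compared with the one that defines
  -- `ext`.
  let φ : OCat.ofSeq hS.lift X ⟶ Y.pull hx :=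
    OCat.seqDesc (E := hS.lift) (Y := Y.pull hx) (X := X) fun b => 𝟙 _
  have h₁ : hS.toUnderSeq X ≫ hS.underMap φ = (hS.free X).desc (Y := (hS.under Y).pull hx)
      fun b => 𝟙 _ := by
    refine (hS.free X).hom_ext fun b => ?_
    refine (Category.assoc _ _ _).symm.trans
      ((congrArg (· ≫ _) ((hS.free X).ι_desc _ b)).trans ?_)
    refine (OCat.gen_seqDesc (E := hS.lift) (Y := Y.pull hx) (X := X) (fun b => 𝟙 _) b).trans ?_
    exact ((hS.free X).ι_desc (Y := (hS.under Y).pull hx) (fun b => 𝟙 _) b).symm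
  refine Eq.trans ?_ (congrArg (fun φ : (hS.free X).cat ⟶ (hS.under Y).pull hx =>
    OCat.Hom.app φ (Fin.zero_le (Fin.last n))) h₁)
  refine Eq.trans ?_ (congrArg (· ≫ _) (hS.toUnderSeq_app X)).symm
  refine Eq.trans ?_ (Category.id_comp _).symm
  exact (Category.id_comp _).symm.trans
    (congrArg (· ≫ _) ((hS.lift.tensor n).map_id X).symm)

end Multitensor.HasFree

/-! ### Colimits of algebras for the unary part -/

namespace OCat

variable {V : Type u} [Category.{v} V] {E : Multitensor V}

/-- The morphism of free ordered categories induced by a morphism of algebras. -/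
def singleMap {X Y : E.unary.Algebra} (f : X ⟶ Y) : single X ⟶ single Y :=
  singleDesc (Y := single Y) f

end OCat

namespace Multitensor

variable {V : Type u} [Category.{v} V] {E : Multitensor V}

-- The coequalizer of `f` and `g` is the hom from `0` to `1` in the quotient of `single B` by the
-- relation identifying `f` and `g`.
open OCat in
theorem hasCoequalizers_algebra [HasColimitsOfSize.{v, v} V] (κ : Cardinal.{v}) [Fact κ.IsRegular]
    (hE : E.IsCardinalAccessible κ) : HasCoequalizers E.unary.Algebra := by
  have h01 : (0 : Fin 2) ≤ 1 := Fin.zero_le _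
  have : ∀ {A B : E.unary.Algebra} {f g : A ⟶ B}, HasColimit (parallelPair f g) := by
    intro A B f g
    obtain ⟨Z, φ, hφ, hZ⟩ := (single B).exists_quotient κ hE (B := Unit) (fun _ => 0) (fun _ => 1)
      (fun _ => h01) (A := fun _ => A.A) (fun _ => f.f) (fun _ => g.f)
    let q : B ⟶ Z.hom 0 1 := Hom.app φ h01
    have hq : f ≫ q = g ≫ q := Monad.Algebra.Hom.ext (hφ ())
    have hdesc : ∀ {Y : OCat E (Fin 2)} (h : B ⟶ Y.hom 0 1), f ≫ h = g ≫ h →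
        ∃! χ : Z ⟶ Y, φ ≫ χ = singleDesc h := by
      intro Y h hh
      refine hZ _ _ fun _ => ?_
      have h₁ := singleDesc_app h
      refine (congrArg (fun k : B ⟶ Y.hom 0 1 => f.f ≫ k.f) h₁).trans (Eq.trans ?_
        (congrArg (fun k : B ⟶ Y.hom 0 1 => g.f ≫ k.f) h₁).symm)
      exact congrArg Monad.Algebra.Hom.f hh
    have hsingle : ∀ {Y : OCat E (Fin 2)} (χ : Z ⟶ Y) (h : B ⟶ Y.hom 0 1),
        q ≫ Hom.app χ h01 = h → φ ≫ χ = singleDesc h := fun χ h hh =>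
      single_hom_ext (hh.trans (singleDesc_app h).symm)
    -- A map of algebras out of `Z.hom 0 1` is not yet a morphism out of `Z`. Composing `θ`, which
    -- turns out to be the identity on this hom, with `singleMap` makes it one, so that uniqueness
    -- for `Z` applies.
    obtain ⟨θ, hθ, -⟩ := hdesc (Y := single (Z.hom 0 1)) q hq
    have hθ₁ : q ≫ Hom.app θ h01 = q :=
      (congrArg (fun χ => Hom.app χ h01) hθ).trans (singleDesc_app (Y := single (Z.hom 0 1)) q)
    have hθ₂ : θ ≫ singleDesc (Y := Z) (𝟙 (Z.hom 0 1)) = 𝟙 Z := by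
      refine (hdesc q hq).unique (hsingle _ _ ?_) (hsingle _ _ (Category.comp_id q))
      refine (congrArg (fun k => q ≫ Hom.app θ h01 ≫ k)
        (singleDesc_app (Y := Z) (𝟙 (Z.hom 0 1)))).trans ?_
      exact (congrArg (q ≫ ·) (Category.comp_id _)).trans hθ₁
    have hθ₃ : Hom.app θ h01 = 𝟙 (Z.hom 0 1) := by
      have h₁ := congrArg (fun χ => Hom.app χ h01) hθ₂
      refine Eq.trans ?_ h₁
      refine (Category.comp_id (Y := Z.hom 0 1) _).symm.trans ?_
      exact congrArg (Hom.app θ h01 ≫ ·) (singleDesc_app (Y := Z) (𝟙 (Z.hom 0 1))).symm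
    refine ⟨⟨⟨Cofork.ofπ q hq, Cofork.IsColimit.ofExistsUnique fun s => ?_⟩⟩⟩
    obtain ⟨χ, hχ, hu⟩ := hdesc (Y := single s.pt) s.π s.condition
    refine ⟨Hom.app χ h01, ?_, fun t ht => ?_⟩
    · exact (congrArg (fun χ => Hom.app χ h01) hχ).trans (singleDesc_app (Y := single s.pt) s.π)
    · have h₁ : Hom.app (θ ≫ singleMap t) h01 = t := by
        refine (congrArg (· ≫ _) hθ₃).trans ((Category.id_comp _).trans ?_)
        exact singleDesc_app (Y := single s.pt) t
      have h₂ := hu (θ ≫ singleMap t) (hsingle _ _ ((congrArg (q ≫ ·) h₁).trans ht))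
      exact h₁.symm.trans (congrArg (fun χ => Hom.app χ h01) h₂)
  exact hasCoequalizers_of_hasColimit_parallelPair _

/-- In arity one there are no other variables, so the isomorphism condition in the definition of
distributivity is vacuous. -/
theorem IsDistributive.preservesColimitsOfShape_unary [HasColimitsOfSize.{v, v} V]
    (hE : E.IsDistributive) (J : Type v) :
    PreservesColimitsOfShape (Discrete J) E.unary.toFunctor := by
  have : ∀ f : J → V, PreservesColimit (Discrete.functor f) E.unary.toFunctor := fun f => by
    refine preservesColimit_of_preserves_colimit_cocone (coproductIsCoproduct f) ?_
    refine (isColimitMapCoconeCofanMkEquiv _ _ _).symm ?_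
    exact (hE 1 0 J (fun a _ => f a) (fun _ => ∐ f) (fun a _ => Sigma.ι f a)
      (fun a j hj => absurd (Subsingleton.elim _ _) hj) ⟨coproductIsCoproduct f⟩).some
  exact preservesColimitsOfShape_of_discrete _

/-- The forgetful functor creates coproducts because `E₁` preserves them; coequalizers supply the
rest. -/
theorem hasColimits_algebra [HasColimitsOfSize.{v, v} V] (κ : Cardinal.{v}) [Fact κ.IsRegular]
    (hE : E.IsCardinalAccessible κ) (hE' : E.IsDistributive) :
    HasColimitsOfSize.{v, v} E.unary.Algebra := by
  have := hasCoequalizers_algebra κ hE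
  have : HasCoproducts.{v} E.unary.Algebra := fun J => by
    have := hE'.preservesColimitsOfShape_unary J
    exact hasColimitsOfShape_of_hasColimitsOfShape_createsColimitsOfShape E.unary.forget
  exact has_colimits_of_hasCoequalizers_and_coproducts

end Multitensor

/-! ### Gluing ordered categories -/

namespace OCat

variable {V : Type u} [Category.{v} V] {E : Multitensor V} {I : Type w₁} [Preorder I]

/-- Families of algebras between a family of ordered categories and an ordered category. -/
structure Glue (E : Multitensor V) (I : Type w₁) [Preorder I] (A : Type w₂) where
  source : A → OCat E I
  target : OCat E I
  hom : I → I → E.unary.Algebra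
  into (x : A) {p q : I} (h : p ≤ q) : (source x).hom p q ⟶ hom p q
  out {p q : I} (h : p ≤ q) : hom p q ⟶ target.hom p q

namespace Glue

variable {A : Type w₂} (D : Glue E I A)

/-- Compatible compositions along a path. -/
structure IsComp {k : ℕ} {c d : Fin k → I} {a b : I} (h : MonoPath c d a b)
    (f : (E.tensor k).obj (fun i => (D.hom (c i) (d i)).A) ⟶ (D.hom a b).A) : Prop where
  into_comp (x : A) : (E.tensor k).map (fun i => (D.into x (h.step i)).f) ≫ f =
    (D.source x).comp h ≫ (D.into x h.le).f
  comp_out : f ≫ (D.out h.le).f =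
    (E.tensor k).map (fun i => (D.out (h.step i)).f) ≫ D.target.comp h

/-- Compositions exist, and are detected by the given maps. -/
structure HasComp : Prop where
  exists_comp {k : ℕ} {c d : Fin k → I} {a b : I} (h : MonoPath c d a b) : ∃ f, D.IsComp h f
  hom_ext {k : ℕ} {c d : Fin k → I} {a b : I} (h : MonoPath c d a b)
    {f g : (E.tensor k).obj (fun i => (D.hom (c i) (d i)).A) ⟶ (D.hom a b).A}
    (hfg : ∀ x, (E.tensor k).map (fun i => (D.into x (h.step i)).f) ≫ f =
      (E.tensor k).map (fun i => (D.into x (h.step i)).f) ≫ g)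
    (hfg' : f ≫ (D.out h.le).f = g ≫ (D.out h.le).f) : f = g
  hom_ext₂ {k : ℕ} {n : Fin k → ℕ} {c₂ d₂ : ∀ i, Fin (n i) → I}
    {c d : Fin k → I} {a b : I} (h : MonoPath c d a b)
    (h₂ : ∀ i, MonoPath (c₂ i) (d₂ i) (c i) (d i))
    {f g : (E.tensor k).obj (fun i => (E.tensor (n i)).obj
      (fun j => (D.hom (c₂ i j) (d₂ i j)).A)) ⟶ (D.hom a b).A}
    (hfg : ∀ x, (E.tensor k).map (fun i => (E.tensor (n i)).map
        (fun j => (D.into x ((h₂ i).step j)).f)) ≫ f =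
      (E.tensor k).map (fun i => (E.tensor (n i)).map
        (fun j => (D.into x ((h₂ i).step j)).f)) ≫ g)
    (hfg' : f ≫ (D.out h.le).f = g ≫ (D.out h.le).f) : f = g

variable {D} (hD : D.HasComp)

theorem isComp_act {p q : I} (h : MonoPath (fun _ : Fin 1 => p) (fun _ => q) p q) :
    D.IsComp h (Multitensor.act (D.hom p q)) where
  into_comp x := (Multitensor.map_act (D.into x h.le)).trans
    (congrArg (· ≫ _) ((D.source x).comp_edge h).symm)
  comp_out := (Multitensor.map_act (D.out h.le)).symm.trans
    (congrArg (_ ≫ ·) (D.target.comp_edge h).symm)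

/-- The ordered category obtained by gluing. -/
noncomputable def glue : OCat E I where
  hom := D.hom
  comp h := (hD.exists_comp h).choose
  comp_edge h := hD.hom_ext h
    (fun x => ((hD.exists_comp h).choose_spec.into_comp x).trans ((isComp_act h).into_comp x).symm)
    ((hD.exists_comp h).choose_spec.comp_out.trans (isComp_act h).comp_out.symm)
  comp_subst {k m n c d c₂ d₂ c' d' a b} hc hd h h' h₂ := by
    obtain ⟨H₁, H₂⟩ := (hD.exists_comp h).choose_spec
    obtain ⟨H₁', H₂'⟩ := (hD.exists_comp h').choose_spec
    have H₁₂ := fun i => (hD.exists_comp (h₂ i)).choose_spec.into_comp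
    have H₂₂ := fun i => (hD.exists_comp (h₂ i)).choose_spec.comp_out
    generalize (hD.exists_comp h).choose = f at *
    -- The chosen compositions enter only through their compatibilities.
    generalize (hD.exists_comp h').choose = f' at *
    generalize hf₂ : (fun i => (hD.exists_comp (h₂ i)).choose) = f₂
    replace H₁₂ : ∀ i (x : A), (E.tensor (n i)).map
        (fun j => (D.into x ((h₂ i).step j)).f) ≫ f₂ i =
        (D.source x).comp (h₂ i) ≫ (D.into x (h₂ i).le).f := by
      subst hf₂
      exact H₁₂
    replace H₂₂ : ∀ i, f₂ i ≫ (D.out (h₂ i).le).f = (E.tensor (n i)).map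
        (fun j => (D.out ((h₂ i).step j)).f) ≫ D.target.comp (h₂ i) := by
      subst hf₂
      exact H₂₂
    -- Associativity is detected on the sources and on the target, where it is known.
    refine hD.hom_ext₂ h' h₂ (fun x => ?_) ?_
    · have h₃ := (D.source x).comp_subst hc hd h h' h₂
      have h₄ : (E.tensor k).map (fun i => (E.tensor (n i)).map
          (fun j => (D.into x ((h₂ i).step j)).f)) ≫
            E.subst (hc.map₂ hd fun p q => (D.hom p q).A) =
          E.subst (hc.map₂ hd fun p q => ((D.source x).hom p q).A) ≫
            (E.tensor m).map (fun s => (D.into x (h.step s)).f) :=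
        E.subst_naturality_of_heq _ _ _ _ fun i j => by
          have e₁ := hc.entry_eq i j
          have e₂ := hd.entry_eq i j
          generalize_proofs p₁ p₂ p₃
          revert p₁
          rw [e₁, e₂]
          exact fun _ => HEq.rfl
      have h₅ : (E.tensor k).map (fun i => (E.tensor (n i)).map
            (fun j => (D.into x ((h₂ i).step j)).f)) ≫ (E.tensor k).map f₂ =
          (E.tensor k).map (fun i => (D.source x).comp (h₂ i)) ≫
            (E.tensor k).map (fun i => (D.into x (h'.step i)).f) := by
        refine ((E.tensor k).map_comp _ _).symm.trans (Eq.trans ?_ ((E.tensor k).map_comp _ _))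
        exact congrArg (E.tensor k).map (funext fun i => H₁₂ i x)
      rw [← Category.assoc, h₅, Category.assoc, H₁', ← Category.assoc, h₃, ← Category.assoc, h₄,
        Category.assoc, Category.assoc, H₁]
    · have h₃ := D.target.comp_subst hc hd h h' h₂
      have h₄ : (E.tensor k).map (fun i => (E.tensor (n i)).map
          (fun j => (D.out ((h₂ i).step j)).f)) ≫
            E.subst (hc.map₂ hd fun p q => (D.target.hom p q).A) =
          E.subst (hc.map₂ hd fun p q => (D.hom p q).A) ≫
            (E.tensor m).map (fun s => (D.out (h.step s)).f) :=
        E.subst_naturality_of_heq _ _ _ _ fun i j => by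
          have e₁ := hc.entry_eq i j
          have e₂ := hd.entry_eq i j
          generalize_proofs p₁ p₂ p₃
          revert p₁
          rw [e₁, e₂]
          exact fun _ => HEq.rfl
      have h₅ : (E.tensor k).map f₂ ≫ (E.tensor k).map (fun i => (D.out (h'.step i)).f) =
          (E.tensor k).map (fun i => (E.tensor (n i)).map (fun j => (D.out ((h₂ i).step j)).f)) ≫
            (E.tensor k).map (fun i => D.target.comp (h₂ i)) := by
        refine ((E.tensor k).map_comp _ _).symm.trans (Eq.trans ?_ ((E.tensor k).map_comp _ _))
        exact congrArg (E.tensor k).map (funext fun i => H₂₂ i)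
      rw [Category.assoc, H₂', ← Category.assoc, h₅, Category.assoc, h₃, ← Category.assoc, h₄,
        Category.assoc, Category.assoc, H₂]

/-- The maps into a glued ordered category. -/
noncomputable def toGlue (x : A) : D.source x ⟶ glue hD where
  app h := D.into x h
  app_comp h := (hD.exists_comp h).choose_spec.into_comp x

/-- The map out of a glued ordered category. -/
noncomputable def fromGlue : glue hD ⟶ D.target where
  app h := D.out h
  app_comp h := (hD.exists_comp h).choose_spec.comp_out.symm

end Glue

/-- An ordered category over a free one and under free ones has a section if the generators
lift. -/
theorem Free.exists_section {n : ℕ} {A : Type w₂} {T : OCat E (Fin (n + 1))}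
    {W : Fin n → E.unary.Algebra} (SW : Free W) {Z : A → Fin n → E.unary.Algebra}
    (S : ∀ x, Free (Z x)) (ι : ∀ x j, Z x j ⟶ W j) (t : ∀ x, (S x).cat ⟶ T) (π : T ⟶ SW.cat)
    (w : ∀ j, W j ⟶ T.hom j.castSucc j.succ)
    (hwπ : ∀ j, w j ≫ Hom.app π (Fin.castSucc_le_succ j) = SW.ι j)
    (hw : ∀ x j, ι x j ≫ w j = (S x).ι j ≫ Hom.app (t x) (Fin.castSucc_le_succ j)) :
    ∃ ρ : SW.cat ⟶ T, ρ ≫ π = 𝟙 _ ∧ ∀ x, t x ≫ π ≫ ρ = t x := by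
  refine ⟨SW.desc w, SW.hom_ext fun j => ?_, fun x => (S x).hom_ext fun j => ?_⟩
  · refine (Category.assoc _ _ _).symm.trans ((congrArg (· ≫ _) (SW.ι_desc w j)).trans ?_)
    exact (hwπ j).trans (Category.comp_id _).symm
  · refine (Category.assoc _ _ _).symm.trans ((congrArg (· ≫ _) (hw x j).symm).trans ?_)
    refine Eq.trans ?_ (hw x j)
    refine (Category.assoc _ _ _).trans (congrArg (_ ≫ ·) ?_)
    refine (Category.assoc _ _ _).symm.trans ((congrArg (· ≫ _) (hwπ j)).trans ?_)
    exact SW.ι_desc w j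

end OCat

/-! ### Distributivity of the lifted multitensor -/

/-- A discrete intermediate value argument: if no step crossed from `i` to `i + 1`, all vertices
would stay at or below `i`; two crossing steps would contradict monotonicity. -/
theorem MonoPath.existsUnique_step {n k : ℕ} {c d : Fin k → Fin (n + 1)} {a b : Fin (n + 1)}
    (h : MonoPath c d a b) {i : Fin n} (hi : a ≤ i.castSucc ∧ i.succ ≤ b) :
    ∃ r, (c r ≤ i.castSucc ∧ i.succ ≤ d r) ∧ ∀ j, j ≠ r → ¬ (c j ≤ i.castSucc ∧ i.succ ≤ d j) := by
  obtain ⟨x, hx, rfl, rfl, hc, hd⟩ := h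
  obtain rfl := funext hc
  obtain rfl := funext hd
  have h₁ : ∃ r : Fin k, x r.castSucc ≤ i.castSucc ∧ i.succ ≤ x r.succ := by
    by_contra hcon
    push Not at hcon
    have h₂ : ∀ j, x j ≤ i.castSucc := fun j => by
      induction j using Fin.induction with
      | zero => exact hi.1
      | succ j ih =>
        have := hcon j ih
        rw [Fin.lt_def] at this
        rw [Fin.le_def]
        simp only [Fin.val_succ, Fin.val_castSucc] at this ⊢
        omega
    have := le_trans hi.2 (h₂ (Fin.last k))
    rw [Fin.le_def] at this
    simp at this
  obtain ⟨r, hr⟩ := h₁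
  refine ⟨r, hr, fun j hj hj' => ?_⟩
  rcases lt_or_gt_of_ne hj with hlt | hlt
  · have h₂ := (hj'.2.trans (hx (Fin.succ_le_castSucc_iff.2 hlt))).trans hr.1
    rw [Fin.le_def] at h₂
    simp at h₂
  · have h₂ := (hr.2.trans (hx (Fin.succ_le_castSucc_iff.2 hlt))).trans hj'.1
    rw [Fin.le_def] at h₂
    simp at h₂

namespace Multitensor

section

variable {V : Type u} [Category.{v} V]

/-- A family of maps which is a coproduct cocone if `P` holds, and consists of isomorphisms
otherwise. -/
def CoprodIf (P : Prop) {J : Type v} {Z : J → V} {X : V} (t : ∀ a, Z a ⟶ X) : Prop :=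
  (P → Nonempty (IsColimit (Cofan.mk X t))) ∧ (¬ P → ∀ a, IsIso (t a))

/-- If `Q` holds, one variable carries a coproduct and all others isomorphisms, which is the
situation of distributivity; if not, all variables carry isomorphisms. -/
theorem IsDistributive.coprodIf {E : Multitensor V} (hE : E.IsDistributive) {k : ℕ}
    {P : Fin k → Prop} {Q : Prop} (hPQ : Q → ∃ r, P r ∧ ∀ j, j ≠ r → ¬ P j)
    (hQ : ¬ Q → ∀ j, ¬ P j) {J : Type v} {Z : Fin k → J → V} {X : Fin k → V}
    {t : ∀ i a, Z i a ⟶ X i} (h : ∀ i, CoprodIf (P i) (t i)) :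
    CoprodIf Q (Z := fun a => (E.tensor k).obj fun i => Z i a) (X := (E.tensor k).obj X)
      (fun a => (E.tensor k).map (X := fun i => Z i a) (fun i => t i a)) := by
  refine ⟨fun q => ?_, fun q a => ?_⟩
  · obtain ⟨r, hr, hr'⟩ := hPQ q
    exact hE k r J (fun a i => Z i a) X (fun a i => t i a) (fun a j hj => (h j).2 (hr' j hj) a)
      ((h r).1 hr)
  · have := fun i => (h i).2 (hQ q i) a
    have : IsIso (C := Fin k → V) (X := fun i => Z i a) (Y := X) (fun i => t i a) :=
      ⟨fun i => inv (t i a), funext fun i => IsIso.hom_inv_id _, funext fun i => IsIso.inv_hom_id _⟩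
    exact Functor.map_isIso _ _

end

namespace HasFree

variable {V : Type (max v u)} [Category.{v} V] {E : Multitensor V} (hS : E.HasFree) {n : ℕ}

/-- The morphism of free ordered categories induced by morphisms of algebras. -/
noncomputable def freeMap {X Y : Fin n → E.unary.Algebra} (g : ∀ j, X j ⟶ Y j) :
    (hS.free X).cat ⟶ (hS.free Y).cat :=
  (hS.free X).desc fun j => g j ≫ (hS.free Y).ι j

theorem freeMap_app {X Y : Fin n → E.unary.Algebra} (g : ∀ j, X j ⟶ Y j) :
    OCat.Hom.app (hS.freeMap g) (Fin.zero_le (Fin.last n)) = hS.map g :=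
  (hS.ext_of_monotone (Z := (hS.free Y).cat) monotone_id fun j => g j ≫ (hS.free Y).ι j).symm

/-- With `toUnderSeq_desc`, this identifies the hom from `p` to `q` of the free ordered category
with the lifted tensor of the entries between `p` and `q`. -/
theorem desc_toUnderSeq {X : Fin n → E.unary.Algebra} {p q : Fin (n + 1)} (h : p ≤ q) :
    OCat.Hom.app (hS.underSeqDesc X) h ≫ OCat.Hom.app (hS.toUnderSeq X) h =
      𝟙 (hS.obj (interval X p q)) := by
  refine (hS.ext_comp (hS.toUnderSeq X) _ _).trans ?_
  refine Eq.trans ?_ (OCat.map_gen_comp (E := hS.lift) X h)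
  refine Eq.trans ?_ (congrArg (_ ≫ ·) (hS.comp_eq_ext (OCat.ofSeq hS.lift X) _)).symm
  refine Eq.trans ?_ (hS.map_ext _ _ _).symm
  refine congrArg (hS.ext (X := interval X p q) (Z := hS.under (OCat.ofSeq hS.lift X)) _)
    (funext fun j => ?_)
  exact ((hS.free X).ι_desc _ _).trans (Category.comp_id _).symm

/-- The hom from `p` to `q` is the lifted tensor of the entries in between, so the other entries
have no influence on it. -/
theorem isIso_freeMap_app {X Y : Fin n → E.unary.Algebra} (g : ∀ j, X j ⟶ Y j)
    {p q : Fin (n + 1)} (h : p ≤ q)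
    (hg : ∀ j : Fin n, p ≤ j.castSucc ∧ j.succ ≤ q → IsIso (g j)) :
    IsIso (OCat.Hom.app (hS.freeMap g) h) := by
  have h₁ : ∀ X : Fin n → E.unary.Algebra, IsIso (OCat.Hom.app (hS.underSeqDesc X) h) := fun X =>
    ⟨OCat.Hom.app (hS.toUnderSeq X) h, hS.desc_toUnderSeq h,
      congrArg (fun φ => OCat.Hom.app φ h) (hS.toUnderSeq_desc X)⟩
  have h₂ := h₁ X
  have h₃ := h₁ Y
  let g' : interval X p q ⟶ interval Y p q := fun j =>
    g ⟨j + p, by have := q.is_le; have := j.is_lt; omega⟩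
  have h₄ : hS.map g' ≫ OCat.Hom.app (hS.underSeqDesc Y) h =
      OCat.Hom.app (hS.underSeqDesc X) h ≫ OCat.Hom.app (hS.freeMap g) h := by
    refine (hS.map_ext _ _ _).trans (Eq.trans ?_ (hS.ext_comp (hS.freeMap g) _ _).symm)
    refine congrArg (hS.ext (X := interval X p q) (Z := (hS.free Y).cat) _) (funext fun j => ?_)
    exact ((hS.free X).ι_desc (fun j => g j ≫ (hS.free Y).ι j) _).symm
  have h₅ : IsIso g' := by
    have : ∀ j, IsIso (g' j) := fun j => hg _ ⟨by rw [Fin.le_def]; simp, by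
      have := j.is_lt
      rw [Fin.le_def]
      simp only [Fin.val_succ]
      omega⟩
    exact ⟨fun j => inv (g' j), funext fun j => IsIso.hom_inv_id (g' j),
      funext fun j => IsIso.inv_hom_id (g' j)⟩
  have h₆ : IsIso (hS.map g') := inferInstanceAs (IsIso ((hS.lift.tensor _).map g'))
  have h₇ : IsIso (OCat.Hom.app (hS.underSeqDesc X) h ≫ OCat.Hom.app (hS.freeMap g) h) := by
    rw [← h₄]
    exact IsIso.comp_isIso' h₆ h₃
  exact IsIso.of_isIso_comp_left (OCat.Hom.app (hS.underSeqDesc X) h) _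

end HasFree

end Multitensor

namespace OCat.Glue

variable {V : Type u} [Category.{v} V] {E : Multitensor V} {I : Type w₁} [Preorder I] {J : Type v}

/-- Gluing when every hom is either a coproduct or isomorphic to the given homs. -/
theorem hasComp_of_coprodIf (D : Glue E I J) (hE : E.IsDistributive) (P : I → I → Prop)
    (hP : ∀ {k : ℕ} {c d : Fin k → I} {a b : I}, MonoPath c d a b → P a b →
      ∃ r, P (c r) (d r) ∧ ∀ j, j ≠ r → ¬ P (c j) (d j))
    (hP' : ∀ {k : ℕ} {c d : Fin k → I} {a b : I}, MonoPath c d a b → ¬ P a b →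
      ∀ j, ¬ P (c j) (d j))
    (s : ∀ x, D.source x ⟶ D.target)
    (hs : ∀ x {p q} (h : p ≤ q), D.into x h ≫ D.out h = Hom.app (s x) h)
    (h₁ : ∀ {p q} (h : p ≤ q), Multitensor.CoprodIf (P p q) fun x => (D.into x h).f)
    (h₂ : ∀ {p q} (h : p ≤ q), ¬ P p q → IsIso (D.out h).f) : D.HasComp := by
  -- Where `P` holds, the maps of the cocone are jointly epic. Elsewhere the index type may be empty
  -- and they detect nothing, but there `out` is invertible; this is why detection involves both.
  have key : ∀ {a b : I} (hab : a ≤ b) {Z : J → V} {X : V} {t : ∀ x, Z x ⟶ X},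
      Multitensor.CoprodIf (P a b) t → ∀ {f g : X ⟶ (D.hom a b).A},
      (∀ x, t x ≫ f = t x ≫ g) → f ≫ (D.out hab).f = g ≫ (D.out hab).f → f = g := by
    intro a b hab Z X t ht f g hfg hfg'
    by_cases hP : P a b
    · obtain ⟨hc⟩ := ht.1 hP
      exact Cofan.IsColimit.hom_ext hc _ _ hfg
    · have := h₂ hab hP
      exact (cancel_mono _).1 hfg'
  have hk : ∀ {k : ℕ} {c d : Fin k → I} {a b : I} (h : MonoPath c d a b),
      Multitensor.CoprodIf (P a b)
        (Z := fun x => (E.tensor k).obj fun i => ((D.source x).hom (c i) (d i)).A)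
        (X := (E.tensor k).obj fun i => (D.hom (c i) (d i)).A)
        fun x => (E.tensor k).map fun i => (D.into x (h.step i)).f := fun h =>
    hE.coprodIf (hP h) (hP' h) fun i => h₁ (h.step i)
  have hs' : ∀ {k : ℕ} {c d : Fin k → I} {a b : I} (h : MonoPath c d a b) (x : J),
      (E.tensor k).map (fun i => (D.into x (h.step i)).f) ≫
        (E.tensor k).map (fun i => (D.out (h.step i)).f) ≫ D.target.comp h =
        (D.source x).comp h ≫ (D.into x h.le).f ≫ (D.out h.le).f := by
    intro k c d a b h x
    refine (Category.assoc _ _ _).symm.trans ?_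
    refine (congrArg (· ≫ _) ((E.tensor k).map_comp _ _).symm).trans ?_
    refine Eq.trans ?_ (congrArg (fun f => _ ≫ Monad.Algebra.Hom.f f) (hs x h.le).symm)
    refine Eq.trans ?_ (Hom.app_comp (s x) h)
    exact congrArg (fun f => (E.tensor k).map f ≫ _) (funext fun i =>
      congrArg Monad.Algebra.Hom.f (hs x (h.step i)))
  refine ⟨fun {k c d a b} h => ?_, fun {k c d a b} h => key h.le (hk h),
    fun {k n c₂ d₂ c d a b} h hh₂ =>
      key h.le (hE.coprodIf (hP h) (hP' h) fun i => hk (hh₂ i))⟩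
  by_cases hab : P a b
  · obtain ⟨hc⟩ := (hk h).1 hab
    have hd : ∀ x, (E.tensor k).map (fun i => (D.into x (h.step i)).f) ≫
        Cofan.IsColimit.desc hc (fun x => (D.source x).comp h ≫ (D.into x h.le).f) =
        (D.source x).comp h ≫ (D.into x h.le).f := fun x => Cofan.IsColimit.fac hc _ x
    refine ⟨Cofan.IsColimit.desc hc fun x => (D.source x).comp h ≫ (D.into x h.le).f, hd,
      Cofan.IsColimit.hom_ext hc _ _ fun x => ?_⟩
    refine (Category.assoc _ _ _).symm.trans ((congrArg (· ≫ _) (hd x)).trans ?_)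
    exact (Category.assoc _ _ _).trans (hs' h x).symm
  · have := h₂ h.le hab
    refine ⟨(E.tensor k).map (fun i => (D.out (h.step i)).f) ≫ D.target.comp h ≫
      inv (D.out h.le).f, fun x => ?_, ?_⟩
    · rw [← cancel_mono (D.out h.le).f, Category.assoc, Category.assoc, Category.assoc,
        IsIso.inv_hom_id, Category.comp_id, hs', Category.assoc]
    · rw [Category.assoc, Category.assoc, IsIso.inv_hom_id, Category.comp_id]

end OCat.Glue

namespace Multitensor.HasFree

variable {V : Type (max v u)} [Category.{v} V] {E : Multitensor V} (hS : E.HasFree) {n : ℕ}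

/-- The free ordered categories on the `Z x` are glued: by coproducts of homs where the interval
contains the `i`-th entry, and with the homs for `W` elsewhere. The generators for `W` lift to the
result, so its comparison map to the free ordered category on `W` has a section, which is an inverse
from `0` to `n`. -/
theorem isDistributive_lift [HasColimitsOfSize.{v, v} V] [HasColimitsOfSize.{v, v} E.unary.Algebra]
    (hE : E.IsDistributive) : hS.lift.IsDistributive := by
  intro n i J Z W ι hι hW
  obtain ⟨hW⟩ := hW
  let P : Fin (n + 1) → Fin (n + 1) → Prop := fun p q => p ≤ i.castSucc ∧ i.succ ≤ q
  let s : ∀ x, (hS.free (Z x)).cat ⟶ (hS.free W).cat := fun x => hS.freeMap (ι x)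
  have hsiso : ∀ x {p q : Fin (n + 1)} (h : p ≤ q), ¬ P p q → IsIso (OCat.Hom.app (s x) h) :=
    fun x p q h hpq => hS.isIso_freeMap_app (ι x) h fun j hj =>
      hι x j fun hji => hpq (by subst hji; exact hj)
  have hpres : PreservesColimitsOfShape (Discrete J) E.unary.forget := by
    have := hE.preservesColimitsOfShape_unary J
    infer_instance
  have hdata : ∀ p q : Fin (n + 1), ∃ (H : E.unary.Algebra)
      (into : ∀ (x : J), p ≤ q → ((hS.free (Z x)).cat.hom p q ⟶ H))
      (out : p ≤ q → (H ⟶ (hS.free W).cat.hom p q)),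
      (∀ x h, into x h ≫ out h = OCat.Hom.app (s x) h) ∧
      (P p q → ∀ h, Nonempty (IsColimit (Cofan.mk H fun x => into x h))) ∧
      (¬ P p q → ∀ h, IsIso (out h) ∧ ∀ x, IsIso (into x h)) := by
    intro p q
    by_cases hpq : P p q
    · refine ⟨∐ fun x => (hS.free (Z x)).cat.hom p q, 
        fun x _ => Limits.Sigma.ι (fun x => (hS.free (Z x)).cat.hom p q) x,
        fun h => Limits.Sigma.desc fun x => OCat.Hom.app (s x) h, fun x h => Limits.Sigma.ι_desc _ _,
        fun _ _ => ⟨coproductIsCoproduct _⟩, fun h => absurd hpq h⟩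
    · exact ⟨(hS.free W).cat.hom p q, fun x h => OCat.Hom.app (s x) h, fun _ => 𝟙 _,
        fun x h => Category.comp_id _, fun h => absurd h hpq,
        fun _ h => ⟨inferInstance, fun x => hsiso x h hpq⟩⟩
  choose H into out hio hcol hiso using hdata
  let D : OCat.Glue E (Fin (n + 1)) J :=
    { source := fun x => (hS.free (Z x)).cat
      target := (hS.free W).cat
      hom := H
      into := fun x {p q} h => into p q x h
      out := fun {p q} h => out p q h }
  have hD : D.HasComp := by
    refine D.hasComp_of_coprodIf hE P (fun h hab => h.existsUnique_step hab)
      (fun h hab j hj => hab ⟨(h.source_le j).trans hj.1, hj.2.trans (h.le_target j)⟩) s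
      (fun x p q h => hio p q x h) (fun {p q} h => ⟨fun hpq => ?_, fun hpq x => ?_⟩)
      fun {p q} h hpq => ?_
    · exact ⟨isColimitCofanMkObjOfIsColimit E.unary.forget _ _ (hcol p q hpq h).some⟩
    · have := (hiso p q hpq h).2 x
      exact inferInstanceAs (IsIso (E.unary.forget.map (into p q x h)))
    · have := (hiso p q hpq h).1
      exact inferInstanceAs (IsIso (E.unary.forget.map (out p q h)))
  -- For `j = i` the lift comes from the coproduct `W i`; for the other `j` the comparison map is
  -- invertible on this hom.
  have hw : ∀ j : Fin n, ∃ w : W j ⟶ D.hom j.castSucc j.succ,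
      w ≫ D.out (Fin.castSucc_le_succ j) = (hS.free W).ι j ∧
      ∀ x, ι x j ≫ w = (hS.free (Z x)).ι j ≫ D.into x (Fin.castSucc_le_succ j) := by
    intro j
    have hsι : ∀ x, (hS.free (Z x)).ι j ≫ OCat.Hom.app (s x) (Fin.castSucc_le_succ j) =
      ι x j ≫ (hS.free W).ι j := fun x => (hS.free (Z x)).ι_desc _ j
    by_cases hji : j = i
    · subst hji
      have hd : ∀ x, ι x j ≫ Cofan.IsColimit.desc hW (fun x => (hS.free (Z x)).ι j ≫
          D.into x (Fin.castSucc_le_succ j)) =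
          (hS.free (Z x)).ι j ≫ D.into x (Fin.castSucc_le_succ j) :=
        fun x => Cofan.IsColimit.fac hW _ x
      refine ⟨_, Cofan.IsColimit.hom_ext hW _ _ fun x => ?_, hd⟩
      refine (Category.assoc _ _ _).symm.trans ((congrArg (· ≫ _) (hd x)).trans ?_)
      refine (Category.assoc _ _ _).trans ((congrArg (_ ≫ ·) (hio _ _ x _)).trans (hsι x))
    · have hP : ¬ P j.castSucc j.succ := fun h => hji (by
        have h₁ := h.1
        have h₂ := h.2
        rw [Fin.le_def] at h₁ h₂
        simp only [Fin.val_succ, Fin.val_castSucc] at h₁ h₂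
        exact Fin.ext (by omega))
      have h₁ : IsIso (D.out (Fin.castSucc_le_succ j)) := (hiso _ _ hP _).1
      refine ⟨(hS.free W).ι j ≫ inv (D.out (Fin.castSucc_le_succ j)), ?_, fun x => ?_⟩
      · rw [Category.assoc, IsIso.inv_hom_id, Category.comp_id]
      · rw [← Category.assoc, IsIso.comp_inv_eq]
        refine (hsι x).symm.trans (Eq.trans ?_ (Category.assoc _ _ _).symm)
        exact congrArg (_ ≫ ·) (hio _ _ x _).symm
  choose w hw₁ hw₂ using hw
  obtain ⟨ρ, hρ, hρ'⟩ := OCat.Free.exists_section (hS.free W) (fun x => hS.free (Z x)) ι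
    (OCat.Glue.toGlue hD) (OCat.Glue.fromGlue hD) w hw₁ fun x j => hw₂ j x
  have hP : P 0 (Fin.last n) := ⟨Fin.zero_le _, Fin.le_last _⟩
  have h0 := Fin.zero_le (Fin.last n)
  obtain ⟨hc⟩ := hcol 0 (Fin.last n) hP h0
  let e : H 0 (Fin.last n) ≅ hS.obj W :=
    { hom := out 0 (Fin.last n) h0
      inv := OCat.Hom.app ρ h0
      hom_inv_id := Cofan.IsColimit.hom_ext hc _ _ fun x =>
        (congrArg (fun φ => OCat.Hom.app φ h0) (hρ' x)).trans (Category.comp_id _).symm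
      inv_hom_id := congrArg (fun φ => OCat.Hom.app φ h0) hρ }
  refine ⟨IsColimit.ofIsoColimit hc (Cofan.ext e fun x => ?_)⟩
  exact (hio 0 (Fin.last n) x h0).trans (hS.freeMap_app (ι x))

end Multitensor.HasFree

/-! ### Accessibility of the lifted multitensor -/

section TensorCocone

variable {V : Type u} [Category.{v} V] {J : Type w₁} [Category.{w₂} J]

/-- The value of a multitensor on a family of cocones. -/
def Multitensor.tensorCocone (E : Multitensor V) {k : ℕ} {G : Fin k → J ⥤ V}
    (c : ∀ i, Cocone (G i)) : Cocone (Functor.pi' G ⋙ E.tensor k) where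
  pt := (E.tensor k).obj fun i => (c i).pt
  ι :=
    { app := fun x => (E.tensor k).map fun i => (c i).ι.app x
      naturality := fun x y f => by
        refine Eq.trans ?_ (Category.comp_id _).symm
        refine ((E.tensor k).map_comp _ _).symm.trans ?_
        exact congrArg (E.tensor k).map (funext fun i => (c i).w f) }

/-- The value of a multitensor on a family of colimit cocones. -/
noncomputable def Multitensor.isColimitTensorCocone (E : Multitensor V) {k : ℕ}
    [PreservesColimitsOfShape J (E.tensor k)] {G : Fin k → J ⥤ V} {c : ∀ i, Cocone (G i)}
    (hc : ∀ i, IsColimit (c i)) : IsColimit (E.tensorCocone c) := by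
  let c' : Cocone (Functor.pi' G) :=
    { pt := fun i => (c i).pt
      ι := { app := fun x i => (c i).ι.app x
             naturality := fun x y f => funext fun i => (c i).ι.naturality f } }
  exact isColimitOfPreserves (E.tensor k) (isColimitOfEval c' hc)

end TensorCocone

namespace OCat

variable {V : Type u} [Category.{v} V] {E : Multitensor V} {I : Type w₁} [Preorder I]

/-- The functor taking an ordered category to one of its homs. -/
def homFunctor (E : Multitensor V) {p q : I} (h : p ≤ q) : OCat E I ⥤ V where
  obj X := (X.hom p q).A
  map φ := (Hom.app φ h).f

variable {J : Type w₂} [Category.{v₁} J] (S : J ⥤ OCat E I) {hom : I → I → E.unary.Algebra}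
  {into : ∀ x {p q : I}, p ≤ q → ((S.obj x).hom p q ⟶ hom p q)}

/-- The cocones of a compatible family of maps into a family of algebras. -/
def intoCocone (hw : ∀ {x y : J} (f : x ⟶ y) {p q : I} (h : p ≤ q),
    Hom.app (S.map f) h ≫ into y h = into x h) {p q : I} (h : p ≤ q) :
    Cocone (S ⋙ homFunctor E h) where
  pt := (hom p q).A
  ι :=
    { app := fun x => (into x h).f
      naturality := fun _ _ f =>
        (congrArg Monad.Algebra.Hom.f (hw f h)).trans (Category.comp_id _).symm }

/-- Gluing when the homs are colimits. -/
theorem Glue.hasComp_of_isColimit [∀ k, PreservesColimitsOfShape J (E.tensor k)]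
    (T : OCat E I) (out : ∀ {p q : I}, p ≤ q → (hom p q ⟶ T.hom p q)) (s : ∀ x, S.obj x ⟶ T)
    (hs : ∀ x {p q} (h : p ≤ q), into x h ≫ out h = Hom.app (s x) h)
    (hw : ∀ {x y} (f : x ⟶ y) {p q : I} (h : p ≤ q),
      Hom.app (S.map f) h ≫ into y h = into x h)
    (hc : ∀ {p q : I} (h : p ≤ q), Nonempty (IsColimit (intoCocone S hw h))) :
    Glue.HasComp ⟨S.obj, T, hom, into, out⟩ := by
  have hk : ∀ {k : ℕ} {c d : Fin k → I} {a b : I} (h : MonoPath c d a b),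
      IsColimit (E.tensorCocone fun i => intoCocone S hw (h.step i)) := fun h =>
    E.isColimitTensorCocone fun i => (hc (h.step i)).some
  refine ⟨fun {k c d a b} h => ?_, fun {k c d a b} h {f g} hfg _ => (hk h).hom_ext hfg,
    fun {k n c₂ d₂ c d a b} h h₂ {f g} hfg _ =>
      (E.isColimitTensorCocone fun i => hk (h₂ i)).hom_ext hfg⟩
  let c' : Cocone (Functor.pi' (fun i => S ⋙ homFunctor E (h.step i)) ⋙ E.tensor k) :=
    { pt := (hom a b).A
      ι :=
        { app := fun x => (S.obj x).comp h ≫ (into x h.le).f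
          naturality := fun x y f => by
            refine (Category.assoc _ _ _).symm.trans ?_
            refine (congrArg (· ≫ _) (Hom.app_comp (S.map f) h)).trans ?_
            refine (Category.assoc _ _ _).trans (Eq.trans ?_ (Category.comp_id _).symm)
            exact congrArg (_ ≫ ·) (congrArg Monad.Algebra.Hom.f (hw f h.le)) } }
  have hd : ∀ x, (E.tensor k).map (fun i => (into x (h.step i)).f) ≫ (hk h).desc c' =
      (S.obj x).comp h ≫ (into x h.le).f := (hk h).fac c'
  refine ⟨(hk h).desc c', hd, (hk h).hom_ext fun x => ?_⟩
  refine (Category.assoc _ _ _).symm.trans ((congrArg (· ≫ _) (hd x)).trans ?_)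
  refine (Category.assoc _ _ _).trans ?_
  refine (congrArg (fun f => _ ≫ Monad.Algebra.Hom.f f) (hs x h.le)).trans ?_
  refine (Hom.app_comp (s x) h).symm.trans (Eq.trans ?_ (Category.assoc _ _ _))
  refine congrArg (· ≫ _) (Eq.trans ?_ ((E.tensor k).map_comp _ _))
  exact congrArg (E.tensor k).map (funext fun i =>
    (congrArg Monad.Algebra.Hom.f (hs x (h.step i))).symm)

end OCat

namespace Multitensor.HasFree

variable {V : Type (max v u)} [Category.{v} V] {E : Multitensor V} (hS : E.HasFree) {n : ℕ}

/-- The functor taking a sequence of algebras to its free ordered category. -/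
noncomputable def freeFunctor (n : ℕ) : (Fin n → E.unary.Algebra) ⥤ OCat E (Fin (n + 1)) where
  obj X := (hS.free X).cat
  map g := hS.freeMap g
  map_id X := (hS.free X).hom_ext fun b => ((hS.free X).ι_desc _ b).trans
    ((Category.id_comp _).trans (Category.comp_id _).symm)
  map_comp {X Y Z} f g := (hS.free X).hom_ext fun b => by
    refine ((hS.free X).ι_desc _ b).trans ?_
    refine Eq.trans ?_ (Category.assoc _ _ _)
    refine Eq.trans ?_ (congrArg (· ≫ _) ((hS.free X).ι_desc _ b)).symm
    refine (Category.assoc _ _ _).trans (Eq.trans ?_ (Category.assoc _ _ _).symm)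
    exact congrArg (_ ≫ ·) ((hS.free Y).ι_desc (fun j => g j ≫ (hS.free Z).ι j) b).symm

/-- The gluing argument again, with every relevant hom a colimit over `J`. Filteredness plays no
role: it is enough that the tensors of `E` preserve colimits of shape `J`. -/
theorem preservesColimitsOfShape_lift [HasColimitsOfSize.{v, v} V]
    [HasColimitsOfSize.{v, v} E.unary.Algebra] {J : Type v} [Category.{v} J]
    [hE : ∀ k, PreservesColimitsOfShape J (E.tensor k)] (n : ℕ) :
    PreservesColimitsOfShape J (hS.lift.tensor n) := by
  refine ⟨fun {K} => ⟨fun {c} hc => ?_⟩⟩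
  have hunary : PreservesColimitsOfShape J E.unary.toFunctor := by
    have := preservesColimitsOfShape_pi' (J := J) (fun _ : Fin 1 => 𝟭 V)
    exact inferInstanceAs (PreservesColimitsOfShape J
      (Functor.pi' (fun _ : Fin 1 => 𝟭 V) ⋙ E.tensor 1))
  have hpres : PreservesColimitsOfShape J E.unary.forget := inferInstance
  have hcj : ∀ j, IsColimit ((Pi.eval (fun _ => E.unary.Algebra) j).mapCocone c) := fun j =>
    have := preservesColimitsOfShape_eval (V := E.unary.Algebra) (J := J) j
    isColimitOfPreserves _ hc
  let F : ∀ {p q : Fin (n + 1)}, p ≤ q → J ⥤ E.unary.Algebra := fun {p q} h =>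
    { obj := fun x => (hS.free (K.obj x)).cat.hom p q
      map := fun f => OCat.Hom.app ((hS.freeFunctor n).map (K.map f)) h
      map_id := fun x => by rw [K.map_id, (hS.freeFunctor n).map_id]; rfl
      map_comp := fun f g => by rw [K.map_comp, (hS.freeFunctor n).map_comp]; rfl }
  let s : ∀ x, (hS.free (K.obj x)).cat ⟶ (hS.free c.pt).cat := fun x => hS.freeMap (c.ι.app x)
  have hsw : ∀ {x y} (f : x ⟶ y), (hS.freeFunctor n).map (K.map f) ≫ s y = s x := fun {x y} f =>
    ((hS.freeFunctor n).map_comp _ _).symm.trans (congrArg (hS.freeFunctor n).map (c.w f))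
  have hdata : ∀ p q : Fin (n + 1), ∃ (H : E.unary.Algebra)
      (into : ∀ (x : J), p ≤ q → ((hS.free (K.obj x)).cat.hom p q ⟶ H))
      (out : p ≤ q → (H ⟶ (hS.free c.pt).cat.hom p q)),
      (∀ x h, into x h ≫ out h = OCat.Hom.app (s x) h) ∧
      ∃ hw : ∀ {x y} (f : x ⟶ y) h, (F h).map f ≫ into y h = into x h,
        ∀ h, Nonempty (IsColimit (Cocone.mk H
          { app := fun x => into x h
            naturality := fun x y f => (hw f h).trans (Category.comp_id _).symm } :
              Cocone (F h))) := by
    intro p q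
    by_cases h : p ≤ q
    · refine ⟨colimit (F h), fun x _ => colimit.ι (F h) x, fun _ => colimit.desc (F h)
        { pt := (hS.free c.pt).cat.hom p q
          ι :=
            { app := fun x => OCat.Hom.app (s x) h
              naturality := fun x y f => (congrArg (fun φ => OCat.Hom.app φ h) (hsw f)).trans
                (Category.comp_id _).symm } }, fun x _ => colimit.ι_desc _ _,
        fun f _ => colimit.w (F h) f, fun _ => ⟨?_⟩⟩
      exact IsColimit.ofIsoColimit (colimit.isColimit (F h))
        (Cocone.ext (Iso.refl _) fun x => Category.comp_id _)
    -- A default value, since this hom is irrelevant.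
    · exact ⟨(hS.free c.pt).cat.hom p q, fun x h' => absurd h' h, fun h' => absurd h' h, fun x h' => absurd h' h,
        fun _ h' => absurd h' h, fun h' => absurd h' h⟩
  choose H into out hio hw hcol using hdata
  have hD : OCat.Glue.HasComp ⟨fun x => (hS.free (K.obj x)).cat, (hS.free c.pt).cat, H,
      fun x {p q} h => into p q x h, fun {p q} h => out p q h⟩ :=
    OCat.Glue.hasComp_of_isColimit (K ⋙ hS.freeFunctor n) (hS.free c.pt).cat
      (fun {p q} h => out p q h) s (fun x {p q} h => hio p q x h)
      (fun {x y} f {p q} h => hw p q f h) fun {p q} h =>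
        ⟨isColimitOfPreserves E.unary.forget (hcol p q h).some⟩
  have hwj : ∀ j : Fin n, ∃ w : c.pt j ⟶ H j.castSucc j.succ,
      w ≫ out _ _ (Fin.castSucc_le_succ j) = (hS.free c.pt).ι j ∧
      ∀ x, c.ι.app x j ≫ w = (hS.free (K.obj x)).ι j ≫ into _ _ x (Fin.castSucc_le_succ j) := by
    intro j
    let c' : Cocone (K ⋙ Pi.eval (fun _ => E.unary.Algebra) j) :=
      { pt := H j.castSucc j.succ
        ι :=
          { app := fun x => (hS.free (K.obj x)).ι j ≫ into _ _ x (Fin.castSucc_le_succ j)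
            naturality := fun x y f => by
              refine Eq.trans ?_ (Category.comp_id _).symm
              refine Eq.trans ?_ (congrArg (_ ≫ ·) (hw _ _ f (Fin.castSucc_le_succ j)))
              refine (Category.assoc _ _ _).symm.trans (Eq.trans ?_ (Category.assoc _ _ _))
              exact congrArg (· ≫ _) ((hS.free (K.obj x)).ι_desc
                (fun j => K.map f j ≫ (hS.free (K.obj y)).ι j) j).symm } }
    have hd : ∀ x, c.ι.app x j ≫ (hcj j).desc c' =
      (hS.free (K.obj x)).ι j ≫ into _ _ x (Fin.castSucc_le_succ j) := (hcj j).fac c'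
    refine ⟨(hcj j).desc c', (hcj j).hom_ext fun x => ?_, hd⟩
    refine (Category.assoc _ _ _).symm.trans ((congrArg (· ≫ _) (hd x)).trans ?_)
    refine (Category.assoc _ _ _).trans ((congrArg (_ ≫ ·) (hio _ _ x _)).trans ?_)
    exact (hS.free (K.obj x)).ι_desc (fun j => c.ι.app x j ≫ (hS.free c.pt).ι j) j
  choose w hw₁ hw₂ using hwj
  obtain ⟨ρ, hρ, hρ'⟩ := OCat.Free.exists_section (hS.free c.pt) (fun x => hS.free (K.obj x))
    (fun x => c.ι.app x) (OCat.Glue.toGlue hD) (OCat.Glue.fromGlue hD) w hw₁ fun x j => hw₂ j x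
  have h0 := Fin.zero_le (Fin.last n)
  obtain ⟨hc0⟩ := hcol 0 (Fin.last n) h0
  let e : H 0 (Fin.last n) ≅ hS.obj c.pt :=
    { hom := out 0 (Fin.last n) h0
      inv := OCat.Hom.app ρ h0
      hom_inv_id := hc0.hom_ext fun x =>
        (congrArg (fun φ => OCat.Hom.app φ h0) (hρ' x)).trans (Category.comp_id _).symm
      inv_hom_id := congrArg (fun φ => OCat.Hom.app φ h0) hρ }
  let α : K ⋙ hS.lift.tensor n ≅ F h0 := NatIso.ofComponents (fun x => Iso.refl _) fun f =>
    (Category.comp_id _).trans ((hS.freeMap_app (K.map f)).symm.trans (Category.id_comp _).symm)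
  refine ⟨IsColimit.ofIsoColimit ((IsColimit.precomposeHomEquiv α _).symm hc0)
    (Cocone.ext e fun x => ?_)⟩
  refine (congrArg (· ≫ _) (Category.id_comp _)).trans ?_
  exact (hio 0 (Fin.last n) x h0).trans (hS.freeMap_app (c.ι.app x))

theorem isCardinalAccessible_lift [HasColimitsOfSize.{v, v} V]
    [HasColimitsOfSize.{v, v} E.unary.Algebra] (κ : Cardinal.{v}) [Fact κ.IsRegular]
    (hE : E.IsCardinalAccessible κ) : hS.lift.IsCardinalAccessible κ := fun n =>
  ⟨fun J _ _ =>
    have : ∀ k, PreservesColimitsOfShape J (E.tensor k) := fun k =>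
      have := hE k
      (E.tensor k).preservesColimitsOfShape_of_isCardinalAccessible κ J
    hS.preservesColimitsOfShape_lift n⟩

end Multitensor.HasFree

/-! ### Enriched categories over the lifted multitensor -/

/-- A type with the preorder in which any two elements are related. -/
def Indiscrete (α : Type w₁) : Type w₁ := α

instance (α : Type w₁) : Preorder (Indiscrete α) where
  le _ _ := True
  le_refl _ := trivial
  le_trans _ _ _ _ _ := trivial

/-- `IsPath` takes its vertices as data while `MonoPath` only asserts that they exist; they are
recovered from the start and the targets. -/
theorem MonoPath.eq_cons {I : Type*} [Preorder I] {k : ℕ} {c d : Fin k → I} {a b : I}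
    (h : MonoPath c d a b) : (Fin.cons a d : Fin (k + 1) → I) (Fin.last k) = b ∧
      ∀ i : Fin k, (Fin.cons a d : Fin (k + 1) → I) i.castSucc = c i := by
  obtain ⟨x, -, rfl, rfl, hc, hd⟩ := h
  obtain rfl := funext hd
  have : (Fin.cons (x 0) (fun i : Fin k => x i.succ) : Fin (k + 1) → I) = x :=
    Fin.cons_self_tail x
  rw [this]
  exact ⟨rfl, hc⟩

theorem VGraph.IsPath.monoPath {V : Type u} [Category.{v} V] {X : VGraph V} {n : ℕ}
    {x : Fin (n + 1) → X.vertex} {a b : X.vertex} {Z : Fin n → V} (h : X.IsPath x a b Z) :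
    MonoPath (I := Indiscrete X.vertex) (fun i : Fin n => x i.castSucc) (fun i => x i.succ) a b :=
  ⟨x, fun _ _ _ => trivial, h.start, h.finish, fun _ => rfl, fun _ => rfl⟩

namespace EnrichedCat

variable {V : Type u} [Category.{v} V] {E : Multitensor V}

theorem isPath (X : EnrichedCat E) {k : ℕ} {c d : Fin k → Indiscrete X.vertex}
    {a b : Indiscrete X.vertex} (h : MonoPath c d a b) :
    X.IsPath (Fin.cons a d) a b (fun i => X.hom (c i) (d i)) :=
  ⟨rfl, h.eq_cons.1, fun i => congrArg (fun p => X.hom p (d i)) (h.eq_cons.2 i).symm⟩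

theorem comp_congr (X : EnrichedCat E) {n : ℕ} {x y : Fin (n + 1) → X.vertex} {a b : X.vertex}
    {Z : Fin n → V} (hx : X.IsPath x a b Z) (hy : X.IsPath y a b Z) (h : x = y) :
    X.comp hx = X.comp hy := by
  subst h
  rfl

/-- An enriched category as an ordered category on an indiscrete preorder. -/
def toOCat (X : EnrichedCat E) : OCat E (Indiscrete X.vertex) where
  hom := X.homAlgebra
  comp h := X.comp (X.isPath h)
  comp_edge {p q} h := X.comp_congr _ _ (funext fun i => by fin_cases i <;> rfl)
  comp_subst {k m n c d c₂ d₂ c' d' a b} hc hd h h' h₂ := by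
    have hm := hc.length_eq
    obtain ⟨x, hx, rfl, rfl, rfl, rfl, rfl, rfl, rfl, rfl⟩ :=
      MonoPath.exists_blocks hm hc hd h h' h₂
    have hx' : (Fin.cons (x 0) (fun i : Fin m => x i.succ) : Fin (m + 1) → Indiscrete X.vertex) =
      x := Fin.cons_self_tail x
    refine X.subst_comp_of_isPath (hc.map₂ hd X.hom) (X.isPath h) (fun i => X.isPath (h₂ i))
      (X.isPath h') (fun i j => ?_) fun i => ?_
    · refine Eq.trans ?_ (congrFun hx' _).symm
      induction j using Fin.cases with
      | zero => rfl
      | succ j => rfl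
    · refine Eq.trans ?_ (congrFun hx' _).symm
      induction i using Fin.cases with
      | zero => exact congrArg x (cutVertex_zero n _).symm
      | succ i => rfl

theorem toOCat_comp (X : EnrichedCat E) {n : ℕ} {x : Fin (n + 1) → X.vertex}
    {a b : X.vertex}
    (hx : X.IsPath x a b fun i => X.hom (x i.castSucc) (x i.succ))
    (h : MonoPath (I := Indiscrete X.vertex) (fun i : Fin n => x i.castSucc) (fun i => x i.succ)
      a b) : X.toOCat.comp h = X.comp hx := by
  obtain ⟨rfl, rfl, -⟩ := hx
  exact X.comp_congr _ _ (Fin.cons_self_tail x)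

/-- The morphism of ordered categories given by an enriched functor. -/
def toOCatMap {X Y : EnrichedCat E} (f : X ⟶ Y) :
    X.toOCat ⟶ Y.toOCat.pull (I' := Indiscrete X.vertex) (y := (Hom.toGraphHom f).onVertex)
      (fun _ _ _ => trivial) where
  app {p q} _ := ((toAlgebraGraph E).map f).onHom p q
  app_comp {k c d a b} h := by
    refine Hom.map_comp_of_isPath f (X.isPath h) (Y.isPath (h.map fun _ _ _ => trivial))
      (fun i => ?_) _ fun i => ?_
    · induction i using Fin.cases with
      | zero => rfl
      | succ i => rfl
    · exact congr_arg_heq (fun p => (Hom.toGraphHom f).onHom p (d i)) (h.eq_cons.2 i).symm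

/-- Compositions along arbitrary paths reduce to canonical ones, so only those have to be compared,
up to transport along the equality of homs. -/
theorem mk_eq_mk {t : Type v} {hom hom' : t → t → V} {comp unit_comp subst_comp}
    {comp' unit_comp' subst_comp'} (h : hom = hom')
    (hcomp : ∀ {n : ℕ} (x : Fin (n + 1) → t),
      comp (VGraph.IsPath.canonical (VGraph.mk t hom) x) ≫
          eqToHom (congrFun (congrFun h (x 0)) (x (Fin.last n))) =
        (E.tensor n).map (fun i => eqToHom (congrFun (congrFun h (x i.castSucc)) (x i.succ))) ≫
          comp' (VGraph.IsPath.canonical (VGraph.mk t hom') x)) :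
    EnrichedCat.mk (E := E) (VGraph.mk t hom) comp unit_comp subst_comp =
      EnrichedCat.mk (VGraph.mk t hom') comp' unit_comp' subst_comp' := by
  subst h
  obtain rfl : @comp = @comp' := by
    funext n x a b Z hx
    obtain ⟨rfl, rfl, hZ⟩ := hx
    obtain rfl := funext hZ
    refine (Category.comp_id _).symm.trans ((hcomp x).trans ?_)
    exact (congrArg (· ≫ _) ((E.tensor n).map_id _)).trans (Category.id_comp _)
  rfl

theorem hom_heq {X X' Y Y' : EnrichedCat E} (hX : X = X') (hY : Y = Y') {f : X ⟶ Y} {g : X' ⟶ Y'}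
    (h : HEq (Hom.toGraphHom f) (Hom.toGraphHom g)) : HEq f g := by
  subst hX hY
  exact heq_of_eq (Hom.ext (eq_of_heq h))

end EnrichedCat

theorem VGraph.mk_heq_mk {V : Type u} [Category.{v} V] {M : CategoryTheory.Monad V} {s t : Type v}
    {X X' : s → s → M.Algebra} {Y Y' : t → t → M.Algebra} (hX : X = X') (hY : Y = Y') {φ : s → t}
    {f : ∀ a b, X a b ⟶ Y (φ a) (φ b)} {g : ∀ a b, X' a b ⟶ Y' (φ a) (φ b)}
    (h : ∀ a b, HEq (f a b).f (g a b).f) :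
    HEq (VGraph.Hom.mk φ f : VGraph.Hom ⟨s, X⟩ ⟨t, Y⟩)
      (VGraph.Hom.mk φ g : VGraph.Hom ⟨s, X'⟩ ⟨t, Y'⟩) := by
  subst hX hY
  obtain rfl : f = g := funext fun a => funext fun b => Monad.Algebra.Hom.ext (eq_of_heq (h a b))
  rfl

theorem CategoryTheory.Monad.Algebra.eqToHom_f {V : Type u} [Category.{v} V]
    {M : CategoryTheory.Monad V} {A B : M.Algebra} (h : A = B) :
    (eqToHom h).f = eqToHom (congrArg Monad.Algebra.A h) := by
  subst h
  rfl

theorem CategoryTheory.Monad.Algebra.mk_eq {V : Type u} [Category.{v} V]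
    {M : CategoryTheory.Monad V} {A : M.Algebra} {a unit assoc} (h : a = A.a) :
    (Monad.Algebra.mk A.A a unit assoc : M.Algebra) = A := by
  subst h
  rfl

namespace Multitensor.HasFree

variable {V : Type (max v u)} [Category.{v} V] {E : Multitensor V} (hS : E.HasFree)

/-- The enriched category over the lifted multitensor given by an enriched category. -/
noncomputable def liftObj (X : EnrichedCat E) : EnrichedCat hS.lift where
  vertex := X.vertex
  hom := X.homAlgebra
  comp h := hS.ext (Z := X.toOCat) h.monoPath fun j => eqToHom (h.homs j)
  unit_comp a b := hS.unit_ext (Z := X.toOCat) (X := X.homAlgebra a b)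
    (VGraph.IsPath.edge (VGraph.mk X.vertex X.homAlgebra) a b).monoPath
    fun j => eqToHom ((VGraph.IsPath.edge (VGraph.mk X.vertex X.homAlgebra) a b).homs j)
  subst_comp {k m} n hm x := by
    refine (hS.map_ext (Z := X.toOCat) _ _ _).trans ?_
    refine Eq.trans ?_ (hS.subst_ext (Z := X.toOCat) (IsConcat.canonical n hm _)
      (c := fun i => x i.castSucc) (d := fun i => x i.succ)
      (IsConcat.canonical n hm _) (IsConcat.canonical n hm _)
      (VGraph.IsPath.canonical X.toVGraph x).monoPath
      (VGraph.IsPath.cuts X.toVGraph n hm x).monoPath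
      (fun i => (VGraph.IsPath.block X.toVGraph n hm x i).monoPath)
      (fun j => 𝟙 (X.homAlgebra (x j.castSucc) (x j.succ)))
      (fun i j => 𝟙 _) (fun i j => HEq.rfl)).symm
    exact congrArg (hS.ext (Z := X.toOCat) _) (funext fun i => Category.comp_id _)

/-- The functor from `E`-categories to categories enriched in the lifted multitensor. -/
noncomputable def liftFunctor : EnrichedCat E ⥤ EnrichedCat hS.lift where
  obj X := hS.liftObj X
  map {X Y} f :=
    { toGraphHom := (EnrichedCat.toAlgebraGraph E).map f
      map_comp := fun {n} x => by
        have hx := (VGraph.IsPath.canonical X.toVGraph x).monoPath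
        refine (hS.map_ext (Z := Y.toOCat) _ _ _).trans ?_
        refine Eq.trans ?_ (hS.ext_comp (Z := X.toOCat) (EnrichedCat.toOCatMap f) hx
          fun j => 𝟙 (X.homAlgebra (x j.castSucc) (x j.succ))).symm
        refine Eq.trans ?_ (hS.ext_map (Z := Y.toOCat) (I := Indiscrete X.vertex)
          (I' := Indiscrete Y.vertex) (y := (EnrichedCat.Hom.toGraphHom f).onVertex)
          (fun _ _ _ => trivial) hx _)
        exact congrArg (hS.ext (Z := Y.toOCat) _) (funext fun j =>
          (Category.comp_id _).trans (Category.id_comp _).symm) }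
  map_id X := EnrichedCat.Hom.ext ((EnrichedCat.toAlgebraGraph E).map_id X)
  map_comp f g := EnrichedCat.Hom.ext ((EnrichedCat.toAlgebraGraph E).map_comp f g)

/-- The graph underlying a graph enriched in algebras. -/
abbrev underGraph (Y : VGraph E.unary.Algebra) : VGraph V :=
  ⟨Y.vertex, fun a b => (Y.hom a b).A⟩

/-- The composition in the `E`-category underlying a category enriched in the lift of `E`. -/
noncomputable def underComp (Y : EnrichedCat hS.lift) {n : ℕ} {x : Fin (n + 1) → Y.vertex}
    {a b : Y.vertex} {Z : Fin n → V}
    (h : (underGraph Y.toVGraph).IsPath x a b Z) :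
    (E.tensor n).obj Z ⟶ (Y.hom a b).A :=
  (E.tensor n).map (fun i => eqToHom (h.homs i)) ≫
    hS.coh (fun i => Y.hom (x i.castSucc) (x i.succ)) ≫
      (Y.comp ⟨h.start, h.finish, fun _ => rfl⟩).f

/-- The transports in `underComp` disappear once the sequence is known to underlie the sequence of
hom algebras. -/
theorem underComp_eq (Y : EnrichedCat hS.lift) {n : ℕ} {x : Fin (n + 1) → Y.vertex}
    {a b : Y.vertex} {Z : Fin n → E.unary.Algebra}
    (h : (underGraph Y.toVGraph).IsPath x a b fun i => (Z i).A)
    (h' : Y.IsPath x a b Z) : hS.underComp Y h = hS.coh Z ≫ (Y.comp h').f := by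
  obtain rfl := funext h'.homs
  exact (congrArg (· ≫ _) ((E.tensor n).map_id _)).trans (Category.id_comp _)

theorem comp_edge_eq (Y : EnrichedCat hS.lift) (a b : Y.vertex) :
    Y.comp (VGraph.IsPath.edge Y.toVGraph a b) = 𝟙 (Y.hom a b) :=
  (Category.id_comp _).symm.trans (Y.unit_comp a b)

theorem underComp_edge (Y : EnrichedCat hS.lift) (a b : Y.vertex) :
    hS.underComp Y (VGraph.IsPath.edge (underGraph Y.toVGraph) a b) = act (Y.hom a b) := by
  refine (hS.underComp_eq Y (Z := fun _ => Y.hom a b) _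
    (VGraph.IsPath.edge Y.toVGraph a b)).trans ?_
  rw [hS.comp_edge_eq]
  exact (Category.comp_id _).trans (hS.coh_single _)

/-- The `E`-category underlying a category enriched in the lift of `E`. -/
noncomputable def underObj (Y : EnrichedCat hS.lift) : EnrichedCat E where
  vertex := Y.vertex
  hom a b := (Y.hom a b).A
  comp h := hS.underComp Y h
  unit_comp a b := (congrArg (_ ≫ ·) (hS.underComp_edge Y a b)).trans (unit_act _)
  subst_comp {k m} n hm x := by
    have h₁ : ∀ i, hS.underComp Y (VGraph.IsPath.block (underGraph Y.toVGraph) n hm x i) = _ := fun i =>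
      hS.underComp_eq Y _ (VGraph.IsPath.block Y.toVGraph n hm x i)
    have h₂ := hS.underComp_eq Y (VGraph.IsPath.cuts (underGraph Y.toVGraph) n hm x)
      (VGraph.IsPath.cuts Y.toVGraph n hm x)
    have h₃ := hS.underComp_eq Y (VGraph.IsPath.canonical (underGraph Y.toVGraph) x)
      (VGraph.IsPath.canonical Y.toVGraph x)
    refine (congrArg (_ ≫ ·) h₂).trans (Eq.trans ?_ (congrArg (_ ≫ ·) h₃).symm)
    refine (congrArg (fun f => (E.tensor k).map f ≫ _) (funext h₁)).trans ?_
    refine (congrArg (· ≫ _) ((E.tensor k).map_comp _ _)).trans ?_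
    have h₄ := hS.forget.coh_naturality
      fun i => Y.comp (VGraph.IsPath.block Y.toVGraph n hm x i)
    have h₅ := congrArg Monad.Algebra.Hom.f (Y.subst_comp n hm x)
    have h₆ := hS.forget.subst_coh (IsConcat.canonical n hm
      fun s => Y.hom (x s.castSucc) (x s.succ))
    refine (Category.assoc _ _ _).trans ((congrArg (_ ≫ ·) ((Category.assoc _ _ _).symm.trans
      ((congrArg (· ≫ _) h₄).trans (Category.assoc _ _ _)))).trans ?_)
    refine (congrArg (fun f => _ ≫ _ ≫ f) h₅).trans ?_
    refine Eq.trans ?_ ((congrArg (· ≫ _) h₆).trans (Category.assoc _ _ _))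
    refine Eq.trans ?_ (Category.assoc _ _ _).symm
    exact congrArg (_ ≫ ·) (Category.assoc _ _ _).symm

/-- The functor from categories enriched in the lift of `E` to `E`-categories. -/
noncomputable def underFunctor : EnrichedCat hS.lift ⥤ EnrichedCat E where
  obj Y := hS.underObj Y
  map {X Y} f :=
    { toGraphHom :=
        { onVertex := (EnrichedCat.Hom.toGraphHom f).onVertex
          onHom := fun a b => ((EnrichedCat.Hom.toGraphHom f).onHom a b).f }
      map_comp := fun {n} x => by
        have h₃ := hS.underComp_eq Y
          (VGraph.IsPath.canonical (underGraph Y.toVGraph) fun i =>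
            (EnrichedCat.Hom.toGraphHom f).onVertex (x i))
          (VGraph.IsPath.canonical Y.toVGraph _)
        have h₄ := hS.underComp_eq X (VGraph.IsPath.canonical (underGraph X.toVGraph) x)
          (VGraph.IsPath.canonical X.toVGraph x)
        refine (congrArg (_ ≫ ·) h₃).trans (Eq.trans ?_ (congrArg (· ≫ _) h₄).symm)
        have h₁ := hS.forget.coh_naturality (fun i : Fin n =>
          (EnrichedCat.Hom.toGraphHom f).onHom (x i.castSucc) (x i.succ))
        have h₂ := congrArg Monad.Algebra.Hom.f (EnrichedCat.Hom.map_comp f x)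
        refine (Category.assoc _ _ _).symm.trans ((congrArg (· ≫ _) h₁).trans ?_)
        refine (Category.assoc _ _ _).trans ((congrArg (_ ≫ ·) h₂).trans ?_)
        exact (Category.assoc _ _ _).symm }
  map_id X := rfl
  map_comp f g := rfl

/-- One-step compositions over the lift are identities, so the algebra structure recovered on a hom
is the original one. -/
theorem homAlgebra_underObj (Y : EnrichedCat hS.lift) : (hS.underObj Y).homAlgebra = Y.hom :=
  funext fun a => funext fun b => Monad.Algebra.mk_eq (hS.underComp_edge Y a b)

theorem underFunctor_comp_toAlgebraGraph :
    hS.underFunctor ⋙ EnrichedCat.toAlgebraGraph E = EnrichedCat.forget hS.lift :=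
  CategoryTheory.Functor.hext
    (fun Y => congrArg (VGraph.mk Y.vertex) (hS.homAlgebra_underObj Y))
    fun X Y f => VGraph.mk_heq_mk (hS.homAlgebra_underObj X) (hS.homAlgebra_underObj Y)
      (φ := (EnrichedCat.Hom.toGraphHom f).onVertex) fun _ _ => HEq.rfl

/-- The composition after the round trip is `coh` followed by `ext`, which by `coh_ext` is the
original one. -/
theorem underObj_liftObj (X : EnrichedCat E) : hS.underObj (hS.liftObj X) = X := by
  refine EnrichedCat.mk_eq_mk (t := X.vertex) (hom' := X.hom) rfl fun {n} x => ?_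
  have hx := VGraph.IsPath.canonical (VGraph.mk X.vertex X.homAlgebra) x
  refine (Category.comp_id _).trans ?_
  refine (hS.underComp_eq (hS.liftObj X) _ hx).trans ?_
  refine (hS.coh_ext (Z := X.toOCat) hx.monoPath _).trans ?_
  exact congrArg (_ ≫ ·) (X.toOCat_comp (VGraph.IsPath.canonical X.toVGraph x) hx.monoPath)

theorem liftFunctor_comp_underFunctor : hS.liftFunctor ⋙ hS.underFunctor = 𝟭 _ :=
  CategoryTheory.Functor.hext hS.underObj_liftObj fun X Y _ =>
    EnrichedCat.hom_heq (hS.underObj_liftObj X) (hS.underObj_liftObj Y) HEq.rfl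

/-- By `comp_eq_ext` the compositions of `Y` are determined by its underlying `E`-category. The hom
algebras agree by a propositional equality only, and `φ` carries out the transport. -/
theorem liftObj_underObj (Y : EnrichedCat hS.lift) : hS.liftObj (hS.underObj Y) = Y := by
  have hH := hS.homAlgebra_underObj Y
  refine EnrichedCat.mk_eq_mk (t := Y.vertex) (hom' := Y.hom) hH fun {n} x => ?_
  have hx := (VGraph.IsPath.canonical Y.toVGraph x).monoPath
  have hf : ∀ a b, (eqToHom (congrFun (congrFun hH a) b)).f = 𝟙 (Y.hom a b).A := fun a b =>
    Monad.Algebra.eqToHom_f _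
  let φ : (hS.underObj Y).toOCat ⟶ hS.under Y.toOCat :=
    { app := fun {p q} _ => eqToHom (congrFun (congrFun hH p) q)
      app_comp := fun {k c d a b} h => by
        refine (congrArg (fun g => (E.tensor k).map g ≫ _)
          (funext fun i => hf (c i) (d i))).trans (Eq.trans ?_ (congrArg (_ ≫ ·) (hf a b)).symm)
        refine (congrArg (· ≫ _) ((E.tensor k).map_id _)).trans ((Category.id_comp _).trans ?_)
        refine Eq.trans ?_ (Category.comp_id _).symm
        exact (hS.underComp_eq Y ((hS.underObj Y).isPath h) (Y.isPath h)).symm }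
  refine (hS.ext_comp (Z := (hS.underObj Y).toOCat) φ hx _).trans ?_
  have h₁ := (Y.toOCat_comp (VGraph.IsPath.canonical Y.toVGraph x) hx).symm.trans
    (hS.comp_eq_ext Y.toOCat hx)
  refine Eq.trans ?_ (congrArg (_ ≫ ·) h₁).symm
  refine Eq.trans ?_ (hS.map_ext (Z := hS.under Y.toOCat) _ hx _).symm
  refine congrArg (hS.ext (Z := hS.under Y.toOCat) hx) (funext fun j => ?_)
  exact (Category.id_comp _).trans (Category.comp_id _).symm

theorem underFunctor_comp_liftFunctor : hS.underFunctor ⋙ hS.liftFunctor = 𝟭 _ :=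
  CategoryTheory.Functor.hext hS.liftObj_underObj fun X Y f =>
    EnrichedCat.hom_heq (hS.liftObj_underObj X) (hS.liftObj_underObj Y)
      (VGraph.mk_heq_mk (hS.homAlgebra_underObj X) (hS.homAlgebra_underObj Y)
        (φ := (EnrichedCat.Hom.toGraphHom f).onVertex) fun _ _ => HEq.rfl)

/-- The lifted multitensor is a lift in the sense of `Multitensor.IsLift`. -/
theorem isLift_lift [HasColimitsOfSize.{v, v} V] [HasColimitsOfSize.{v, v} E.unary.Algebra]
    (hE : E.IsDistributive) : E.IsLift hS.lift where
  isFunctorOperad := hS.isFunctorOperad_lift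
  isDistributive := hS.isDistributive_lift hE
  isCardinalAccessible κ _ h := hS.isCardinalAccessible_lift κ h
  enrichedCat_iso := ⟨hS.underFunctor, hS.liftFunctor, hS.underFunctor_comp_liftFunctor,
    hS.liftFunctor_comp_underFunctor, hS.underFunctor_comp_toAlgebraGraph⟩

end Multitensor.HasFree

/-! ### Lifting lax monoidal functors out of functor operads -/

namespace Multitensor.IsFunctorOperad

theorem _root_.CategoryTheory.Monad.isIso_unit_of_eq_id {W : Type u} [Category.{v} W]
    {M : CategoryTheory.Monad W}
    (h : M = Monad.id W) (X : W) : IsIso (M.η.app X) := by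
  subst h
  exact inferInstanceAs (IsIso (𝟙 X))

variable {W : Type u} [Category.{v} W] {F : Multitensor W} (hF : F.IsFunctorOperad)

include hF in
theorem isIso_unit (X : W) : IsIso (F.unit X) := Monad.isIso_unit_of_eq_id hF X

include hF in
theorem unit_hom_ext {X Y : W} {f g : (F.tensor 1).obj (fun _ => X) ⟶ Y}
    (h : F.unit X ≫ f = F.unit X ≫ g) : f = g := by
  have := hF.isIso_unit X
  exact (cancel_epi (F.unit X)).1 h

/-- The inverse of the unit of a functor operad. -/
noncomputable def counit (X : W) : (F.tensor 1).obj (fun _ => X) ⟶ X :=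
  have := hF.isIso_unit X
  inv (F.unit X)

theorem unit_counit (X : W) : F.unit X ≫ hF.counit X = 𝟙 X :=
  have := hF.isIso_unit X
  IsIso.hom_inv_id (F.unit X)

/-- The unit is invertible, so the unit law leaves room for one algebra structure on each object. -/
theorem act_eq_counit (X : F.unary.Algebra) : act X = hF.counit X.A :=
  hF.unit_hom_ext ((unit_act X).trans (hF.unit_counit X.A).symm)

theorem counit_naturality {X Y : W} (f : X ⟶ Y) :
    (F.tensor 1).map (fun _ => f) ≫ hF.counit Y = hF.counit X ≫ f := by
  refine hF.unit_hom_ext ?_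
  refine (Category.assoc _ _ _).symm.trans ((congrArg (· ≫ _) (F.unit_naturality f).symm).trans ?_)
  refine (Category.assoc _ _ _).trans ((congrArg (_ ≫ ·) (hF.unit_counit Y)).trans ?_)
  refine (Category.comp_id _).trans ((Category.id_comp _).symm.trans ?_)
  exact (congrArg (· ≫ _) (hF.unit_counit X).symm).trans (Category.assoc _ _ _)

/-- Every object is an algebra for the unary part of a functor operad. -/
noncomputable def algebra : W ⥤ F.unary.Algebra where
  obj X :=
    { A := X
      a := hF.counit X
      unit := hF.unit_counit X
      assoc := by
        refine hF.unit_hom_ext ?_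
        refine (Category.assoc _ _ _).symm.trans
          ((congrArg (· ≫ _) (F.unit_outer fun _ : Fin 1 => X)).trans ?_)
        refine Eq.trans ?_ ((congrArg (· ≫ _) (F.unit_naturality (hF.counit X))).trans
          (Category.assoc _ _ _))
        refine (Category.id_comp _).trans ?_
        refine Eq.trans ?_ (Category.assoc _ _ _).symm
        exact ((congrArg (_ ≫ ·) (hF.unit_counit X)).trans (Category.comp_id _)).symm }
  map f := { f := f, h := hF.counit_naturality f }
  map_id _ := rfl
  map_comp _ _ := rfl

end Multitensor.IsFunctorOperad

namespace LaxMonCat.Hom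

variable {A B : LaxMonCat.{v, u}} (H : LaxMonCat.Hom A B) (hA : A.mult.IsFunctorOperad)

/-- A lax monoidal functor out of a functor operad factors through the category of algebras for
the unary part of its target. -/
noncomputable abbrev toAlgebra : A.carrier ⥤ B.mult.unary.Algebra := hA.algebra ⋙ H.mapAlgebra

/-- Base change of ordered categories enriched in a functor operad. -/
noncomputable def baseChange {I : Type w₁} [Preorder I] (Y : OCat A.mult I) : OCat B.mult I where
  hom p q := (H.toAlgebra hA).obj (Y.hom p q).A
  comp h := (H.mapOCat Y).comp h
  comp_edge {p q} h := by
    refine ((H.mapOCat Y).comp_edge h).trans ?_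
    exact congrArg (fun f => H.coh _ ≫ H.functor.map f) (hA.act_eq_counit (Y.hom p q))
  comp_subst hc hd h h' h₂ := (H.mapOCat Y).comp_subst hc hd h h' h₂

/-- Base change of morphisms. -/
noncomputable def baseChangeMap {I : Type w₁} [Preorder I] {X Y : OCat A.mult I} (φ : X ⟶ Y) :
    H.baseChange hA X ⟶ H.baseChange hA Y where
  app h := (H.toAlgebra hA).map (OCat.Hom.app φ h).f
  app_comp h := OCat.Hom.app_comp (H.mapOCatMap φ) h

end LaxMonCat.Hom

namespace Multitensor.HasFree

variable {V : Type (max v u)} [Category.{v} V] {E : Multitensor V} (hS : E.HasFree) {n : ℕ}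
  {A : LaxMonCat.{v, max v u}} (H : LaxMonCat.Hom A (LaxMonCat.mk V E))
  (hA : A.mult.IsFunctorOperad)

/-- The coherences of the lift of a lax monoidal functor. -/
noncomputable def sharpCoh (X : Fin n → A.carrier) :
    hS.obj (fun i => (H.toAlgebra hA).obj (X i)) ⟶
      (H.toAlgebra hA).obj ((A.mult.tensor n).obj X) :=
  hS.ext (Z := H.baseChange hA (OCat.ofSeq A.mult X)) (MonoPath.succ_step n)
    fun j => (H.toAlgebra hA).map (OCat.gen (E := A.mult) X j rfl rfl)

/-- `sharpCoh` is the case of the free ordered category on `X`; the general case follows by base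
change of the morphism extending `f`. -/
theorem sharpCoh_comp {I : Type w₁} [Preorder I] (Z : OCat A.mult I) {X : Fin n → A.carrier}
    {c d : Fin n → I} {a b : I} (h : MonoPath c d a b) (f : ∀ j, X j ⟶ (Z.hom (c j) (d j)).A) :
    hS.sharpCoh H hA X ≫ (H.toAlgebra hA).map ((A.mult.tensor n).map f ≫ Z.comp h) =
      hS.ext (Z := H.baseChange hA Z) h fun j => (H.toAlgebra hA).map (f j) := by
  obtain ⟨x, hx, rfl, rfl, hc, hd⟩ := h
  obtain rfl := funext hc
  obtain rfl := funext hd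
  let φ : OCat.ofSeq A.mult X ⟶ Z.pull hx := OCat.seqDesc (E := A.mult) (Y := Z.pull hx) f
  refine (hS.ext_comp (H.baseChangeMap hA φ) (MonoPath.succ_step n) _).trans ?_
  refine Eq.trans ?_ (hS.ext_map (Z := H.baseChange hA Z) hx (MonoPath.succ_step n)
    (fun j => (H.toAlgebra hA).map (f j))).symm
  refine congrArg (hS.ext (Z := H.baseChange hA (Z.pull hx)) _) (funext fun j => ?_)
  refine ((H.toAlgebra hA).map_comp _ _).symm.trans (congrArg (H.toAlgebra hA).map ?_)
  exact OCat.gen_seqDesc (E := A.mult) (Y := Z.pull hx) f j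

/-- A lax monoidal functor out of a functor operad lifts to the category of algebras. -/
noncomputable def sharp : LaxMonCat.Hom A hS.algebraCat where
  functor := H.toAlgebra hA
  coh X := hS.sharpCoh H hA X
  coh_naturality {n X Y} f := by
    refine (hS.map_ext _ _ _).trans ?_
    have h₁ := hS.sharpCoh_comp H hA (OCat.ofSeq A.mult Y) (MonoPath.succ_step n)
      fun j => f j ≫ OCat.gen (E := A.mult) Y j rfl rfl
    have h₂ : (A.mult.tensor n).map (fun j => f j ≫ OCat.gen (E := A.mult) Y j rfl rfl) ≫
        (OCat.ofSeq A.mult Y).comp (MonoPath.succ_step n) = (A.mult.tensor n).map f := by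
      refine (congrArg (· ≫ _) ((A.mult.tensor n).map_comp _ _)).trans ?_
      refine (Category.assoc _ _ _).trans ?_
      exact (congrArg (_ ≫ ·) (OCat.map_gen_comp (E := A.mult) Y
        (Fin.zero_le (Fin.last n)))).trans (Category.comp_id _)
    refine Eq.trans ?_ (h₁.symm.trans
      (congrArg (fun g => hS.sharpCoh H hA X ≫ (H.toAlgebra hA).map g) h₂))
    refine congrArg (hS.ext (Z := H.baseChange hA (OCat.ofSeq A.mult Y)) _) (funext fun j => ?_)
    exact ((H.toAlgebra hA).map_comp _ _).symm
  unit_coh X := by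
    refine (hS.unit_ext (X := (H.toAlgebra hA).obj X)
      (Z := H.baseChange hA (OCat.ofSeq A.mult fun _ : Fin 1 => X)) (MonoPath.succ_step 1) _).trans ?_
    exact congrArg (H.toAlgebra hA).map (A.mult.unitCast_eq X)
  subst_coh {k n Y m X} h := by
    have h₁ : ∀ i, hS.sharpCoh H hA (Y i) ≫ (H.toAlgebra hA).map
        ((A.mult.tensor (n i)).map (fun j => eqToHom (h.entry_eq i j) ≫
          OCat.gen (E := A.mult) X (blockPos n h.length_eq i j) rfl rfl) ≫
            (OCat.ofSeq A.mult X).comp (MonoPath.block h.length_eq monotone_id i)) = _ :=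
      fun i => hS.sharpCoh_comp H hA (OCat.ofSeq A.mult X) _ _
    have h₂ := hS.sharpCoh_comp H hA (OCat.ofSeq A.mult X) (MonoPath.cuts h.length_eq monotone_id)
      fun i => (A.mult.tensor (n i)).map (fun j => eqToHom (h.entry_eq i j) ≫
          OCat.gen (E := A.mult) X (blockPos n h.length_eq i j) rfl rfl) ≫
            (OCat.ofSeq A.mult X).comp (MonoPath.block h.length_eq monotone_id i)
    -- Substitution is recovered by composing the generators of the free ordered category block by
    -- block.
    have h₃ : (A.mult.tensor k).map (fun i => (A.mult.tensor (n i)).map (fun j =>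
        eqToHom (h.entry_eq i j) ≫ OCat.gen (E := A.mult) X (blockPos n h.length_eq i j) rfl rfl) ≫
            (OCat.ofSeq A.mult X).comp (MonoPath.block h.length_eq monotone_id i)) ≫
        (OCat.ofSeq A.mult X).comp (MonoPath.cuts h.length_eq monotone_id) = A.mult.subst h := by
      refine (congrArg (· ≫ _) ((A.mult.tensor k).map_comp _ _)).trans ?_
      refine (Category.assoc _ _ _).trans ((congrArg (_ ≫ ·) ((OCat.ofSeq A.mult X).comp_subst
        (IsConcat.canonical n h.length_eq Fin.castSucc)
        (IsConcat.canonical n h.length_eq Fin.succ) (MonoPath.succ_step m) _ _)).trans ?_)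
      refine (Category.assoc _ _ _).symm.trans ?_
      refine (congrArg (· ≫ _) (A.mult.subst_naturality_of_heq h _ _
        (fun s => OCat.gen (E := A.mult) X s rfl rfl) fun i j => eqToHom_comp_heq _ _)).trans ?_
      refine (Category.assoc _ _ _).trans ?_
      exact (congrArg (_ ≫ ·) (OCat.map_gen_comp (E := A.mult) X
        (Fin.zero_le (Fin.last m)))).trans (Category.comp_id _)
    rw [h₃] at h₂
    refine (congrArg (_ ≫ ·) h₂).trans ((hS.map_ext _ _ _).trans ?_)
    refine (congrArg (hS.ext (Z := H.baseChange hA (OCat.ofSeq A.mult X)) _) (funext h₁)).trans ?_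
    refine (hS.subst_ext (Z := H.baseChange hA (OCat.ofSeq A.mult X)) (h.map (H.toAlgebra hA).obj)
      (IsConcat.canonical n h.length_eq Fin.castSucc) (IsConcat.canonical n h.length_eq Fin.succ)
      (MonoPath.succ_step m) _ _ _ _ fun i j => ?_).symm
    have h₄ : ∀ {X Y Z : A.carrier} (e : X = Y) (f : Y ⟶ Z),
        HEq ((H.toAlgebra hA).map (eqToHom e ≫ f)) ((H.toAlgebra hA).map f) := by
      rintro X _ Z rfl f
      exact heq_of_eq (congrArg _ (Category.id_comp f))
    exact h₄ _ _

/-- By `coh_ext`, the underlying coherence is a composition in the base change of `ofSeq`; the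
composite of the generators is the identity, so the coherence of `H` remains. -/
theorem sharp_comp_forget :
    (CategoryStruct.comp (obj := LaxMonCat) (hS.sharp H hA) hS.forget : LaxMonCat.Hom A _) = H := by
  refine LaxMonCat.hom_eq fun {n} X => ?_
  refine (hS.coh_ext (Z := H.baseChange hA (OCat.ofSeq A.mult X)) (MonoPath.succ_step n) _).trans ?_
  refine (Category.assoc _ _ _).symm.trans ?_
  refine (congrArg (· ≫ _) (H.coh_naturality fun j =>
    OCat.gen (E := A.mult) X j rfl rfl)).trans ?_
  refine (Category.assoc _ _ _).trans ?_
  refine (congrArg (_ ≫ ·) (H.functor.map_comp _ _).symm).trans ?_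
  refine (congrArg (fun f => _ ≫ H.functor.map f) (OCat.map_gen_comp (E := A.mult) X
    (Fin.zero_le (Fin.last n)))).trans ?_
  exact (congrArg (_ ≫ ·) (H.functor.map_id _)).trans (Category.comp_id _)

end Multitensor.HasFree

/-! ### Uniqueness of lifts of lax monoidal functors -/

namespace LaxMonCat

theorem eq_of_natTrans_app_eq {A B : LaxMonCat.{v, u}} {H K : A ⟶ B} (θ : H ⟶ K)
    (h : ∀ X, (Hom.functor H).obj X = (Hom.functor K).obj X)
    (hθ : ∀ X, (Hom₂.natTrans θ).app X = eqToHom (h X)) : H = K := by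
  obtain ⟨H, c, h₁, h₂, h₃⟩ := H
  obtain ⟨K, c', h₁', h₂', h₃'⟩ := K
  have e : H = K := CategoryTheory.Functor.ext h fun X Y f => by
    have := θ.natTrans.naturality f
    rw [hθ, hθ] at this
    have h' : (eqToHom (h Y) : H.obj Y ⟶ K.obj Y) ≫ eqToHom (h Y).symm = 𝟙 _ := by simp
    refine (Category.comp_id _).symm.trans ((congrArg (H.map f ≫ ·) h'.symm).trans ?_)
    refine (Category.assoc _ _ _).symm.trans ((congrArg (· ≫ _) this).trans ?_)
    exact Category.assoc _ _ _
  subst e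
  refine hom_eq fun {n} X => ?_
  have := θ.coh_natTrans X
  have h' : (fun i => θ.natTrans.app (X i)) = 𝟙 fun i => H.obj (X i) :=
    funext fun i => hθ (X i)
  rw [h', hθ] at this
  exact ((Category.comp_id _).symm.trans this.symm).trans
    ((congrArg (· ≫ _) ((B.mult.tensor n).map_id _)).trans (Category.id_comp _))

end LaxMonCat

/-- If the underlying map is an identity up to transport, compatibility with the actions says that
the structure maps coincide. -/
theorem CategoryTheory.Monad.Algebra.eq_of_hom {V : Type u} [Category.{v} V]
    {M : CategoryTheory.Monad V} {X Y : M.Algebra} (f : X ⟶ Y) (h : X.A = Y.A)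
    (hf : f.f = eqToHom h) : ∃ e : X = Y, f = eqToHom e := by
  obtain ⟨X, x, hx, hx'⟩ := X
  obtain ⟨Y, y, hy, hy'⟩ := Y
  obtain rfl : X = Y := h
  have hf' : f.f = 𝟙 X := hf
  have h₁ := f.h
  rw [hf', M.map_id] at h₁
  obtain rfl : x = y := ((Category.comp_id x).symm.trans h₁.symm).trans (Category.id_comp y)
  exact ⟨rfl, Monad.Algebra.Hom.ext hf⟩

namespace Multitensor.HasFree

variable {V : Type (max v u)} [Category.{v} V] {E : Multitensor V} (hS : E.HasFree) {n : ℕ}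
  {A : LaxMonCat.{v, max v u}} {H K : A ⟶ hS.algebraCat}

/-- The underlying lax monoidal functor of a lax monoidal functor to algebras. -/
noncomputable abbrev compForget (H : A ⟶ hS.algebraCat) : A ⟶ LaxMonCat.mk V E :=
  H ≫ (show hS.algebraCat ⟶ LaxMonCat.mk V E from hS.forget)

/-- A monoidal natural transformation of underlying functors induces morphisms of ordered
categories. -/
noncomputable def underNatTrans (θ : hS.compForget H ⟶ hS.compForget K) {I : Type w₁} [Preorder I]
    (Y : OCat A.mult I) :
    hS.under (LaxMonCat.Hom.mapOCat H Y) ⟶ hS.under (LaxMonCat.Hom.mapOCat K Y) :=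
  OCat.Hom.ofMaps (fun {p q} _ => (LaxMonCat.Hom₂.natTrans θ).app (Y.hom p q).A)
    fun {k c d a b} h => by
      have h₁ := LaxMonCat.Hom₂.coh_natTrans θ (fun i => (Y.hom (c i) (d i)).A)
      have h₂ := (LaxMonCat.Hom₂.natTrans θ).naturality (Y.comp h)
      refine (congrArg (_ ≫ ·) (Category.assoc _ _ _).symm).trans ?_
      refine (Category.assoc _ _ _).symm.trans ((congrArg (· ≫ _) h₁).trans ?_)
      refine (Category.assoc _ _ _).trans ((congrArg (_ ≫ ·) h₂.symm).trans ?_)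
      refine (Category.assoc _ _ _).symm.trans (congrArg (· ≫ _) ?_)
      exact Category.assoc _ _ _

/-- Coherences are compositions in the base change of `ofSeq` evaluated on generators, and
`comp_eq_ext` determines these from the underlying ordered category. The uniqueness of lifts rests
on this. -/
theorem coh_eq_ext (H : A ⟶ hS.algebraCat) (X : Fin n → A.carrier) :
    LaxMonCat.Hom.coh H X = hS.ext (Z := hS.under (LaxMonCat.Hom.mapOCat H (OCat.ofSeq A.mult X)))
      (MonoPath.succ_step n)
      fun j => (LaxMonCat.Hom.functor H).map (OCat.gen (E := A.mult) X j rfl rfl) := by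
  have h₁ := LaxMonCat.Hom.coh_naturality H fun j => OCat.gen (E := A.mult) X j rfl rfl
  have h₂ := OCat.map_gen_comp (E := A.mult) X (Fin.zero_le (Fin.last n))
  have h₃ := hS.comp_eq_ext (LaxMonCat.Hom.mapOCat H (OCat.ofSeq A.mult X)) (MonoPath.succ_step n)
  refine (Category.comp_id _).symm.trans ?_
  refine (congrArg (_ ≫ ·) ((LaxMonCat.Hom.functor H).map_id _).symm).trans ?_
  refine (congrArg (fun f => LaxMonCat.Hom.coh H X ≫ (LaxMonCat.Hom.functor H).map f)
    h₂.symm).trans ?_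
  refine (congrArg (_ ≫ ·) ((LaxMonCat.Hom.functor H).map_comp _ _)).trans ?_
  refine (Category.assoc _ _ _).symm.trans ((congrArg (· ≫ _) h₁.symm).trans ?_)
  refine (Category.assoc _ _ _).trans ((congrArg (_ ≫ ·) h₃).trans ?_)
  refine (hS.map_ext _ _ _).trans (congrArg (hS.ext _) (funext fun j => ?_))
  exact Category.comp_id _

variable (hA : A.mult.IsFunctorOperad)

/-- The components of the lift of a monoidal natural transformation. -/
noncomputable def liftApp (θ : hS.compForget H ⟶ hS.compForget K) (X : A.carrier) :
    (LaxMonCat.Hom.functor H).obj X ⟶ (LaxMonCat.Hom.functor K).obj X :=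
  -- To exhibit `θ` at `X` as a map of algebras, it is written as a composite of such maps: the
  -- middle one is `θ` at `A₁ X`, a hom of a free ordered category, and the outer two cancel by
  -- naturality.
  (LaxMonCat.Hom.functor H).map (A.mult.unit X) ≫
    OCat.Hom.app (hS.underNatTrans θ (OCat.ofSeq A.mult fun _ : Fin 1 => X))
      (Fin.zero_le (Fin.last 1)) ≫ (LaxMonCat.Hom.functor K).map (hA.counit X)

theorem liftApp_f (θ : hS.compForget H ⟶ hS.compForget K) (X : A.carrier) :
    (hS.liftApp hA θ X).f = (LaxMonCat.Hom₂.natTrans θ).app X := by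
  have h₁ := (LaxMonCat.Hom₂.natTrans θ).naturality (hA.counit X)
  refine (congrArg (_ ≫ ·) h₁.symm).trans ((Category.assoc _ _ _).symm.trans ?_)
  refine (congrArg (· ≫ _) (((LaxMonCat.Hom.functor (hS.compForget H)).map_comp
    (A.mult.unit X) (hA.counit X)).symm.trans ?_)).trans (Category.id_comp _)
  rw [hA.unit_counit]
  exact (LaxMonCat.Hom.functor (hS.compForget H)).map_id X

/-- The lift of a monoidal natural transformation. -/
noncomputable def liftHom₂ (θ : hS.compForget H ⟶ hS.compForget K) : H ⟶ K :=
  LaxMonCat.Hom₂.mk (H := H) (K := K)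
    { app := hS.liftApp hA θ
      naturality := fun X Y f => Monad.Algebra.Hom.ext (by
        refine (congrArg (_ ≫ ·) (hS.liftApp_f hA θ Y)).trans
          (Eq.trans ?_ (congrArg (· ≫ _) (hS.liftApp_f hA θ X).symm))
        exact (LaxMonCat.Hom₂.natTrans θ).naturality f) }
    fun {n} X => by
      have h₁ := hS.coh_eq_ext H X
      have h₂ := hS.coh_eq_ext K X
      have h₃ : hS.liftApp hA θ ((A.mult.tensor n).obj X) =
          OCat.Hom.app (hS.underNatTrans θ (OCat.ofSeq A.mult X)) (Fin.zero_le (Fin.last n)) :=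
        Monad.Algebra.Hom.ext (hS.liftApp_f hA θ _)
      refine (congrArg (_ ≫ ·) h₂).trans (Eq.trans ?_ (congrArg₂ (· ≫ ·) h₁ h₃).symm)
      refine (hS.map_ext _ _ _).trans (Eq.trans ?_ (hS.ext_comp _ _ _).symm)
      refine congrArg (hS.ext _) (funext fun j => Monad.Algebra.Hom.ext ?_)
      refine (congrArg (· ≫ _) (hS.liftApp_f hA θ (X j))).trans ?_
      exact ((LaxMonCat.Hom₂.natTrans θ).naturality (OCat.gen (E := A.mult) X j rfl rfl)).symm

theorem liftHom₂_whiskerRight (θ : hS.compForget H ⟶ hS.compForget K) :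
    hS.liftHom₂ hA θ ▷ (show hS.algebraCat ⟶ LaxMonCat.mk V E from hS.forget) = θ :=
  LaxMonCat.Hom₂.ext (NatTrans.ext (funext fun X => hS.liftApp_f hA θ X))

theorem whiskerRight_forget_injective {θ θ' : H ⟶ K}
    (h : θ ▷ (show hS.algebraCat ⟶ LaxMonCat.mk V E from hS.forget) =
      θ' ▷ (show hS.algebraCat ⟶ LaxMonCat.mk V E from hS.forget)) : θ = θ' :=
  LaxMonCat.Hom₂.ext (NatTrans.ext (funext fun X => Monad.Algebra.Hom.ext
    (congrArg (fun η => (LaxMonCat.Hom₂.natTrans η).app X) h)))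

-- The 2-cell `eqToHom h` lifts to one from `H` to `K` whose components are again identities up to
-- transport.
include hA in
theorem compForget_injective (h : hS.compForget H = hS.compForget K) : H = K := by
  have key := fun X => Monad.Algebra.eq_of_hom (hS.liftApp hA (eqToHom h) X) _
    ((hS.liftApp_f hA _ X).trans (LaxMonCat.eqToHom_natTrans_app h X))
  exact LaxMonCat.eq_of_natTrans_app_eq (hS.liftHom₂ hA (eqToHom h))
    (fun X => (key X).choose) fun X => (key X).choose_spec

end Multitensor.HasFree

/-! ### 2-adjunctions from universal arrows -/

namespace CategoryTheory.Functor

section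

variable {X : Type u₁} [Category.{v₁} X] {Y : Type u₂} [Category.{v₂} Y] (P : X ⥤ Y)

/-- The strict inverse of a fully faithful functor which is bijective on objects. -/
noncomputable def strictInverse [P.Full] [P.Faithful] (hP : Function.Bijective P.obj) : Y ⥤ X where
  obj y := (hP.2 y).choose
  map {y y'} θ := P.preimage
    (eqToHom (hP.2 y).choose_spec ≫ θ ≫ eqToHom (hP.2 y').choose_spec.symm)
  map_id y := P.map_injective (by simp)
  map_comp f g := P.map_injective (by simp)

variable [P.Full] [P.Faithful] (hP : Function.Bijective P.obj)

theorem obj_strictInverse_obj (y : Y) : P.obj ((P.strictInverse hP).obj y) = y :=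
  (hP.2 y).choose_spec

theorem map_strictInverse_map_heq {y y' : Y} (θ : y ⟶ y') :
    HEq (P.map ((P.strictInverse hP).map θ)) θ := by
  refine (heq_of_eq (P.map_preimage _)).trans ?_
  exact (eqToHom_comp_heq _ _).trans (comp_eqToHom_heq _ _)

omit [P.Full] in
include hP in
theorem heq_of_map_heq {K L K' L' : X} {κ : K ⟶ L} {κ' : K' ⟶ L'} (h₁ : P.obj K = P.obj K')
    (h₂ : P.obj L = P.obj L') (h : HEq (P.map κ) (P.map κ')) : HEq κ κ' := by
  obtain rfl := hP.1 h₁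
  obtain rfl := hP.1 h₂
  exact heq_of_eq (P.map_injective (eq_of_heq h))

theorem strictInverse_comp : P.strictInverse hP ⋙ P = 𝟭 Y :=
  CategoryTheory.Functor.hext (P.obj_strictInverse_obj hP) fun _ _ => P.map_strictInverse_map_heq hP

theorem comp_strictInverse : P ⋙ P.strictInverse hP = 𝟭 X :=
  CategoryTheory.Functor.hext (fun _ => hP.1 (P.obj_strictInverse_obj hP _)) fun _ _ _ =>
    P.heq_of_map_heq hP (P.obj_strictInverse_obj hP _) (P.obj_strictInverse_obj hP _)
      (P.map_strictInverse_map_heq hP _)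

end

/-- Strict 2-naturality is an equality of functors into functor categories; heterogeneous equality
avoids explicit transports in both variables. -/
theorem hext₂ {X Y Z : Type*} [Category* X] [Category* Y] [Category* Z] {F G : X ⥤ Y ⥤ Z}
    (h : ∀ x y, (F.obj x).obj y = (G.obj x).obj y)
    (h₁ : ∀ x {y y' : Y} (f : y ⟶ y'), HEq ((F.obj x).map f) ((G.obj x).map f))
    (h₂ : ∀ {x x' : X} (f : x ⟶ x') (y : Y), HEq ((F.map f).app y) ((G.map f).app y)) : F = G := by
  refine CategoryTheory.Functor.ext
    (fun x => CategoryTheory.Functor.hext (h x) fun _ _ f => h₁ x f) fun x x' f => ?_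
  ext y
  rw [NatTrans.comp_app, NatTrans.comp_app, eqToHom_app, eqToHom_app]
  exact (conj_eqToHom_iff_heq _ _ (h x y) (h x' y)).2 (h₂ f y)

end CategoryTheory.Functor

/-! ### Whiskering in strict bicategories. -/

namespace CategoryTheory.Bicategory.Strict

variable {B : Type u₁} [Bicategory.{w₁, v₁} B]

theorem whiskerLeft_congr {a b c : B} {f f' : a ⟶ b} {g h g' h' : b ⟶ c} (hf : f = f')
    (hg : g = g') (hh : h = h') {η : g ⟶ h} {η' : g' ⟶ h'} (hη : HEq η η') :
    HEq (f ◁ η) (f' ◁ η') := by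
  subst hf hg hh hη
  rfl

theorem whiskerRight_congr {a b c : B} {f f' : b ⟶ c} {g h g' h' : a ⟶ b} (hf : f = f')
    (hg : g = g') (hh : h = h') {η : g ⟶ h} {η' : g' ⟶ h'} (hη : HEq η η') :
    HEq (η ▷ f) (η' ▷ f') := by
  subst hf hg hh hη
  rfl

/-- In the strict setting the associators are `eqToHom`s, so the bicategorical identities become
heterogeneous equalities without coherence cells. -/
theorem heq_of_eq_eqToHom_comp {X : Type*} [Category* X] {a b c d : X} {f : a ⟶ b} {g : c ⟶ d}
    {h₁ : a = c} {h₂ : d = b} (h : f = eqToHom h₁ ≫ g ≫ eqToHom h₂) : HEq f g := by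
  subst h₁ h₂
  simpa using h

variable [Strict B]

theorem comp_whiskerLeft_heq {a b c d : B} (f : a ⟶ b) (g : b ⟶ c) {h h' : c ⟶ d} (η : h ⟶ h') :
    HEq ((f ≫ g) ◁ η) (f ◁ g ◁ η) := by
  have := comp_whiskerLeft f g η
  rw [associator_eqToIso, associator_eqToIso] at this
  exact heq_of_eq_eqToHom_comp (h₁ := Strict.assoc _ _ _) (h₂ := (Strict.assoc _ _ _).symm) this

theorem whiskerRight_comp_heq {a b c d : B} {f f' : a ⟶ b} (η : f ⟶ f') (g : b ⟶ c) (h : c ⟶ d) :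
    HEq (η ▷ (g ≫ h)) (η ▷ g ▷ h) := by
  have := whiskerRight_comp η g h
  rw [associator_eqToIso, associator_eqToIso] at this
  exact heq_of_eq_eqToHom_comp (h₁ := (Strict.assoc _ _ _).symm) (h₂ := Strict.assoc _ _ _) this

theorem whisker_assoc_heq {a b c d : B} (f : a ⟶ b) {g g' : b ⟶ c} (η : g ⟶ g') (h : c ⟶ d) :
    HEq ((f ◁ η) ▷ h) (f ◁ η ▷ h) := by
  have := whisker_assoc f η h
  rw [associator_eqToIso, associator_eqToIso] at this
  exact heq_of_eq_eqToHom_comp (h₁ := Strict.assoc _ _ _) (h₂ := (Strict.assoc _ _ _).symm) this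

end CategoryTheory.Bicategory.Strict

/-! ### Universal arrows from a 2-functor. -/

namespace CategoryTheory.StrictPseudofunctor

open Bicategory.Strict

variable {B : Type u₁} [Bicategory.{w₁, v₁} B] {C : Type u₂} [Bicategory.{w₂, v₂} C]
  (F : StrictPseudofunctor B C)

theorem map₂_whiskerLeft_heq {a b c : B} (f : a ⟶ b) {g g' : b ⟶ c} (η : g ⟶ g') :
    HEq (F.map₂ (f ◁ η)) (F.map f ◁ F.map₂ η) := by
  have := F.map₂_whisker_left f η
  rw [F.mapComp_eq_eqToIso, F.mapComp_eq_eqToIso] at this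
  exact heq_of_eq_eqToHom_comp (h₁ := F.map_comp _ _) (h₂ := (F.map_comp _ _).symm) this

theorem map₂_whiskerRight_heq {a b c : B} {f f' : a ⟶ b} (η : f ⟶ f') (g : b ⟶ c) :
    HEq (F.map₂ (η ▷ g)) (F.map₂ η ▷ F.map g) := by
  have := F.map₂_whisker_right η g
  rw [F.mapComp_eq_eqToIso, F.mapComp_eq_eqToIso] at this
  exact heq_of_eq_eqToHom_comp (h₁ := F.map_comp _ _) (h₂ := (F.map_comp _ _).symm) this

/-- The functor `B(b, g) ⥤ C(F b, c)` induced by a 1-cell `F g ⟶ c`. -/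
def transpose {g : B} {c : C} (e : F.obj g ⟶ c) (b : B) : (b ⟶ g) ⥤ (F.obj b ⟶ c) :=
  F.mapFunctor b g ⋙ postcomp (F.obj b) e

/-- A family of universal arrows from `F`: 1-cells `F (G c) ⟶ c` such that the induced functors
`B(b, G c) ⥤ C(F b, c)` are isomorphisms of categories. -/
structure UniversalArrows where
  obj : C → B
  arrow (c : C) : F.obj (obj c) ⟶ c
  full (c : C) (b : B) : (F.transpose (arrow c) b).Full
  faithful (c : C) (b : B) : (F.transpose (arrow c) b).Faithful
  bijective (c : C) (b : B) : Function.Bijective (F.transpose (arrow c) b).obj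

namespace UniversalArrows

attribute [instance] full faithful

variable {F} (U : F.UniversalArrows)

/-- The functor induced by composition with a universal arrow. -/
abbrev P (b : B) (c : C) : (b ⟶ U.obj c) ⥤ (F.obj b ⟶ c) := F.transpose (U.arrow c) b

/-- Factorization through a universal arrow. -/
noncomputable def Q (b : B) (c : C) : (F.obj b ⟶ c) ⥤ (b ⟶ U.obj c) :=
  (U.P b c).strictInverse (U.bijective c b)

theorem P_obj_Q {b : B} {c : C} (h : F.obj b ⟶ c) :
    F.map ((U.Q b c).obj h) ≫ U.arrow c = h :=
  (U.P b c).obj_strictInverse_obj (U.bijective c b) h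

theorem P_map_Q {b : B} {c : C} {h h' : F.obj b ⟶ c} (θ : h ⟶ h') :
    HEq (F.map₂ ((U.Q b c).map θ) ▷ U.arrow c) θ :=
  (U.P b c).map_strictInverse_map_heq (U.bijective c b) θ

theorem hom_ext {b : B} {c : C} {f g : b ⟶ U.obj c}
    (h : F.map f ≫ U.arrow c = F.map g ≫ U.arrow c) : f = g :=
  (U.bijective c b).1 h

/-- Equations between 2-cells involving `Q` are proved after composing with the universal arrow,
where `P_map_Q` removes `Q`. -/
theorem hom₂_heq {b : B} {c : C} {f g f' g' : b ⟶ U.obj c} (hf : f = f') (hg : g = g')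
    {η : f ⟶ g} {η' : f' ⟶ g'} (h : HEq (F.map₂ η ▷ U.arrow c) (F.map₂ η' ▷ U.arrow c)) :
    HEq η η' :=
  (U.P b c).heq_of_map_heq (U.bijective c b) (congrArg _ hf) (congrArg _ hg) h

variable [Bicategory.Strict C]

/-- For general `h` this is naturality of the adjunction; when `h` is a universal arrow followed by
a 1-cell, it is functoriality of the right adjoint. -/
theorem comp_Q {b : B} {c c' : C} (h : F.obj b ⟶ c) (g : c ⟶ c') :
    (U.Q b c').obj (h ≫ g) = (U.Q b c).obj h ≫ (U.Q (U.obj c) c').obj (U.arrow c ≫ g) := by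
  refine U.hom_ext ((U.P_obj_Q _).trans ?_)
  rw [F.map_comp, Bicategory.Strict.assoc, U.P_obj_Q, ← Bicategory.Strict.assoc, U.P_obj_Q]

theorem precomp_Q {b' b : B} {c : C} (k : b' ⟶ b) (h : F.obj b ⟶ c) :
    (U.Q b' c).obj (F.map k ≫ h) = k ≫ (U.Q b c).obj h := by
  refine U.hom_ext ((U.P_obj_Q _).trans ?_)
  rw [F.map_comp, Bicategory.Strict.assoc, U.P_obj_Q]

theorem Q_map_whiskerRight {b : B} {c c' : C} {h h' : F.obj b ⟶ c} (θ : h ⟶ h') (g : c ⟶ c') :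
    HEq ((U.Q b c').map (θ ▷ g))
      ((U.Q b c).map θ ▷ (U.Q (U.obj c) c').obj (U.arrow c ≫ g)) := by
  refine U.hom₂_heq (U.comp_Q _ _) (U.comp_Q _ _) ((U.P_map_Q _).trans (HEq.symm ?_))
  refine (whiskerRight_congr rfl (F.map_comp _ _) (F.map_comp _ _)
    (F.map₂_whiskerRight_heq _ _)).trans ?_
  refine (whiskerRight_comp_heq _ _ _).symm.trans ?_
  refine (whiskerRight_congr (U.P_obj_Q _) rfl rfl HEq.rfl).trans ?_
  refine (whiskerRight_comp_heq _ _ _).trans ?_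
  exact whiskerRight_congr rfl (U.P_obj_Q _) (U.P_obj_Q _) (U.P_map_Q θ)

theorem Q_map_whiskerLeft {b : B} {c c' : C} (h : F.obj b ⟶ c) {g g' : c ⟶ c'} (η : g ⟶ g') :
    HEq ((U.Q b c').map (h ◁ η))
      ((U.Q b c).obj h ◁ (U.Q (U.obj c) c').map (U.arrow c ◁ η)) := by
  refine U.hom₂_heq (U.comp_Q _ _) (U.comp_Q _ _) ((U.P_map_Q _).trans (HEq.symm ?_))
  refine (whiskerRight_congr rfl (F.map_comp _ _) (F.map_comp _ _)
    (F.map₂_whiskerLeft_heq _ _)).trans ?_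
  refine (whisker_assoc_heq _ _ _).trans ?_
  refine (whiskerLeft_congr rfl (U.P_obj_Q _) (U.P_obj_Q _) (U.P_map_Q _)).trans ?_
  refine (comp_whiskerLeft_heq _ _ _).symm.trans ?_
  exact whiskerLeft_congr (U.P_obj_Q h) rfl rfl HEq.rfl

theorem Q_map_precomp {b' b : B} {c : C} (k : b' ⟶ b) {h h' : F.obj b ⟶ c} (θ : h ⟶ h') :
    HEq ((U.Q b' c).map (F.map k ◁ θ)) (k ◁ (U.Q b c).map θ) := by
  refine U.hom₂_heq (U.precomp_Q _ _) (U.precomp_Q _ _) ((U.P_map_Q _).trans (HEq.symm ?_))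
  refine (whiskerRight_congr rfl (F.map_comp _ _) (F.map_comp _ _)
    (F.map₂_whiskerLeft_heq _ _)).trans ?_
  refine (whisker_assoc_heq _ _ _).trans ?_
  exact whiskerLeft_congr rfl (U.P_obj_Q _) (U.P_obj_Q _) (U.P_map_Q _)

theorem Q_map_precomp₂ {b' b : B} {c : C} {k k' : b' ⟶ b} (κ : k ⟶ k') (h : F.obj b ⟶ c) :
    HEq ((U.Q b' c).map (F.map₂ κ ▷ h)) (κ ▷ (U.Q b c).obj h) := by
  refine U.hom₂_heq (U.precomp_Q _ _) (U.precomp_Q _ _) ((U.P_map_Q _).trans (HEq.symm ?_))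
  refine (whiskerRight_congr rfl (F.map_comp _ _) (F.map_comp _ _)
    (F.map₂_whiskerRight_heq _ _)).trans ?_
  refine (whiskerRight_comp_heq _ _ _).symm.trans ?_
  exact whiskerRight_congr (U.P_obj_Q _) rfl rfl HEq.rfl

theorem Q_arrow_comp {c c' c'' : C} (f : c ⟶ c') (g : c' ⟶ c'') :
    (U.Q (U.obj c) c'').obj (U.arrow c ≫ f ≫ g) =
      (U.Q (U.obj c) c').obj (U.arrow c ≫ f) ≫ (U.Q (U.obj c') c'').obj (U.arrow c' ≫ g) :=
  (congrArg _ (Bicategory.Strict.assoc _ _ _).symm).trans (U.comp_Q _ _)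

variable [Bicategory.Strict B]

/-- The right 2-adjoint determined by a family of universal arrows. -/
noncomputable def rightAdjoint : StrictPseudofunctor C B :=
  StrictPseudofunctor.mk''
    { obj := U.obj
      map := fun {c c'} g => (U.Q (U.obj c) c').obj (U.arrow c ≫ g)
      map₂ := fun {c c' _ _} η => (U.Q (U.obj c) c').map (U.arrow c ◁ η)
      map₂_id := fun g => by
        rw [whiskerLeft_id, Functor.map_id]
      map₂_comp := fun η θ => by
        rw [whiskerLeft_comp, Functor.map_comp]
      map_id := fun c => by
        refine U.hom_ext ((U.P_obj_Q _).trans ?_)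
        rw [F.map_id, Bicategory.Strict.comp_id, Bicategory.Strict.id_comp]
      map_comp := fun f g => U.Q_arrow_comp f g
      map₂_whisker_left := fun {c c' c''} f {g g'} η => by
        refine (conj_eqToHom_iff_heq _ _ (U.Q_arrow_comp f g) (U.Q_arrow_comp f g')).2 ?_
        refine HEq.trans ?_ (U.Q_map_whiskerLeft (U.arrow c ≫ f) η)
        refine U.hom₂_heq (congrArg _ (Bicategory.Strict.assoc _ _ _).symm)
          (congrArg _ (Bicategory.Strict.assoc _ _ _).symm) ?_
        exact (U.P_map_Q _).trans ((comp_whiskerLeft_heq _ _ _).symm.trans (U.P_map_Q _).symm)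
      map₂_whisker_right := fun {c c' c'' f f'} η g => by
        refine (conj_eqToHom_iff_heq _ _ (U.Q_arrow_comp f g) (U.Q_arrow_comp f' g)).2 ?_
        refine HEq.trans ?_ (U.Q_map_whiskerRight (U.arrow c ◁ η) g)
        refine U.hom₂_heq (congrArg _ (Bicategory.Strict.assoc _ _ _).symm)
          (congrArg _ (Bicategory.Strict.assoc _ _ _).symm) ?_
        exact (U.P_map_Q _).trans ((whisker_assoc_heq _ _ _).symm.trans (U.P_map_Q _).symm) }

/-- The 2-adjunction determined by a family of universal arrows. -/
noncomputable def adjunction : TwoAdjunction F U.rightAdjoint where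
  homFunctor b c := U.Q b c
  invFunctor b c := U.P b c
  hom_inv b c := (U.P b c).strictInverse_comp (U.bijective c b)
  inv_hom b c := (U.P b c).comp_strictInverse (U.bijective c b)
  naturality_right _ _ _ := CategoryTheory.Functor.hext₂ (fun g h => U.comp_Q h g)
    (fun g _ _ θ => U.Q_map_whiskerRight θ g) fun η h => U.Q_map_whiskerLeft h η
  naturality_left _ _ _ := CategoryTheory.Functor.hext₂ (fun k h => U.precomp_Q k h)
    (fun k _ _ θ => U.Q_map_precomp k θ) fun κ h => U.Q_map_precomp₂ κ h

end UniversalArrows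

end CategoryTheory.StrictPseudofunctor

/-! ### The coreflection -/

namespace AccDistMultObj

variable (A : AccDistMultObj.{v, max v u})

/-- Only cocompleteness and accessibility are needed; distributivity enters with the colimits of
algebras. -/
theorem hasFree : A.mult.HasFree := by
  obtain ⟨κ, _, hκ⟩ := A.isAccessible
  have := A.hasColimits
  exact fun n X => OCat.nonempty_free κ hκ X

theorem hasColimits_algebra : HasColimitsOfSize.{v, v} A.mult.unary.Algebra := by
  obtain ⟨κ, _, hκ⟩ := A.isAccessible
  have := A.hasColimits
  exact Multitensor.hasColimits_algebra κ hκ A.isDistributive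

theorem isLift : A.mult.IsLift A.hasFree.lift := by
  have := A.hasColimits
  have := A.hasColimits_algebra
  exact A.hasFree.isLift_lift A.isDistributive

/-- The functor operad on the algebras for the unary part. -/
noncomputable def functorOperad : AccFOpObj.{v, max v u} where
  toLaxMonCat := A.hasFree.algebraCat
  hasColimits := A.hasColimits_algebra
  isDistributive := A.isLift.isDistributive
  isAccessible := by
    obtain ⟨κ, hκ, h⟩ := A.isAccessible
    exact ⟨κ, hκ, A.isLift.isCardinalAccessible κ h⟩
  isFunctorOperad := A.isLift.isFunctorOperad

end AccDistMultObj

namespace AccFOp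

open InducedBicategory

/-- The value of the coreflection on an object. -/
noncomputable abbrev coreflection (A : AccDistMult.{v, max v u}) : AccFOp.{v, max v u} :=
  AccDistMultObj.functorOperad A

/-- The forgetful functors from algebras are universal arrows. -/
noncomputable def universalArrows :
    inclusion.{v, max v u}.UniversalArrows where
  obj := coreflection
  arrow A := mkHom (AccDistMultObj.hasFree A).forget
  -- Composition with the forgetful functor is fully faithful because 2-cells lift uniquely, and
  -- bijective on 1-cells because `sharp` provides lifts and `compForget_injective` their
  -- uniqueness.
  full A B := ⟨fun {K L} θ => ⟨⟨⟨(AccDistMultObj.hasFree A).liftHom₂ B.isFunctorOperad θ.hom⟩⟩,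
    InducedBicategory.hom₂_ext ((AccDistMultObj.hasFree A).liftHom₂_whiskerRight _ _)⟩⟩
  faithful A B := ⟨fun {K L} θ θ' h => InducedBicategory.hom₂_ext (InducedBicategory.hom₂_ext
    ((AccDistMultObj.hasFree A).whiskerRight_forget_injective
      (congrArg InducedBicategory.Hom₂.hom h)))⟩
  bijective A B := by
    refine ⟨fun K L h => InducedBicategory.hom_ext (InducedBicategory.hom_ext
      ((AccDistMultObj.hasFree A).compForget_injective B.isFunctorOperad
        (congrArg InducedBicategory.Hom.hom h))), fun H => ?_⟩
    exact ⟨mkHom (mkHom ((AccDistMultObj.hasFree A).sharp H.hom B.isFunctorOperad)),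
      InducedBicategory.hom_ext ((AccDistMultObj.hasFree A).sharp_comp_forget _ _)⟩

theorem counit_hom (A : AccDistMult.{v, max v u}) :
    (universalArrows.adjunction.counit A).hom = (AccDistMultObj.hasFree A).forget := by
  refine congrArg InducedBicategory.Hom.hom (a₂ := universalArrows.arrow A) ?_
  change inclusion.map (𝟙 (coreflection A)) ≫ _ = _
  rw [inclusion.map_id]
  exact Bicategory.Strict.id_comp _

end AccFOp

theorem mainTheorem5 :
    ∃ (C : StrictPseudofunctor AccDistMult.{v, max v u} AccFOp.{v, max v u})
      (adj : TwoAdjunction AccFOp.inclusion.{v, max v u} C),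
      ∀ A : AccDistMult.{v, max v u},
        ∃ (E' : Multitensor A.mult.unary.Algebra)
          (hobj : (AccFOp.inclusion.obj (C.obj A)).toLaxMonCat =
            LaxMonCat.mk A.mult.unary.Algebra E'),
          A.mult.IsLift E' ∧
          (eqToHom hobj.symm ≫ (adj.counit A).hom).functor = A.mult.unary.forget :=
  ⟨AccFOp.universalArrows.rightAdjoint, AccFOp.universalArrows.adjunction, fun A =>
    -- The two objects agree by definition, so the transport in the statement about the counit is an
    -- identity.
    ⟨(AccDistMultObj.hasFree A).lift, rfl, AccDistMultObj.isLift A, by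
      refine congrArg LaxMonCat.Hom.functor (a₂ := (AccDistMultObj.hasFree A).forget) ?_
      refine (congrArg (· ≫ _) (eqToHom_refl (AccDistMultObj.hasFree A).algebraCat rfl)).trans ?_
      exact (LaxMonCat.id_comp_eq _).trans (AccFOp.counit_hom A)⟩⟩
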